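/- **Setting.** Let $N\ge 1$, $\beta>0$, and let $F\in C^\infty((0,\infty))$, $F(v)=v^{-\beta}+\tilde F(v)$ with $\tilde F(v)=o(v^{-\beta})$ and $\tilde F'(v)=o(v^{-\beta-1})$ as $v\to0^+$. Either (a) $\Omega\ni 0$ is a bounded domain of $\mathbb R^N$, or (b) $\Omega=\mathbb R^N$, $|F(v)|+|F'(v)|\le Ce^{-v}$ for $v$ large, and a constant $\alpha_1>0$ is given. Let $\chi_0\in C^\infty([0,\infty);[0,1])$ with $\chi_0=1$ on $[0,1]$ and $\chi_0=0$ on $[2,\infty)$. Set $$\widehat\Phi(z)=\Big(\beta+1+\tfrac{(\beta+1)^2}{4\beta}|z|^2\Big)^{\frac1{\beta+1}},\quad \Phi=\frac1{\widehat\Phi},\quad \kappa=\Phi(0),\quad \widehat k(\tau)=\Big((\beta+1)(1-\tau)+\tfrac{(\beta+1)^2}{4\beta}\tfrac{K_0^2}{16}\Big)^{\frac1{\beta+1}}.$$ Let $H^*\in C^\infty(\Omega\setminus\{0\})$ be positive with $H^*(x)=\big[\frac{(\beta+1)^2}{8\beta}\frac{|x|^2}{|\log|x||}\big]^{\frac1{\beta+1}}$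 for $0<|x|$ small. In case (a), with $\rho_0=\mathrm{dist}(0,\partial\Omega)$, this formula holds for $0<|x|\le\min(c,\rho_0/4)$ for some $c>0$, $H^*=1$ for $|x|\ge\rho_0/2$ and $\nabla H^*\ne0$ for $0<|x|<\rho_0/2$. In case (b), it holds for $0<|x|\le\min(c,1/2)$ for some $c>0$, $H^*(x)=\alpha_1|x|$ for $|x|\ge1$ and $\nabla H^*\neq0$ for $x\ne0$. Let $\mathbf H$ be the set of positive $g$ on $\Omega$ with $1/g\in L^\infty(\Omega)$ and $g-\psi\in W^{1,\infty}(\Omega)$, where $\psi=0$ in case (a), and in case (b) $\psi\in C^\infty(\mathbb R^N)$, $\psi=0$ for $|x|\le 1$, $\psi=\alpha_1|x|$ for $|x|\ge2$. **Shrinking set.** Let $0\le t_0<T<e^{-1}$, let $K_0,\varepsilon_0,A,\alpha_0,\delta_0,C_0,\eta_0>0$ with $\varepsilon_0\le\frac{K_0}4e^{-1/2}$, and let $\underline\alpha>3$, $\bar\alpha\ge\underline\alpha+1$. For $0<|x|\le\varepsilon_0$ let $\theta(x)\in(0,e^{-1}]$ be the solution of $\frac{K_0}4\sqrt{\theta|\log\theta|}=|x|$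 and $t(x)=T-\theta(x)$. For a function $h$ on $\Omega\times[t_0,T)$ and $s=-\log(T-t)$ put $$q(y,s)=\frac{(T-t)^{\frac1{\beta+1}}}{h(y\sqrt{T-t},t)}-\Phi\Big(\frac y{\sqrt s}\Big)-\frac{N\kappa}{2\beta s}$$ (extended by $0$ outside $\Omega/\sqrt{T-t}$). Put $q_b=\chi_0\big(\frac{|y|}{K_0\sqrt s}\big)q$, $q_e=q-q_b$ and decompose $q_b=q_0+q_1\cdot y+y^{T}q_2y-2\,\mathrm{Tr}\,q_2+q_-$, where, with $\rho(y)=(4\pi)^{-N/2}e^{-|y|^2/4}$, $q_0=\int q_b\rho$, $q_1=\int q_b\frac y2\rho$, $q_2=\int q_b\big(\frac{y y^{T}}8-\frac I4\big)\rho$. Then $h\in S^*(t_0)$ means $h\in C([t_0,T);\mathbf H)$ and, for every $t\in[t_0,T)$: (i) $q(\cdot,s)\in L^\infty(\mathbb R^N)$, $q_0$ and all components of $q_1$ lie in $[-\frac A{s^2},\frac A{s^2}]$, $|q_2|\le\frac{A^2\log s}{s^2}$ (Euclidean matrix norm), $\big\|\frac{q_-}{1+|y|^3}\big\|_{L^\infty}\le\frac{A^{\underline\alpha}\log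 s}{s^{5/2}}$, $\|q_e\|_{L^\infty}\le\frac{A^{\bar\alpha}\log s}{s}$; (ii) for $x\in\Omega$ with $\frac{K_0}4\sqrt{(T-t)|\log(T-t)|}\le|x|\le\varepsilon_0$, $|\xi|\le\alpha_0\sqrt{|\log\theta(x)|}$ with $x+\sqrt{\theta(x)}\,\xi\in\Omega$, and $\tau=\frac{t-t(x)}{\theta(x)}$, the function $k_x(\xi,\tau)=\theta(x)^{-\frac1{\beta+1}}h(x+\sqrt{\theta(x)}\,\xi,t)$ satisfies $|k_x(\xi,\tau)-\widehat k(\tau)|\le\delta_0$ and $|\nabla_\xi k_x(\xi,\tau)|\le\frac{C_0}{\sqrt{|\log\theta(x)|}}$; (iii) for $x\in\Omega$, $|x|\ge\frac{\varepsilon_0}4$: $|h(x,t)-h(x,t_0)|\le\eta_0$ and $|\nabla h(x,t)-\nabla h(x,t_0)|\le\eta_0$. **Proposition.** Let $h>0$ be a classical solution of $\partial_th=\Delta h-F(h)$ on $\Omega\times[t_0,T)$, with $h=1$ on $\partial\Omega$ in case (a), whose value at time $t_0$ is, for some $(d_0,d_1)\in\mathbb R\times\mathbb R^N$, $$h(x,t_0)=(T-t_0)^{\frac1{\beta+1}}\Big[\Phi(z)+(d_0+d_1\cdot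 z)\,\chi_0\Big(\frac{|z|}{K_0/16}\Big)\Big]^{-1}\chi_1(x)+H^*(x)(1-\chi_1(x)),$$ where $z=\frac{x}{\sqrt{(T-t_0)|\log(T-t_0)|}}$ and $\chi_1(x)=\chi_0\Big(\frac{|x|}{(T-t_0)^{1/2}|\log(T-t_0)|^{\gamma}}\Big)$ for some $\gamma\in\mathbb R$ (for instance $\gamma=\beta/2$). Assume that $h\in S^*(t_0)$ and $$\delta_0\le\tfrac12\widehat k(1),\qquad \eta_0\le\tfrac12\inf_{x\in\Omega,\ |x|\ge\varepsilon_0/4}h(x,t_0).$$ Then $h$ extinguishes at time $T$ only at $x=0$: $\lim_{t\to T}h(0,t)=0$, and for every $x\in\Omega\setminus\{0\}$ there is $\omega(x)>0$ with $$\liminf_{t\to T}\ \inf_{|x'-x|\le\omega(x)}h(x',t)>0.$$ Moreover, with $z(x,t)=\frac x{\sqrt{(T-t)|\log(T-t)|}}$: 1. there is $C$ such that for all $t\in[t_0,T)$ $$\Big\|\frac{(T-t)^{\frac1{\beta+1}}}{h(\cdot,t)}-\frac1{\widehat\Phi(z(\cdot,t))}\Big\|_{L^\infty(\Omega)}\le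 C\,\frac{\log|\log(T-t)|}{|\log(T-t)|};$$ 2. for each $K>0$ there is $C(K)$ such that for all $t\in[t_0,T)$, with $\Omega_{t,K}=\{x\in\Omega:|x|\le K\sqrt{(T-t)|\log(T-t)|}\}$, $$\Big\|(T-t)^{-\frac1{\beta+1}+\frac12}\nabla h(\cdot,t)-\frac{(\nabla\widehat\Phi)(z(\cdot,t))}{|\log(T-t)|^{1/2}}\Big\|_{L^\infty(\Omega_{t,K})}\le C(K)\,\frac{\log|\log(T-t)|}{|\log(T-t)|};$$ 3. $h^*(x)=\lim_{t\to T}h(x,t)$ exists for all $x\in\Omega$, and $h^*(x)\sim H^*(x)$ as $x\to0$; 4. $(\nabla h)^*(x)=\lim_{t\to T}\nabla h(x,t)$ exists for all $x\in\Omega\setminus\{0\}$, and $(\nabla h)^*(x)\sim\nabla H^*(x)$ as $x\to0$, i.e. $|(\nabla h)^*(x)-\nabla H^*(x)|=o(|\nabla H^*(x)|)$. -/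

import Mathlib

open Set Filter Topology MeasureTheory Asymptotics
open scoped ContDiff

noncomputable section

namespace Quench

/-- Euclidean space `ℝ^N`. -/
abbrev E (N : ℕ) := EuclideanSpace ℝ (Fin N)

variable {N : ℕ}

/-! ### The nonlinearity, the cut-off and the profiles -/

/-- `F ∈ C^∞((0,∞))` and `F(h) = h^{-β} + F̃(h)` with `F̃(h) = o(h^{-β})` and
`F̃'(h) = o(h^{-β-1})` as `h → 0⁺`. -/
structure IsNonlinearity (β : ℝ) (F : ℝ → ℝ) : Prop where
  smooth : ContDiffOn ℝ ∞ F (Ioi 0)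
  pert : (fun v : ℝ => F v - v ^ (-β)) =o[𝓝[>] 0] fun v : ℝ => v ^ (-β)
  pert_deriv : (fun v : ℝ => deriv (fun w : ℝ => F w - w ^ (-β)) v) =o[𝓝[>] 0]
    fun v : ℝ => v ^ (-(β + 1))

/-- A smooth one-dimensional cut-off on `[0,∞)`: `0 ≤ χ₀ ≤ 1`, `χ₀ = 1` on `[0,1]`,
and `χ₀ = 0` beyond `2`. -/
structure IsCutoff (χ₀ : ℝ → ℝ) : Prop where
  smooth : ContDiffOn ℝ ∞ χ₀ (Ici 0)
  nonneg : ∀ r, 0 ≤ r → 0 ≤ χ₀ r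
  le_one : ∀ r, 0 ≤ r → χ₀ r ≤ 1
  eq_one : ∀ r, 0 ≤ r → r ≤ 1 → χ₀ r = 1
  eq_zero : ∀ r, 2 ≤ r → χ₀ r = 0

/-- The intermediate extinction profile `Φ̂`. -/
def PhiHat (β : ℝ) (z : E N) : ℝ :=
  (β + 1 + (β + 1) ^ 2 / (4 * β) * ‖z‖ ^ 2) ^ (1 / (β + 1))

/-- The intermediate blowup profile `Φ` for `u = 1 / h`
(that is, with `p = β + 2` and `a = 2`). -/
def Phi (β : ℝ) (z : E N) : ℝ :=
  (β + 1 + (β + 1) ^ 2 / (4 * β) * ‖z‖ ^ 2) ^ (-(1 / (β + 1)))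

/-- `κ = Φ(0) = (p - 1)^{-1/(p-1)}` with `p = β + 2`. -/
def kappa (β : ℝ) : ℝ := (β + 1) ^ (-(1 / (β + 1)))

/-- `φ(y,s) = Φ(y/√s) + N κ / (2 (p - a) s)` with `p - a = β`. -/
def varphi (β : ℝ) (y : E N) (s : ℝ) : ℝ :=
  Phi β ((Real.sqrt s)⁻¹ • y) + N * kappa β / (2 * β * s)

/-- The explicit expression of the final extinction profile near the origin. -/
def finalExpr (β : ℝ) (x : E N) : ℝ :=
  ((β + 1) ^ 2 / (8 * β) * (‖x‖ ^ 2 / |Real.log ‖x‖|)) ^ (1 / (β + 1))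

/-- The flat solution `k̂(τ)` of `k' = -k^{-β}` with `k̂(0) = Φ̂(K₀/4)`. -/
def kHat (β K₀ τ : ℝ) : ℝ :=
  ((β + 1) * (1 - τ) + (β + 1) ^ 2 / (4 * β) * (K₀ ^ 2 / 16)) ^ (1 / (β + 1))

/-- The parabolic scale `√((T - t)|log(T - t)|)`. -/
def scale (T t : ℝ) : ℝ := Real.sqrt ((T - t) * |Real.log (T - t)|)

/-- The rescaled variable `z(x,t) = x / √((T - t)|log(T - t)|)`. -/
def zvar (T t : ℝ) (x : E N) : E N := (scale T t)⁻¹ • x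

/-! ### The space `H` -/

/-- `G` is the weak gradient of `f` in the open set `Ω`. -/
def IsWeakGradient (Ω : Set (E N)) (f : E N → ℝ) (G : E N → E N) : Prop :=
  ∀ φ : E N → ℝ, ContDiff ℝ ∞ φ → HasCompactSupport φ → tsupport φ ⊆ Ω →
    ∀ v : E N, ∫ x in Ω, f x * fderiv ℝ φ x v = -∫ x in Ω, inner ℝ (G x) v * φ x

/-- `f ∈ W^{1,∞}(Ω)` with `max(‖f‖_∞, ‖∇f‖_∞) ≤ M`. -/
def W1infLE (Ω : Set (E N)) (f : E N → ℝ) (M : ℝ) : Prop :=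
  AEStronglyMeasurable f (volume.restrict Ω) ∧
  (∀ᵐ x ∂(volume.restrict Ω), |f x| ≤ M) ∧
  ∃ G : E N → E N, AEStronglyMeasurable G (volume.restrict Ω) ∧
    (∀ᵐ x ∂(volume.restrict Ω), ‖G x‖ ≤ M) ∧ IsWeakGradient Ω f G

/-- The trajectory space `H`: positive `g` with `g - ψ ∈ W^{1,∞}(Ω)` and `1/g` bounded.
The reference function `ψ` is `0` for bounded `Ω`. -/
def InH (Ω : Set (E N)) (ψ g : E N → ℝ) : Prop :=
  (∃ M, W1infLE Ω (fun x => g x - ψ x) M) ∧ ∃ c > 0, ∀ x ∈ Ω, c ≤ g x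

/-- `h ∈ C([t₀,T); H)`, for the `W^{1,∞}(Ω)` distance. -/
def ContInH (Ω : Set (E N)) (ψ : E N → ℝ) (t₀ T : ℝ) (h : ℝ → E N → ℝ) : Prop :=
  (∀ t ∈ Ico t₀ T, InH Ω ψ (h t)) ∧
  ∀ t ∈ Ico t₀ T, ∀ ε > 0, ∀ᶠ t' in 𝓝[Ico t₀ T] t, W1infLE Ω (fun x => h t' x - h t x) ε

/-! ### The two settings -/

/-- `Ω` is a bounded domain containing `0`, `ψ = 0`, and `Hs` is a final profile: with
`ρ₀ = dist(0,∂Ω)`, it is the explicit expression near `0` and equals `1` for `|x| ≥ ρ₀/2`. -/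
structure BoundedSetting (β : ℝ) (Ω : Set (E N)) (ψ Hs : E N → ℝ) : Prop where
  isOpen : IsOpen Ω
  isConnected : IsConnected Ω
  isBounded : Bornology.IsBounded Ω
  zero_mem : (0 : E N) ∈ Ω
  ψ_zero : ψ = 0
  Hs_smooth : ContDiffOn ℝ ∞ Hs (Ω \ {0})
  Hs_near : ∃ c > 0, ∀ x ∈ Ω, 0 < ‖x‖ →
    ‖x‖ ≤ min c (Metric.infDist 0 (frontier Ω) / 4) → Hs x = finalExpr β x
  Hs_far : ∀ x ∈ Ω, Metric.infDist 0 (frontier Ω) / 2 ≤ ‖x‖ → Hs x = 1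
  Hs_pos : ∀ x ∈ Ω, x ≠ 0 → 0 < Hs x
  Hs_grad : ∀ x ∈ Ω, x ≠ 0 → ‖x‖ < Metric.infDist 0 (frontier Ω) / 2 → gradient Hs x ≠ 0

/-- `Ω = ℝ^N`, `F` and `F'` decay exponentially at infinity, `ψ` is smooth with `ψ = 0` on
`|x| ≤ 1` and `ψ = α₁|x|` on `|x| ≥ 2` (so that every `g ∈ H` satisfies `g(x) ~ α₁|x|` as
`|x| → ∞`), and `Hs` is a final profile with `Hs(x) = α₁|x|` for `|x| ≥ 1`. -/
structure WholeSpaceSetting (β α₁ : ℝ) (F : ℝ → ℝ) (Ω : Set (E N)) (ψ Hs : E N → ℝ) :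
    Prop where
  eq_univ : Ω = univ
  α₁_pos : 0 < α₁
  decay : ∃ C M : ℝ, ∀ v, 0 < v → M ≤ v → |F v| + |deriv F v| ≤ C * Real.exp (-v)
  ψ_smooth : ContDiff ℝ ∞ ψ
  ψ_near : ∀ x, ‖x‖ ≤ 1 → ψ x = 0
  ψ_far : ∀ x, 2 ≤ ‖x‖ → ψ x = α₁ * ‖x‖
  Hs_smooth : ContDiffOn ℝ ∞ Hs {0}ᶜ
  Hs_near : ∃ c > 0, ∀ x, 0 < ‖x‖ → ‖x‖ ≤ min c (1 / 2) → Hs x = finalExpr β x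
  Hs_far : ∀ x, 1 ≤ ‖x‖ → Hs x = α₁ * ‖x‖
  Hs_pos : ∀ x, x ≠ 0 → 0 < Hs x
  Hs_grad : ∀ x, x ≠ 0 → gradient Hs x ≠ 0

/-! ### Solutions and initial data -/

/-- `h` is a positive classical solution (continuous on `Ω × [t₀,T)`, of class `C^{2,1}` on
`Ω × (t₀,T)`) of `∂ₜh = Δh - F(h)` with `h = 1` on `∂Ω` (no condition if `Ω = ℝ^N`). -/
structure IsSolution (F : ℝ → ℝ) (Ω : Set (E N)) (t₀ T : ℝ) (h : ℝ → E N → ℝ) : Prop where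
  pos : ∀ t ∈ Ico t₀ T, ∀ x ∈ Ω, 0 < h t x
  cont : ContinuousOn (fun p : ℝ × E N => h p.1 p.2) (Ico t₀ T ×ˢ Ω)
  c2 : ∀ t ∈ Ioo t₀ T, ContDiffOn ℝ 2 (h t) Ω
  cont_deriv : ∀ m : ℕ, m ≤ 2 →
    ContinuousOn (fun p : ℝ × E N => iteratedFDeriv ℝ m (h p.1) p.2) (Ioo t₀ T ×ˢ Ω)
  eqn : ∀ t ∈ Ioo t₀ T, ∀ x ∈ Ω,
    HasDerivAt (fun t' => h t' x) (Laplacian.laplacian (h t) x - F (h t x)) t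
  boundary : ∀ t ∈ Ico t₀ T, ∀ b ∈ frontier Ω, Tendsto (h t) (𝓝[Ω] b) (𝓝 1)

/-- The prepared initial data at time `t₀` with parameters `(d₀,d₁) ∈ ℝ × ℝ^N`. The exponent
`γ` fixes the size `(T - t₀)^{1/2}|log(T - t₀)|^γ` of the region outside which the data agree
with the final profile `Hs`. -/
def initData (β : ℝ) (χ₀ : ℝ → ℝ) (Hs : E N → ℝ) (T t₀ K₀ γ d₀ : ℝ) (d₁ : E N) (x : E N) : ℝ :=
  let z := zvar T t₀ x
  let χ₁ := χ₀ (‖x‖ / (Real.sqrt (T - t₀) * |Real.log (T - t₀)| ^ γ))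
  (T - t₀) ^ (1 / (β + 1)) *
      (Phi β z + (d₀ + inner ℝ d₁ z) * χ₀ (‖z‖ / (K₀ / 16)))⁻¹ * χ₁
    + Hs x * (1 - χ₁)

/-! ### Similarity variables and the spectral decomposition -/

/-- `q(y,s) = w(y,s) - φ(y,s)`, where `w(y,s) = (T - t)^{1/(β+1)} u(x,t)`, `u = 1/h`,
`x = √(T - t) y`, `s = -log(T - t)`, for the time slice `g = h(·,t)`; it is extended by zero
outside the dilated domain. -/
def qOf (β : ℝ) (Ω : Set (E N)) (T t : ℝ) (g : E N → ℝ) : E N → ℝ :=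
  indicator {y | Real.sqrt (T - t) • y ∈ Ω} fun y =>
    (T - t) ^ (1 / (β + 1)) * (1 / g (Real.sqrt (T - t) • y)) - varphi β y (-Real.log (T - t))

/-- The Gaussian weight `ρ`. -/
def rho (y : E N) : ℝ := Real.exp (-‖y‖ ^ 2 / 4) / (4 * Real.pi) ^ ((N : ℝ) / 2)

/-- The inner part `r_b = χ r`, `χ(y,s) = χ₀(|y| / (K₀√s))`. -/
def innerPart (χ₀ : ℝ → ℝ) (K₀ s : ℝ) (r : E N → ℝ) (y : E N) : ℝ :=
  χ₀ (‖y‖ / (K₀ * Real.sqrt s)) * r y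

/-- The outer part `r_e = (1 - χ) r`. -/
def outerPart (χ₀ : ℝ → ℝ) (K₀ s : ℝ) (r : E N → ℝ) (y : E N) : ℝ :=
  (1 - χ₀ (‖y‖ / (K₀ * Real.sqrt s))) * r y

/-- The projection on the constant eigenfunction `1`. -/
def mode0 (g : E N → ℝ) : ℝ := ∫ y, g y * rho y

/-- The projections on the eigenfunctions `y_i`, of squared norm `2`. -/
def mode1 (g : E N → ℝ) (i : Fin N) : ℝ := ∫ y, g y * (y i / 2) * rho y

/-- The symmetric matrix such that `y ↦ yᵀ (mode2 g) y - 2 Tr (mode2 g)` is the projection on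
the eigenfunctions `y_i² - 2` (squared norm `8`) and `y_i y_j`, `i ≠ j` (squared norm `4`). -/
def mode2 (g : E N → ℝ) (i j : Fin N) : ℝ :=
  ∫ y, g y * (y i * y j / 8 - if i = j then 1 / 4 else 0) * rho y

/-- The part on the negative spectrum, i.e. what remains after removing the modes `0,1,2`. -/
def modeNeg (g : E N → ℝ) (y : E N) : ℝ :=
  g y - (mode0 g + ∑ i, mode1 g i * y i
    + (∑ i, ∑ j, mode2 g i j * y i * y j - 2 * ∑ i, mode2 g i i))

/-! ### The shrinking set -/

/-- The parameters of the shrinking set; `αlo`, `αhi` are the two exponents of `A`. -/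
structure Params where
  K₀ : ℝ
  ε₀ : ℝ
  A : ℝ
  α₀ : ℝ
  δ₀ : ℝ
  C₀ : ℝ
  η₀ : ℝ
  αlo : ℝ
  αhi : ℝ
  K₀_pos : 0 < K₀
  ε₀_pos : 0 < ε₀
  A_pos : 0 < A
  α₀_pos : 0 < α₀
  δ₀_pos : 0 < δ₀
  C₀_pos : 0 < C₀
  η₀_pos : 0 < η₀
  three_lt_αlo : 3 < αlo
  αlo_add_one_le : αlo + 1 ≤ αhi

/-- The set `V_{K₀,A}(s)`. -/
structure MemV (χ₀ : ℝ → ℝ) (P : Params) (s : ℝ) (r : E N → ℝ) : Prop where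
  memLp : MemLp r ⊤ volume
  bound0 : |mode0 (innerPart χ₀ P.K₀ s r)| ≤ P.A / s ^ 2
  bound1 : ∀ i, |mode1 (innerPart χ₀ P.K₀ s r) i| ≤ P.A / s ^ 2
  bound2 : Real.sqrt (∑ i, ∑ j, mode2 (innerPart χ₀ P.K₀ s r) i j ^ 2) ≤
    P.A ^ 2 * Real.log s / s ^ 2
  boundNeg : ∀ᵐ y : E N, |modeNeg (innerPart χ₀ P.K₀ s r) y| / (1 + ‖y‖ ^ 3) ≤
    P.A ^ P.αlo * Real.log s / s ^ (5 / 2 : ℝ)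
  boundOut : ∀ᵐ y : E N, |outerPart χ₀ P.K₀ s r y| ≤ P.A ^ P.αhi * Real.log s / s

/-- `θ(x) = T - t(x)` as a function of `r = |x|`: the solution `θ ∈ (0, e⁻¹]` of
`(K₀/4) √(θ |log θ|) = r`, which exists and is unique for `0 < r ≤ (K₀/4) e^{-1/2}`. -/
def theta (K₀ r : ℝ) : ℝ :=
  sInf {θ : ℝ | 0 < θ ∧ θ ≤ Real.exp (-1) ∧ K₀ / 4 * Real.sqrt (θ * |Real.log θ|) = r}

/-- `t(x) = T - θ(x)`. -/
def tOf (K₀ T : ℝ) (x : E N) : ℝ := T - theta K₀ ‖x‖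

/-- `τ(x,t) = (t - t(x)) / θ(x)`. -/
def tauOf (K₀ T t : ℝ) (x : E N) : ℝ := (t - tOf K₀ T x) / theta K₀ ‖x‖

/-- `ξ ↦ k_x(ξ, τ(x,t)) = θ(x)^{-1/(β+1)} h(x + √θ(x) ξ, t)` for the time slice
`g = h(·,t)`. -/
def kOf (β K₀ : ℝ) (g : E N → ℝ) (x ξ : E N) : ℝ :=
  g (x + Real.sqrt (theta K₀ ‖x‖) • ξ) / theta K₀ ‖x‖ ^ (1 / (β + 1))

/-- The time slice `g = h(·,t)` belongs to `S*(t₀,t)`; here `g₀ = h(·,t₀)`. -/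
structure MemSlice (β : ℝ) (Ω : Set (E N)) (ψ : E N → ℝ) (χ₀ : ℝ → ℝ) (P : Params) (T : ℝ)
    (g₀ : E N → ℝ) (t : ℝ) (g : E N → ℝ) : Prop where
  memH : InH Ω ψ g
  region1 : MemV χ₀ P (-Real.log (T - t)) (qOf β Ω T t g)
  region2 : ∀ x ∈ Ω, P.K₀ / 4 * scale T t ≤ ‖x‖ → ‖x‖ ≤ P.ε₀ →
    ∀ ξ : E N, ‖ξ‖ ≤ P.α₀ * Real.sqrt |Real.log (theta P.K₀ ‖x‖)| →
    x + Real.sqrt (theta P.K₀ ‖x‖) • ξ ∈ Ω →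
      |kOf β P.K₀ g x ξ - kHat β P.K₀ (tauOf P.K₀ T t x)| ≤ P.δ₀ ∧
      ‖gradient (kOf β P.K₀ g x) ξ‖ ≤ P.C₀ / Real.sqrt |Real.log (theta P.K₀ ‖x‖)|
  region3 : ∀ x ∈ Ω, P.ε₀ / 4 ≤ ‖x‖ →
      |g x - g₀ x| ≤ P.η₀ ∧ ‖gradient g x - gradient g₀ x‖ ≤ P.η₀

/-- `h ∈ S*(t₀)`: `h ∈ C([t₀,T); H)` and `h(·,t) ∈ S*(t₀,t)` for all `t ∈ [t₀,T)`. -/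
def Trapped (β : ℝ) (Ω : Set (E N)) (ψ : E N → ℝ) (χ₀ : ℝ → ℝ) (P : Params) (t₀ T : ℝ)
    (h : ℝ → E N → ℝ) : Prop :=
  ContInH Ω ψ t₀ T h ∧ ∀ t ∈ Ico t₀ T, MemSlice β Ω ψ χ₀ P T (h t₀) t (h t)

end Quench

end

noncomputable section

namespace Quench

variable {N : ℕ}

/-! ### The Laplacian along lines -/

/-! Membership in the shrinking set controls `h` through three regions, and each claim is obtained
by comparing `h`, on a suitably rescaled cylinder, with an explicit function. The parabolic theory
is elementary: the weak maximum principle `nonpos_of_parabolic`, a quadratic barrier bounding a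
solution at the centre of a cylinder (`IsHeat.abs_le_center`), and an interior gradient estimate by
reflection (`IsHeat.norm_gradient_le`). Write `s = -log(T - t)`.

Intermediate profile. Summing the modes of `q` inside the cut-off and adding the outer bound gives
`|q| ≤ C log s / s` everywhere, and the better bound `C log s / s²` for bounded `y`
(`MemV.sup_bounds`). The correction `Nκ/(2βs)` is of lower order, whence
`Setup.exists_profile_bound` and extinction at the origin.

Away from the origin the second and third regions, with the smallness of `δ₀` and `η₀`, keep `h`
between two positive constants near each point (`Setup.exists_local_bounds`). The gradient estimate
applied to `h` and then to its spatial increments bounds the second derivatives up to time `T`, so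
`h` and its gradient converge (`IsHeat.exists_limits`).

Gradient profile. Around `(x₁, T - l)`, at spatial scale `√l`, the solution is compared with
`[(β+1)(1-τ) + b|ξ+y|²/s]^{1/(β+1)}`, where `b = (β+1)²/(4β)`, `y = x₁/√l` and now `s = -log l`.
Their difference is `O(log s / s)` by the intermediate profile, and the gradient estimate carries
this rate over to the gradients if the source is of the same order. The source contains the
deviation of the rescaled `F` from the pure power, for which the hypotheses on `F` give only `o(1)`.
The missing rate is forced by the trapping (`Setup.exists_rate_at_inv_kappa`): near the origin `h`
is known to within `O(log s / s²)` over a rescaled time window of length `1/s`, while a deviation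
`G` in the equation moves the solution by about `G/s` over that window, so `G = O(log s / s)`. A
change of scale transfers this from the value `κ⁻¹` to any compact set of values
(`Setup.exists_rate`).

Final profile. Around `(x, T - θ(x))`, at scale `√θ(x)`, the intermediate profiles show that as `x →
0` the solution starts near the constant `k̂(0)` on every fixed ball, and that its gradient times
`√|log θ|` starts near a fixed multiple of `x/|x|`; the rate in the gradient profile is what
survives the factor `√|log θ|`. The bounds of the second region hold on balls whose radius tends to
infinity, so the barrier on a large ball makes lateral effects negligible. Hence the solution
follows the flat solution `k̂` (`Setup.eventually_zoom_le`) and its gradient follows the linearised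
flow (`Setup.eventually_gradient_zoom_le`), uniformly for `τ < 1`. Letting `τ → 1` and using `log
θ(x) ~ 2 log|x|` identifies both limits with `Hs` and its gradient. -/

lemma laplacian_eq_sum_fderiv {ι : Type*} [Fintype ι] (b : OrthonormalBasis ι ℝ (E N))
    (f : E N → ℝ) (x : E N) :
    Laplacian.laplacian f x = ∑ i, fderiv ℝ (fderiv ℝ f) x (b i) (b i) := by
  rw [InnerProductSpace.laplacian_eq_iteratedFDeriv_orthonormalBasis f b]
  simp [iteratedFDeriv_two_apply]

lemma hasDerivAt_line (x v : E N) (r : ℝ) : HasDerivAt (fun r : ℝ => x + r • v) v r := by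
  simpa using ((hasDerivAt_id r).smul_const v).const_add x

lemma eventually_hasDerivAt_comp_line {f : E N → ℝ} {x : E N} (hf : ContDiffAt ℝ 2 f x)
    (v : E N) :
    ∀ᶠ r in 𝓝 (0 : ℝ), HasDerivAt (fun r : ℝ => f (x + r • v)) (fderiv ℝ f (x + r • v) v) r := by
  have h1 : ∀ᶠ y in 𝓝 x, ContDiffAt ℝ 2 f y := hf.eventually (by simp)
  have h2 : Tendsto (fun r : ℝ => x + r • v) (𝓝 0) (𝓝 x) := by
    have : ContinuousAt (fun r : ℝ => x + r • v) 0 := by fun_prop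
    simpa [ContinuousAt] using this
  filter_upwards [h2.eventually h1] with r hr
  exact (hr.differentiableAt (by simp)).hasFDerivAt.comp_hasDerivAt r (hasDerivAt_line x v r)

lemma hasDerivAt_fderiv_line {f : E N → ℝ} {x : E N} (hf : ContDiffAt ℝ 2 f x) (v : E N) :
    HasDerivAt (fun r : ℝ => fderiv ℝ f (x + r • v) v) (fderiv ℝ (fderiv ℝ f) x v v) 0 := by
  have h1 : ContDiffAt ℝ 1 (fderiv ℝ f) x := hf.fderiv_right (by norm_num)
  have h2 : HasFDerivAt (fderiv ℝ f) (fderiv ℝ (fderiv ℝ f) x) (x + (0 : ℝ) • v) := by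
    simpa using (h1.differentiableAt (by simp)).hasFDerivAt
  have h3 := h2.comp_hasDerivAt (0 : ℝ) (hasDerivAt_line x v 0)
  simpa using h3.clm_apply (hasDerivAt_const (0 : ℝ) v)

/-- Uniqueness of derivatives along the coordinate lines reduces the explicit Laplacians below to
one-variable calculus. -/
lemma laplacian_eq_of_line_derivs {f : E N → ℝ} {x : E N} (hf : ContDiffAt ℝ 2 f x)
    (g' : Fin N → ℝ → ℝ) (g'' : Fin N → ℝ)
    (h1 : ∀ i, ∀ᶠ r in 𝓝 (0 : ℝ),
      HasDerivAt (fun r : ℝ => f (x + r • EuclideanSpace.basisFun (Fin N) ℝ i)) (g' i r) r)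
    (h2 : ∀ i, HasDerivAt (g' i) (g'' i) 0) :
    Laplacian.laplacian f x = ∑ i, g'' i := by
  rw [laplacian_eq_sum_fderiv (EuclideanSpace.basisFun (Fin N) ℝ)]
  refine Finset.sum_congr rfl fun i _ => ?_
  have h3 := hasDerivAt_fderiv_line hf (EuclideanSpace.basisFun (Fin N) ℝ i)
  have h4 := eventually_hasDerivAt_comp_line hf (EuclideanSpace.basisFun (Fin N) ℝ i)
  refine h3.unique ((h2 i).congr_of_eventuallyEq ?_)
  filter_upwards [h4, h1 i] with r hr hr' using hr.unique hr'

/-- A positive second derivative would make `a` a local minimum as well; then `f` is locally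
constant and its second derivative vanishes, a contradiction. -/
lemma deriv_deriv_nonpos_of_isLocalMax {f f' : ℝ → ℝ} {f'' a : ℝ} (h : IsLocalMax f a)
    (h1 : ∀ᶠ r in 𝓝 a, HasDerivAt f (f' r) r) (h2 : HasDerivAt f' f'' a) : f'' ≤ 0 := by
  by_contra! hpos
  have hd : deriv f =ᶠ[𝓝 a] f' := h1.mono fun r hr => hr.deriv
  have hdd : deriv (deriv f) a = f'' := by rw [hd.deriv_eq, h2.deriv]
  have hmin := isLocalMin_of_deriv_deriv_pos (by rw [hdd]; exact hpos) h.deriv_eq_zero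
    h1.self_of_nhds.continuousAt
  have hconst : f =ᶠ[𝓝 a] fun _ => f a := by
    filter_upwards [h, hmin] with r h1 h2 using le_antisymm h1 h2
  have : deriv (deriv f) a = 0 := by
    rw [hconst.deriv.deriv_eq]; simp
  linarith

lemma laplacian_nonpos_of_isLocalMax {f : E N → ℝ} {x : E N} (hf : ContDiffAt ℝ 2 f x)
    (h : IsLocalMax f x) : Laplacian.laplacian f x ≤ 0 := by
  rw [laplacian_eq_sum_fderiv (EuclideanSpace.basisFun (Fin N) ℝ)]
  refine Finset.sum_nonpos fun i _ => ?_
  set v := EuclideanSpace.basisFun (Fin N) ℝ i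
  have h0 : IsLocalMax (fun r : ℝ => f (x + r • v)) 0 := by
    have h2 : Tendsto (fun r : ℝ => x + r • v) (𝓝 0) (𝓝 x) := by
      have : ContinuousAt (fun r : ℝ => x + r • v) 0 := by fun_prop
      simpa [ContinuousAt] using this
    filter_upwards [h2.eventually h] with r hr
    simpa using hr
  exact deriv_deriv_nonpos_of_isLocalMax h0 (eventually_hasDerivAt_comp_line hf v)
    (hasDerivAt_fderiv_line hf v)

lemma laplacian_le_of_isLocalMax_sub {f g : E N → ℝ} {x : E N} (hf : ContDiffAt ℝ 2 f x)
    (hg : ContDiffAt ℝ 2 g x) (h : IsLocalMax (fun y => f y - g y) x) :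
    Laplacian.laplacian f x ≤ Laplacian.laplacian g x := by
  have h1 := laplacian_nonpos_of_isLocalMax (hf.sub hg) h
  have h2 := hf.laplacian_sub hg
  change Laplacian.laplacian (f - g) x ≤ 0 at h1
  linarith

lemma laplacian_comp_affine_scale {f : E N → ℝ} {c : ℝ} (hc : c ≠ 0) (y x : E N) :
    Laplacian.laplacian (fun ξ => f (y + c • ξ)) x =
      c ^ 2 * Laplacian.laplacian f (y + c • x) := by
  have key : ∀ v : E N, iteratedFDeriv ℝ 2 (fun ξ => f (y + c • ξ)) x ![v, v] =
      c ^ 2 * iteratedFDeriv ℝ 2 f (y + c • x) ![v, v] := by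
    intro v
    let L : E N ≃L[ℝ] E N := ContinuousLinearEquiv.smulLeft (Units.mk0 c hc)
    have h1 := L.iteratedFDerivWithin_comp_right (fun z => f (y + z)) uniqueDiffOn_univ
      (x := x) (mem_univ _) 2
    rw [preimage_univ, iteratedFDerivWithin_univ, iteratedFDerivWithin_univ,
      iteratedFDeriv_comp_add_left] at h1
    have h2 : (fun z => f (y + z)) ∘ L = fun ξ => f (y + c • ξ) := rfl
    have h3 : L x = c • x := rfl
    rw [h2, h3] at h1
    rw [h1, ContinuousMultilinearMap.compContinuousLinearMap_apply]
    have h4 : (fun i : Fin 2 => (L : E N →L[ℝ] E N) ((![v, v] : Fin 2 → E N) i)) =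
        fun i => (fun _ => c) i • (![v, v] : Fin 2 → E N) i := by
      funext i; rfl
    rw [h4, ContinuousMultilinearMap.map_smul_univ]
    simp
  rw [InnerProductSpace.laplacian_eq_iteratedFDeriv_orthonormalBasis _
      (EuclideanSpace.basisFun (Fin N) ℝ),
    InnerProductSpace.laplacian_eq_iteratedFDeriv_orthonormalBasis f
      (EuclideanSpace.basisFun (Fin N) ℝ)]
  simp only [key, Finset.mul_sum]

/-- The Laplacian may be computed in any orthonormal basis: the standard one serves on the left, its
image under `R` on the right. -/
lemma laplacian_comp_isometry {f : E N → ℝ} (R : E N ≃ₗᵢ[ℝ] E N) (x : E N) :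
    Laplacian.laplacian (fun ξ => f (R ξ)) x = Laplacian.laplacian f (R x) := by
  rw [InnerProductSpace.laplacian_eq_iteratedFDeriv_orthonormalBasis _
      (EuclideanSpace.basisFun (Fin N) ℝ),
    InnerProductSpace.laplacian_eq_iteratedFDeriv_orthonormalBasis f
      ((EuclideanSpace.basisFun (Fin N) ℝ).map R)]
  refine Finset.sum_congr rfl fun i _ => ?_
  have h1 := R.toContinuousLinearEquiv.iteratedFDerivWithin_comp_right f uniqueDiffOn_univ
    (x := x) (mem_univ _) 2
  rw [preimage_univ, iteratedFDerivWithin_univ, iteratedFDerivWithin_univ] at h1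
  change iteratedFDeriv ℝ 2 (f ∘ R.toContinuousLinearEquiv) x _ = _
  rw [h1, ContinuousMultilinearMap.compContinuousLinearMap_apply]
  congr 1
  funext j
  fin_cases j <;> simp

lemma norm_add_smul_basisFun_sq (x : E N) (i : Fin N) (r : ℝ) :
    ‖x + r • EuclideanSpace.basisFun (Fin N) ℝ i‖ ^ 2 = ‖x‖ ^ 2 + 2 * r * x i + r ^ 2 := by
  rw [norm_add_sq_real, inner_smul_right, norm_smul, mul_pow]
  have h1 : ‖EuclideanSpace.basisFun (Fin N) ℝ i‖ = 1 :=
    (EuclideanSpace.basisFun (Fin N) ℝ).norm_eq_one i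
  have h2 : inner ℝ x (EuclideanSpace.basisFun (Fin N) ℝ i) = x i := by
    simp [PiLp.inner_apply]
  rw [h1, h2, Real.norm_eq_abs, sq_abs]; ring

/-- The Laplacian of a radial function written through the squared distance. -/
lemma laplacian_comp_norm_sq {φ φ' : ℝ → ℝ} {φ'' : ℝ} (y x : E N)
    (hφ : ContDiffAt ℝ 2 φ (‖x + y‖ ^ 2))
    (h1 : ∀ᶠ u in 𝓝 (‖x + y‖ ^ 2), HasDerivAt φ (φ' u) u)
    (h2 : HasDerivAt φ' φ'' (‖x + y‖ ^ 2)) :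
    Laplacian.laplacian (fun ξ : E N => φ (‖ξ + y‖ ^ 2)) x =
      4 * φ'' * ‖x + y‖ ^ 2 + 2 * N * φ' (‖x + y‖ ^ 2) := by
  have hc : ContDiffAt ℝ 2 (fun ξ : E N => φ (‖ξ + y‖ ^ 2)) x := by
    have : ContDiffAt ℝ 2 (fun ξ : E N => ‖ξ + y‖ ^ 2) x :=
      ((contDiff_id.add contDiff_const).norm_sq ℝ).contDiffAt
    exact ContDiffAt.comp x hφ this
  have hn : ∀ (i : Fin N) (r : ℝ), ‖x + r • EuclideanSpace.basisFun (Fin N) ℝ i + y‖ ^ 2 =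
      ‖x + y‖ ^ 2 + 2 * r * (x + y) i + r ^ 2 := by
    intro i r
    rw [add_right_comm, norm_add_smul_basisFun_sq]
  have hd : ∀ (i : Fin N) (r : ℝ),
      HasDerivAt (fun r : ℝ => ‖x + y‖ ^ 2 + 2 * r * (x + y) i + r ^ 2)
        (2 * (x + y) i + 2 * r) r := by
    intro i r
    have ha := ((((hasDerivAt_id r).const_mul 2).mul_const ((x + y) i)).const_add
      (‖x + y‖ ^ 2)).add ((hasDerivAt_id r).pow 2)
    refine ha.congr_deriv ?_
    simp
  rw [laplacian_eq_of_line_derivs hc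
    (fun i r => φ' (‖x + y‖ ^ 2 + 2 * r * (x + y) i + r ^ 2) * (2 * (x + y) i + 2 * r))
    (fun i => φ'' * (2 * (x + y) i) * (2 * (x + y) i) + φ' (‖x + y‖ ^ 2) * 2)]
  · rw [Finset.sum_add_distrib, EuclideanSpace.norm_sq_eq, Finset.mul_sum]
    congr 1
    · refine Finset.sum_congr rfl fun i _ => ?_
      rw [Real.norm_eq_abs, sq_abs]; ring
    · simp; ring
  · intro i
    simp only [hn]
    have ht : Tendsto (fun r : ℝ => ‖x + y‖ ^ 2 + 2 * r * (x + y) i + r ^ 2) (𝓝 0)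
        (𝓝 (‖x + y‖ ^ 2)) := by
      have := (hd i 0).continuousAt
      simpa [ContinuousAt] using this
    filter_upwards [ht.eventually h1] with r hr
    exact hr.comp r (hd i r)
  · intro i
    have h3 : HasDerivAt φ' φ'' (‖x + y‖ ^ 2 + 2 * 0 * (x + y) i + 0 ^ 2) := by simpa using h2
    have h4 := (h3.comp (0 : ℝ) (hd i 0)).mul
      (((hasDerivAt_id (0 : ℝ)).const_mul 2).const_add (2 * (x + y) i))
    refine h4.congr_deriv ?_
    simp

lemma contDiff_const_mul_norm_sq (c : ℝ) (y : E N) :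
    ContDiff ℝ 2 (fun ξ : E N => c * ‖ξ + y‖ ^ 2) :=
  contDiff_const.mul ((contDiff_id.add contDiff_const).norm_sq ℝ)

lemma laplacian_const_mul_norm_sq (c : ℝ) (y x : E N) :
    Laplacian.laplacian (fun ξ : E N => c * ‖ξ + y‖ ^ 2) x = 2 * N * c := by
  have h := laplacian_comp_norm_sq (φ := fun u => c * u) (φ' := fun _ => c) (φ'' := 0) y x
    (by fun_prop) (Eventually.of_forall fun u => by simpa using (hasDerivAt_id u).const_mul c)
    (hasDerivAt_const _ _)
  simpa using h

lemma contDiff_quadratic (a₀ a α γ : ℝ) (e : E N) :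
    ContDiff ℝ 2 (fun ξ : E N => a₀ + a * ‖ξ‖ ^ 2 + α * inner ℝ e ξ + γ * inner ℝ e ξ ^ 2) := by
  have h1 : ContDiff ℝ 2 (fun ξ : E N => ‖ξ‖ ^ 2) := contDiff_norm_sq ℝ
  have h2 : ContDiff ℝ 2 (fun ξ : E N => inner ℝ e ξ) := contDiff_const.inner ℝ contDiff_id
  fun_prop

/-- Needed for the barrier of the reflection argument, which singles out one direction `e`, and for
the radial comparison function of the rate estimate. -/
lemma laplacian_quadratic (a₀ a α γ : ℝ) (e x : E N) :
    Laplacian.laplacian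
      (fun ξ : E N => a₀ + a * ‖ξ‖ ^ 2 + α * inner ℝ e ξ + γ * inner ℝ e ξ ^ 2) x =
      2 * N * a + 2 * γ * ‖e‖ ^ 2 := by
  have hi : ∀ i : Fin N, inner ℝ e (EuclideanSpace.basisFun (Fin N) ℝ i) = e i := by
    intro i; simp [PiLp.inner_apply]
  rw [laplacian_eq_of_line_derivs (contDiff_quadratic a₀ a α γ e).contDiffAt
    (fun i r => a * (2 * x i + 2 * r) + α * e i + γ * (2 * (inner ℝ e x + r * e i) * e i))
    (fun i => 2 * a + γ * (2 * e i * e i))]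
  · rw [Finset.sum_add_distrib, EuclideanSpace.norm_sq_eq, Finset.mul_sum]
    congr 1
    · simp; ring
    · refine Finset.sum_congr rfl fun i _ => ?_
      rw [Real.norm_eq_abs, sq_abs]; ring
  · intro i
    refine Eventually.of_forall fun r => ?_
    simp only [norm_add_smul_basisFun_sq, inner_add_right, inner_smul_right, hi]
    have hr := hasDerivAt_id r
    have e1 : HasDerivAt (fun r : ℝ => inner ℝ e x + r * e i) (e i) r := by
      simpa using (hr.mul_const (e i)).const_add (inner ℝ e x)
    have e2 : HasDerivAt (fun r : ℝ => ‖x‖ ^ 2 + 2 * r * x i + r ^ 2) (2 * x i + 2 * r) r := by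
      refine ((((hr.const_mul 2).mul_const (x i)).const_add (‖x‖ ^ 2)).add
        (hr.pow 2)).congr_deriv ?_
      simp
    refine ((((e2.const_mul a).const_add a₀).add (e1.const_mul α)).add
      ((e1.pow 2).const_mul γ)).congr_deriv ?_
    simp
  · intro i
    have hr := hasDerivAt_id (0 : ℝ)
    have e1 : HasDerivAt (fun r : ℝ => inner ℝ e x + r * e i) (e i) 0 := by
      simpa using (hr.mul_const (e i)).const_add (inner ℝ e x)
    have e2 : HasDerivAt (fun r : ℝ => 2 * x i + 2 * r) 2 0 := by
      simpa using (hr.const_mul 2).const_add (2 * x i)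
    refine (((e2.const_mul a).add_const (α * e i)).add
      (((e1.const_mul 2).mul_const (e i)).const_mul γ)).congr_deriv ?_
    ring

/-! ### The maximum principle and inhomogeneous heat equations -/

/-- Weak maximum principle on a compact space-time cylinder: it suffices to control the time
derivative at positive spatial maxima. -/
theorem nonpos_of_parabolic {K O : Set (E N)} (hK : IsCompact K) (hO : IsOpen O) (hOK : O ⊆ K)
    {a b L : ℝ} {W : ℝ → E N → ℝ}
    (hcont : ContinuousOn (fun p : ℝ × E N => W p.1 p.2) (Icc a b ×ˢ K))
    (hinit : ∀ x ∈ K, W a x ≤ 0)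
    (hlat : ∀ t ∈ Icc a b, ∀ x ∈ K \ O, W t x ≤ 0)
    (hint : ∀ t ∈ Ioc a b, ∀ x ∈ O, 0 < W t x → IsLocalMax (W t) x →
      ∃ w, HasDerivAt (fun t' => W t' x) w t ∧ w ≤ L * W t x) :
    ∀ t ∈ Icc a b, ∀ x ∈ K, W t x ≤ 0 := by
  intro t ht x hx
  by_contra! hpos
  -- The exponent `L + 1`, rather than `L`, makes the time derivative of `Z` strictly negative at a
  -- positive maximum.
  set Z : ℝ × E N → ℝ := fun p => Real.exp (-(L + 1) * p.1) * W p.1 p.2 with hZ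
  have hZc : ContinuousOn Z (Icc a b ×ˢ K) := by
    refine ContinuousOn.mul ?_ hcont
    fun_prop
  obtain ⟨⟨t₁, x₁⟩, ⟨ht₁, hx₁⟩, hmax⟩ :=
    (isCompact_Icc.prod hK).exists_isMaxOn ⟨(t, x), ht, hx⟩ hZc
  simp only at ht₁ hx₁
  have hZpos : 0 < Z (t₁, x₁) :=
    lt_of_lt_of_le (mul_pos (Real.exp_pos _) hpos) (hmax (show (t, x) ∈ Icc a b ×ˢ K from ⟨ht, hx⟩))
  have hWpos : 0 < W t₁ x₁ := by
    rcases pos_and_pos_or_neg_and_neg_of_mul_pos hZpos with h | h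
    · exact h.2
    · exact absurd h.1 (Real.exp_pos _).not_gt
  have hat₁ : a < t₁ := by
    rcases ht₁.1.eq_or_lt with h | h
    · exact absurd (hinit x₁ hx₁) (by rw [h]; exact not_le.2 hWpos)
    · exact h
  have hx₁O : x₁ ∈ O := by
    by_contra hn
    exact absurd (hlat t₁ ht₁ x₁ ⟨hx₁, hn⟩) (not_le.2 hWpos)
  have hloc : IsLocalMax (W t₁) x₁ := by
    filter_upwards [hO.mem_nhds hx₁O] with y hy
    have h1 := hmax (show (t₁, y) ∈ Icc a b ×ˢ K from ⟨ht₁, hOK hy⟩)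
    exact le_of_mul_le_mul_left h1 (Real.exp_pos _)
  obtain ⟨w, hw, hwle⟩ := hint t₁ ⟨hat₁, ht₁.2⟩ x₁ hx₁O hWpos hloc
  have hexp : HasDerivAt (fun t' : ℝ => Real.exp (-(L + 1) * t'))
      (Real.exp (-(L + 1) * t₁) * (-(L + 1))) t₁ := by
    have := ((hasDerivAt_id t₁).const_mul (-(L + 1))).exp
    simpa using this
  have hder := hexp.mul hw
  have hneg : Real.exp (-(L + 1) * t₁) * (-(L + 1)) * W t₁ x₁ +
      Real.exp (-(L + 1) * t₁) * w < 0 := by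
    have : Real.exp (-(L + 1) * t₁) * (w - (L + 1) * W t₁ x₁) < 0 :=
      mul_neg_of_pos_of_neg (Real.exp_pos _) (by linarith)
    linarith
  -- Only earlier times are compared, so that `t₁ = b` is allowed: a negative derivative would give
  -- larger values of `Z` just before `t₁`.
  have hev := (hasDerivAt_iff_tendsto_slope.1 hder).mono_left
    (nhdsWithin_mono t₁ (s := Iio t₁) fun r hr => ne_of_lt hr)
  have hneg' := hev.eventually (gt_mem_nhds hneg)
  have hmem : ∀ᶠ r in 𝓝[<] t₁, r ∈ Ioo a t₁ := Ioo_mem_nhdsLT hat₁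
  obtain ⟨r, hr1, hr2⟩ := (hneg'.and hmem).exists
  have h1 := hmax (show (r, x₁) ∈ Icc a b ×ˢ K from ⟨⟨hr2.1.le, hr2.2.le.trans ht₁.2⟩, hx₁⟩)
  rw [slope_def_field] at hr1
  have h2 : 0 ≤ (Z (r, x₁) - Z (t₁, x₁)) / (r - t₁) := by
    apply div_nonneg_of_nonpos
    · simpa using h1
    · linarith [hr2.2]
  exact absurd hr1 (not_lt.2 h2)

/-- `D` is a classical solution of `∂ₜ D = Δ D + f` at the points of `I × O`. -/
structure IsHeat (I : Set ℝ) (O : Set (E N)) (D f : ℝ → E N → ℝ) : Prop where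
  cont : ContinuousOn (fun p : ℝ × E N => D p.1 p.2) (I ×ˢ O)
  c2 : ∀ t ∈ I, ∀ x ∈ O, ContDiffAt ℝ 2 (D t) x
  eqn : ∀ t ∈ I, ∀ x ∈ O, HasDerivAt (fun t' => D t' x) (Laplacian.laplacian (D t) x + f t x) t

namespace IsHeat

variable {I J : Set ℝ} {O O' : Set (E N)} {D D' f f' : ℝ → E N → ℝ}

lemma mono (h : IsHeat I O D f) (hJ : J ⊆ I) (hO : O' ⊆ O) : IsHeat J O' D f :=
  ⟨h.cont.mono (prod_mono hJ hO), fun t ht x hx => h.c2 t (hJ ht) x (hO hx),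
    fun t ht x hx => h.eqn t (hJ ht) x (hO hx)⟩

lemma congr_source (h : IsHeat I O D f) (hf : ∀ t ∈ I, ∀ x ∈ O, f t x = f' t x) :
    IsHeat I O D f' :=
  ⟨h.cont, h.c2, fun t ht x hx => by rw [← hf t ht x hx]; exact h.eqn t ht x hx⟩

lemma sub (h : IsHeat I O D f) (h' : IsHeat I O D' f') :
    IsHeat I O (fun t x => D t x - D' t x) (fun t x => f t x - f' t x) := by
  refine ⟨h.cont.sub h'.cont, fun t ht x hx => (h.c2 t ht x hx).sub (h'.c2 t ht x hx),
    fun t ht x hx => ?_⟩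
  have h1 := (h.c2 t ht x hx).laplacian_sub (h'.c2 t ht x hx)
  change Laplacian.laplacian (fun y => D t y - D' t y) x = _ at h1
  rw [h1]
  refine ((h.eqn t ht x hx).sub (h'.eqn t ht x hx)).congr_deriv ?_
  ring

lemma const_mul (h : IsHeat I O D f) (c : ℝ) :
    IsHeat I O (fun t x => c * D t x) (fun t x => c * f t x) := by
  refine ⟨continuousOn_const.mul h.cont, fun t ht x hx => contDiffAt_const.mul (h.c2 t ht x hx),
    fun t ht x hx => ?_⟩
  have h1 := InnerProductSpace.laplacian_smul c (h.c2 t ht x hx)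
  change Laplacian.laplacian (fun y => c * D t y) x = c * _ at h1
  rw [h1]
  refine ((h.eqn t ht x hx).const_mul c).congr_deriv ?_
  ring

lemma neg (h : IsHeat I O D f) : IsHeat I O (fun t x => -D t x) (fun t x => -f t x) := by
  simpa using h.const_mul (-1)

/-- Parabolic rescaling and translation. -/
lemma rescale (h : IsHeat I O D f) {l c : ℝ} (hc : c ≠ 0) (hcl : c ^ 2 = l) (t₁ : ℝ) (x₁ : E N)
    (hJ : ∀ t ∈ J, t₁ + l * t ∈ I) (hO : ∀ x ∈ O', x₁ + c • x ∈ O) :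
    IsHeat J O' (fun t x => D (t₁ + l * t) (x₁ + c • x))
      (fun t x => l * f (t₁ + l * t) (x₁ + c • x)) := by
  refine ⟨?_, fun t ht x hx => ?_, fun t ht x hx => ?_⟩
  · refine h.cont.comp (f := fun p : ℝ × E N => (t₁ + l * p.1, x₁ + c • p.2)) (by fun_prop) ?_
    rintro ⟨t, x⟩ ⟨ht, hx⟩
    exact ⟨hJ t ht, hO x hx⟩
  · exact (h.c2 _ (hJ t ht) _ (hO x hx)).comp x (f := fun x => x₁ + c • x) (by fun_prop)
  · rw [laplacian_comp_affine_scale hc, hcl]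
    have h1 := h.eqn _ (hJ t ht) _ (hO x hx)
    have h2 : HasDerivAt (fun t' : ℝ => t₁ + l * t') l t := by
      simpa using ((hasDerivAt_id t).const_mul l).const_add t₁
    refine (h1.comp t h2).congr_deriv ?_
    ring

lemma comp_isometry (h : IsHeat I O D f) (R : E N ≃ₗᵢ[ℝ] E N) (hO : ∀ x ∈ O', R x ∈ O) :
    IsHeat I O' (fun t x => D t (R x)) (fun t x => f t (R x)) := by
  refine ⟨?_, fun t ht x hx => ?_, fun t ht x hx => ?_⟩
  · refine h.cont.comp (f := fun p : ℝ × E N => (p.1, R p.2)) ?_ ?_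
    · exact (continuous_fst.prodMk (R.continuous.comp continuous_snd)).continuousOn
    · rintro ⟨t, x⟩ ⟨ht, hx⟩
      exact ⟨ht, hO x hx⟩
  · exact (h.c2 t ht _ (hO x hx)).comp x R.contDiff.contDiffAt
  · rw [laplacian_comp_isometry]
    exact h.eqn t ht _ (hO x hx)

lemma translate (h : IsHeat I O D f) (v : E N) (hO : ∀ x ∈ O', x + v ∈ O) :
    IsHeat I O' (fun t x => D t (x + v)) (fun t x => f t (x + v)) := by
  have := h.rescale (J := I) (O' := O') (l := 1) (c := 1) one_ne_zero (by norm_num) 0 v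
    (fun t ht => by simpa using ht) (fun x hx => by simpa [add_comm] using hO x hx)
  simpa [add_comm] using this

/-- Pointwise bound at the centre of a cylinder, by comparison with a quadratic barrier. -/
theorem le_center {a b R L ε₁ ε₂ M : ℝ} {x₀ : E N} (hR : 0 < R) (hL : 0 ≤ L) (hε₁ : 0 ≤ ε₁)
    (hε₂ : 0 ≤ ε₂) (hM : 0 ≤ M)
    (h : IsHeat (Icc a b) (Metric.closedBall x₀ R) D f)
    (hf : ∀ t ∈ Icc a b, ∀ x ∈ Metric.closedBall x₀ R, f t x ≤ L * |D t x| + ε₁)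
    (hb : ∀ t ∈ Icc a b, ∀ x ∈ Metric.closedBall x₀ R, D t x ≤ M)
    (hi : ∀ x ∈ Metric.closedBall x₀ R, D a x ≤ ε₂) :
    ∀ t ∈ Icc a b, D t x₀ ≤
      Real.exp (L * (t - a)) * (ε₂ + ε₁ * (t - a) + M / R ^ 2 * (2 * N * (t - a))) := by
  -- Since `|x - x₀|² + 2N(t - a)` is caloric, `B` satisfies `∂ₜB = ΔB + L B + e^{L(t-a)} ε₁`, a
  -- supersolution. It dominates `M` on the lateral boundary, while at the centre only the small
  -- time term of the barrier remains.
  set B : ℝ → E N → ℝ := fun t x => Real.exp (L * (t - a)) *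
    (ε₂ + ε₁ * (t - a) + M / R ^ 2 * (‖x + -x₀‖ ^ 2 + 2 * N * (t - a))) with hB
  have hBc : Continuous (fun p : ℝ × E N => B p.1 p.2) := by simp only [hB]; fun_prop
  have hMR : 0 ≤ M / R ^ 2 := by positivity
  have hBnn : ∀ t ∈ Icc a b, ∀ x, 0 ≤ B t x := by
    intro t ht x
    have : 0 ≤ t - a := by linarith [ht.1]
    simp only [hB]
    positivity
  have key := nonpos_of_parabolic (isCompact_closedBall x₀ R) Metric.isOpen_ball
    Metric.ball_subset_closedBall (L := L) (W := fun t x => D t x - B t x)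
    (h.cont.sub hBc.continuousOn) ?_ ?_ ?_
  · intro t ht
    have h1 := key t ht x₀ (Metric.mem_closedBall_self hR.le)
    simp only [hB] at h1
    simpa using h1
  · intro x hx
    have h1 := hi x hx
    simp only [hB, sub_self, mul_zero, Real.exp_zero, add_zero, one_mul]
    have : 0 ≤ M / R ^ 2 * ‖x + -x₀‖ ^ 2 := by positivity
    linarith
  · rintro t ht x ⟨hx, hx'⟩
    have hxR : ‖x + -x₀‖ = R := by
      rw [← sub_eq_add_neg, ← dist_eq_norm]
      exact le_antisymm hx (not_lt.1 hx')
    have h1 := hb t ht x hx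
    have h0 : 0 ≤ t - a := by linarith [ht.1]
    have h2 : M ≤ B t x := by
      have h3 : M ≤ ε₂ + ε₁ * (t - a) + M / R ^ 2 * (‖x + -x₀‖ ^ 2 + 2 * N * (t - a)) := by
        rw [hxR, mul_add, div_mul_cancel₀ _ (by positivity)]
        have : 0 ≤ ε₂ + ε₁ * (t - a) + M / R ^ 2 * (2 * N * (t - a)) := by positivity
        linarith
      have h4 : 1 ≤ Real.exp (L * (t - a)) := Real.one_le_exp (by positivity)
      simp only [hB]
      calc M ≤ 1 * (ε₂ + ε₁ * (t - a) + M / R ^ 2 * (‖x + -x₀‖ ^ 2 + 2 * N * (t - a))) := by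
            rw [one_mul]; exact h3
        _ ≤ _ := mul_le_mul_of_nonneg_right h4 (hM.trans h3)
    linarith
  · intro t ht x hx hpos hmax
    have ht' : t ∈ Icc a b := ⟨ht.1.le, ht.2⟩
    have hx' := Metric.ball_subset_closedBall hx
    have h0 : 0 ≤ t - a := by linarith [ht.1]
    set e := Real.exp (L * (t - a)) with he
    have he1 : 1 ≤ e := Real.one_le_exp (by positivity)
    have hBx : (B t) = fun y => e * (ε₂ + ε₁ * (t - a) + M / R ^ 2 * (2 * N * (t - a))) +
        e * (M / R ^ 2) * ‖y + -x₀‖ ^ 2 := by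
      funext y; simp only [hB]; ring
    have hBc2 : ContDiffAt ℝ 2 (B t) x := by
      rw [hBx]; exact contDiffAt_const.add (contDiff_const_mul_norm_sq _ _).contDiffAt
    have hBl : Laplacian.laplacian (B t) x = 2 * N * (e * (M / R ^ 2)) := by
      rw [hBx]
      have := (contDiffAt_const (c := e * (ε₂ + ε₁ * (t - a) + M / R ^ 2 * (2 * N * (t - a))))
        ).laplacian_add (contDiff_const_mul_norm_sq (e * (M / R ^ 2)) (-x₀)).contDiffAt (x := x)
      rw [laplacian_const_mul_norm_sq, InnerProductSpace.laplacian_const] at this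
      exact this.trans (by simp)
    have hlap := laplacian_le_of_isLocalMax_sub (h.c2 t ht' x hx') hBc2 hmax
    have hu : HasDerivAt (fun t' : ℝ => t' - a) 1 t := (hasDerivAt_id t).sub_const a
    have hBt : HasDerivAt (fun t' => B t' x)
        (e * (L * 1) * (ε₂ + ε₁ * (t - a) + M / R ^ 2 * (‖x + -x₀‖ ^ 2 + 2 * N * (t - a))) +
          e * (ε₁ * 1 + M / R ^ 2 * (2 * N * 1))) t :=
      ((hu.const_mul L).exp).mul (((hu.const_mul ε₁).const_add ε₂).add
        ((((hu.const_mul (2 * (N : ℝ))).const_add (‖x + -x₀‖ ^ 2))).const_mul (M / R ^ 2)))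
    refine ⟨_, (h.eqn t ht' x hx').sub hBt, ?_⟩
    have hDB : B t x < D t x := by simpa using hpos
    have hDpos : 0 ≤ D t x := (hBnn t ht' x).trans hDB.le
    have h1 := hf t ht' x hx'
    rw [abs_of_nonneg hDpos] at h1
    have h2 : e * (L * 1) * (ε₂ + ε₁ * (t - a) + M / R ^ 2 * (‖x + -x₀‖ ^ 2 + 2 * N * (t - a))) =
        L * B t x := by simp only [hB, ← he]; ring
    have h3 : ε₁ ≤ e * ε₁ := le_mul_of_one_le_left hε₁ he1
    rw [h2]
    rw [hBl] at hlap
    nlinarith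

/-- Two-sided version of `IsHeat.le_center`. -/
theorem abs_le_center {a b R L ε₁ ε₂ M : ℝ} {x₀ : E N} (hR : 0 < R) (hL : 0 ≤ L) (hε₁ : 0 ≤ ε₁)
    (hε₂ : 0 ≤ ε₂) (hM : 0 ≤ M)
    (h : IsHeat (Icc a b) (Metric.closedBall x₀ R) D f)
    (hf : ∀ t ∈ Icc a b, ∀ x ∈ Metric.closedBall x₀ R, |f t x| ≤ L * |D t x| + ε₁)
    (hb : ∀ t ∈ Icc a b, ∀ x ∈ Metric.closedBall x₀ R, |D t x| ≤ M)
    (hi : ∀ x ∈ Metric.closedBall x₀ R, |D a x| ≤ ε₂) :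
    ∀ t ∈ Icc a b, |D t x₀| ≤
      Real.exp (L * (t - a)) * (ε₂ + ε₁ * (t - a) + M / R ^ 2 * (2 * N * (t - a))) := by
  intro t ht
  rw [abs_le']
  refine ⟨h.le_center hR hL hε₁ hε₂ hM (fun t ht x hx => (le_abs_self _).trans (hf t ht x hx))
    (fun t ht x hx => (le_abs_self _).trans (hb t ht x hx))
    (fun x hx => (le_abs_self _).trans (hi x hx)) t ht, ?_⟩
  exact h.neg.le_center hR hL hε₁ hε₂ hM
    (fun t ht x hx => by rw [abs_neg]; exact (neg_le_abs _).trans (hf t ht x hx))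
    (fun t ht x hx => (neg_le_abs _).trans (hb t ht x hx))
    (fun x hx => (neg_le_abs _).trans (hi x hx)) t ht

/-- Interior gradient estimate in a fixed direction, by reflection and comparison. -/
theorem fderiv_le_of_bound {d M F₀ : ℝ} (hd : 0 < d) (hM : 0 ≤ M) (hF₀ : 0 ≤ F₀)
    (h : IsHeat (Icc (-d ^ 2) 0) (Metric.closedBall (0 : E N) d) D f)
    (hf : ∀ t ∈ Icc (-d ^ 2) 0, ∀ x ∈ Metric.closedBall (0 : E N) d, |f t x| ≤ F₀)
    (hb : ∀ t ∈ Icc (-d ^ 2) 0, ∀ x ∈ Metric.closedBall (0 : E N) d, |D t x| ≤ M)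
    (e : E N) (he : ‖e‖ = 1) :
    fderiv ℝ (D 0) 0 e ≤ (N + 1) * M / d + F₀ * d / 2 := by
  -- Minus the reflection in the line `ℝe` is the reflection in the hyperplane `e⊥`. Half of `D - D
  -- ∘ R` again solves a heat equation and vanishes on that hyperplane, so it can be compared with a
  -- barrier on the half ball.
  set R : E N ≃ₗᵢ[ℝ] E N := (ℝ ∙ e).reflection.trans (LinearIsometryEquiv.neg ℝ) with hR
  have hRx : ∀ x, R x = x - (2 * inner ℝ e x) • e := by
    intro x
    simp only [hR, LinearIsometryEquiv.coe_trans, Function.comp_apply,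
      LinearIsometryEquiv.coe_neg, Submodule.reflection_singleton_apply, he]
    simp [two_smul, add_smul, two_mul]
  have hRn : ∀ x, ‖R x‖ = ‖x‖ := R.norm_map
  set K : Set (E N) := Metric.closedBall 0 d ∩ {x | 0 ≤ inner ℝ e x} with hK
  set O : Set (E N) := Metric.ball 0 d ∩ {x | 0 < inner ℝ e x} with hO
  have hKc : IsCompact K := (isCompact_closedBall 0 d).inter_right
    (isClosed_le continuous_const (by fun_prop))
  have hOo : IsOpen O := Metric.isOpen_ball.inter (isOpen_lt continuous_const (by fun_prop))
  have hOK : O ⊆ K := fun x hx =>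
    ⟨Metric.ball_subset_closedBall hx.1, le_of_lt (show 0 < inner ℝ e x from hx.2)⟩
  have hxn : ∀ x ∈ K, inner ℝ e x ≤ d := by
    intro x hx
    have h1 := real_inner_le_norm e x
    have h2 : ‖x‖ ≤ d := by simpa using hx.1
    rw [he, one_mul] at h1
    linarith
  have hφ : IsHeat (Icc (-d ^ 2) 0) (Metric.closedBall (0 : E N) d)
      (fun t x => 1 / 2 * (D t x - D t (R x))) (fun t x => 1 / 2 * (f t x - f t (R x))) :=
    (h.sub (h.comp_isometry R fun x hx => by simpa [hRn] using hx)).const_mul (1 / 2)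
  set a := M / d ^ 2 with ha
  have hann : 0 ≤ a := by positivity
  have had : a * d ^ 2 = M := div_mul_cancel₀ _ (by positivity)
  set α := (N + 1) * M / d + F₀ * d / 2 with hα
  have hα' : α = (N + 1) * (a * d) + F₀ * d / 2 := by
    rw [hα, ← had]; field_simp
  set γ := -(a * (N + 1)) - F₀ / 2 with hγ
  -- With `u = ⟨e, x⟩`, the last two terms equal `(a(N+1) + F₀/2) u (d - u)`, which is nonnegative
  -- on the half ball. The choice of `γ` gives `∂ₜB - ΔB = a + F₀ ≥ F₀`, and `a d² = M` makes `B`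
  -- dominate `M` at the initial time and on the spherical part of the boundary.
  set B : ℝ → E N → ℝ := fun t x =>
    -(a * t) + a * ‖x‖ ^ 2 + α * inner ℝ e x + γ * inner ℝ e x ^ 2 with hB
  have hBc : Continuous (fun p : ℝ × E N => B p.1 p.2) := by simp only [hB]; fun_prop
  have hBlow : ∀ t, ∀ x ∈ K, a * (-t + ‖x‖ ^ 2 + inner ℝ e x * (d - inner ℝ e x)) ≤ B t x := by
    intro t x hx
    have h1 := hxn x hx
    have h0 : 0 ≤ inner ℝ e x := hx.2
    set u := inner ℝ e x
    have h3 : B t x - a * (-t + ‖x‖ ^ 2 + u * (d - u)) =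
        (a * N + F₀ / 2) * (u * (d - u)) := by
      simp only [hB, hα', hγ]; ring
    have h4 : 0 ≤ (a * N + F₀ / 2) * (u * (d - u)) :=
      mul_nonneg (by positivity) (mul_nonneg h0 (by linarith))
    linarith
  have hφb : ∀ t ∈ Icc (-d ^ 2) 0, ∀ x ∈ K, 1 / 2 * (D t x - D t (R x)) ≤ M := by
    intro t ht x hx
    have h1 := abs_le.1 (hb t ht x hx.1)
    have h2 := abs_le.1 (hb t ht (R x) (by simpa [hRn] using hx.1))
    linarith [h1.2, h2.1]
  have key := nonpos_of_parabolic hKc hOo hOK (L := 0) (a := -d ^ 2) (b := 0)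
    (W := fun t x => 1 / 2 * (D t x - D t (R x)) - B t x)
    ((hφ.cont.mono (prod_mono le_rfl inter_subset_left)).sub hBc.continuousOn) ?_ ?_ ?_
  -- At `x = ρe` the quadratic terms of the barrier add up to `(a + γ)ρ² ≤ 0`, leaving only `αρ`.
  -- Dividing by `ρ` and letting `ρ → 0` yields twice the directional derivative.
  · have hup : ∀ ρ ∈ Ioo 0 d, D 0 (ρ • e) - D 0 (-ρ • e) ≤ 2 * ρ * α := by
      intro ρ hρ
      have hin : inner ℝ e (ρ • e) = ρ := by
        rw [inner_smul_right, real_inner_self_eq_norm_sq, he]; simp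
      have hnρ : ‖ρ • e‖ = ρ := by rw [norm_smul, he, mul_one, Real.norm_of_nonneg hρ.1.le]
      have h1 := key 0 ⟨by nlinarith, le_rfl⟩ (ρ • e)
        ⟨by simpa [hnρ] using hρ.2.le, by simpa only [mem_ofPred_eq, hin] using hρ.1.le⟩
      have h2 : R (ρ • e) = -ρ • e := by
        rw [hRx, hin, ← sub_smul]; congr 1; ring
      simp only [hB, h2, hin, hnρ] at h1
      have h3 : a + γ ≤ 0 := by
        have : 0 ≤ a * N := by positivity
        simp only [hγ]; linarith
      nlinarith [sq_nonneg ρ]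
    have hdiff : DifferentiableAt ℝ (D 0) 0 :=
      (h.c2 0 ⟨by nlinarith, le_rfl⟩ 0 (Metric.mem_closedBall_self hd.le)).differentiableAt
        (by simp)
    have hl : ∀ c : ℝ, HasDerivAt (fun ρ : ℝ => D 0 ((c * ρ) • e)) (c * fderiv ℝ (D 0) 0 e) 0 := by
      intro c
      have h1 : HasDerivAt (fun ρ : ℝ => (c * ρ) • e) (c • e) 0 := by
        simpa using ((hasDerivAt_id (0 : ℝ)).const_mul c).smul_const e
      have h2 : HasFDerivAt (D 0) (fderiv ℝ (D 0) 0) ((c * 0) • e) := by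
        simpa using hdiff.hasFDerivAt
      exact (h2.comp_hasDerivAt (0 : ℝ) h1).congr_deriv (by simp)
    have hder := (hl 1).sub (hl (-1))
    have hs := (hasDerivAt_iff_tendsto_slope.1 hder).mono_left
      (nhdsWithin_mono 0 (s := Ioi 0) fun r hr => ne_of_gt hr)
    have hle := le_of_tendsto hs (b := 2 * α) (by
      filter_upwards [Ioo_mem_nhdsGT hd] with ρ hρ
      rw [slope_def_field]
      have := hup ρ hρ
      rw [div_le_iff₀ (by linarith [hρ.1])]
      simp only [Pi.sub_apply, one_mul, neg_mul, neg_zero, zero_smul, sub_self,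
        sub_zero]
      linarith)
    linarith
  · intro x hx
    have h1 := hφb (-d ^ 2) ⟨le_rfl, by nlinarith⟩ x hx
    have h2 := hBlow (-d ^ 2) x hx
    have h3 := hxn x hx
    have h4 : 0 ≤ inner ℝ e x * (d - inner ℝ e x) := mul_nonneg hx.2 (by linarith)
    have h5 : a * d ^ 2 ≤ a * (-(-d ^ 2) + ‖x‖ ^ 2 + inner ℝ e x * (d - inner ℝ e x)) :=
      mul_le_mul_of_nonneg_left (by nlinarith [sq_nonneg ‖x‖]) hann
    linarith
  · rintro t ht x ⟨hx, hxO⟩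
    have h2 := hBlow t x hx
    have h3 := hxn x hx
    have h4 : 0 ≤ inner ℝ e x * (d - inner ℝ e x) := mul_nonneg hx.2 (by linarith)
    by_cases h0 : inner ℝ e x = 0
    · have h5 : R x = x := by rw [hRx, h0]; simp
      have h6 : 0 ≤ a * (-t + ‖x‖ ^ 2 + inner ℝ e x * (d - inner ℝ e x)) :=
        mul_nonneg hann (by nlinarith [sq_nonneg ‖x‖, ht.2])
      rw [h5]
      linarith
    · have hpos : 0 < inner ℝ e x := lt_of_le_of_ne hx.2 (Ne.symm h0)
      have hnx : ‖x‖ = d := by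
        refine le_antisymm (by simpa using hx.1) (not_lt.1 fun hlt => hxO ⟨?_, hpos⟩)
        simpa using hlt
      have h1 := hφb t ht x hx
      have h5 : a * d ^ 2 ≤ a * (-t + ‖x‖ ^ 2 + inner ℝ e x * (d - inner ℝ e x)) :=
        mul_le_mul_of_nonneg_left (by rw [hnx]; linarith [ht.2]) hann
      linarith
  · intro t ht x hx hpos hmax
    have ht' : t ∈ Icc (-d ^ 2) 0 := ⟨ht.1.le, ht.2⟩
    have hx' := Metric.ball_subset_closedBall hx.1
    have hlap := laplacian_le_of_isLocalMax_sub (hφ.c2 t ht' x hx')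
      (contDiff_quadratic (-(a * t)) a α γ e).contDiffAt hmax
    rw [laplacian_quadratic, he] at hlap
    have hBt : HasDerivAt (fun t' => B t' x) (-a) t := by
      have := ((((hasDerivAt_id t).const_mul a).neg.add_const (a * ‖x‖ ^ 2)).add_const
        (α * inner ℝ e x)).add_const (γ * inner ℝ e x ^ 2)
      exact this.congr_deriv (by simp)
    refine ⟨_, (hφ.eqn t ht' x hx').sub hBt, ?_⟩
    have h1 := abs_le.1 (hf t ht' x hx')
    have h2 := abs_le.1 (hf t ht' (R x) (by simpa [hRn] using hx'))
    simp only [hγ] at hlap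
    linarith [h1.2, h2.1]

/-- Interior gradient estimate for the heat equation with bounded source. -/
theorem norm_gradient_le {d M F₀ b : ℝ} {x₀ : E N} (hd : 0 < d) (hM : 0 ≤ M) (hF₀ : 0 ≤ F₀)
    (h : IsHeat (Icc (b - d ^ 2) b) (Metric.closedBall x₀ d) D f)
    (hf : ∀ t ∈ Icc (b - d ^ 2) b, ∀ x ∈ Metric.closedBall x₀ d, |f t x| ≤ F₀)
    (hb : ∀ t ∈ Icc (b - d ^ 2) b, ∀ x ∈ Metric.closedBall x₀ d, |D t x| ≤ M) :
    ‖gradient (D b) x₀‖ ≤ (N + 1) * M / d + F₀ * d / 2 := by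
  by_cases h0 : gradient (D b) x₀ = 0
  · rw [h0, norm_zero]; positivity
  have hJ : ∀ t ∈ Icc (-d ^ 2) 0, b + 1 * t ∈ Icc (b - d ^ 2) b := fun t ht =>
    ⟨by linarith [ht.1], by linarith [ht.2]⟩
  have hO : ∀ x ∈ Metric.closedBall (0 : E N) d, x₀ + (1 : ℝ) • x ∈ Metric.closedBall x₀ d := by
    intro x hx; simpa using hx
  have h1 := h.rescale (J := Icc (-d ^ 2) 0) (O' := Metric.closedBall (0 : E N) d) (l := 1)
    (c := 1) one_ne_zero (by norm_num) b x₀ hJ hO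
  have hg : 0 < ‖gradient (D b) x₀‖ := norm_pos_iff.2 h0
  set e := ‖gradient (D b) x₀‖⁻¹ • gradient (D b) x₀ with he
  have h2 := h1.fderiv_le_of_bound hd hM hF₀
    (fun t ht x hx => by simpa using hf _ (hJ t ht) _ (hO x hx))
    (fun t ht x hx => hb _ (hJ t ht) _ (hO x hx)) e
    (by rw [he, norm_smul, norm_inv, norm_norm, inv_mul_cancel₀ hg.ne'])
  have h3 : fderiv ℝ (fun x => D (b + 1 * 0) (x₀ + (1 : ℝ) • x)) 0 e = fderiv ℝ (D b) x₀ e := by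
    simp only [mul_zero, add_zero, one_smul]
    rw [fderiv_comp_add_left, add_zero]
  have h4 : fderiv ℝ (D b) x₀ e = ‖gradient (D b) x₀‖ := by
    have : fderiv ℝ (D b) x₀ e = inner ℝ (gradient (D b) x₀) e := by
      rw [gradient, InnerProductSpace.toDual_symm_apply]
    rw [this, he, inner_smul_right, real_inner_self_eq_norm_sq]
    field_simp
  linarith [h3 ▸ h2]

end IsHeat

/-! ### Pointwise gradients of functions in `W^{1,∞}` -/

lemma norm_gradient_eq (f : E N → ℝ) (x : E N) : ‖gradient f x‖ = ‖fderiv ℝ f x‖ := by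
  simp [gradient]

lemma inner_gradient (f : E N → ℝ) (x v : E N) : inner ℝ (gradient f x) v = fderiv ℝ f x v := by
  rw [gradient, InnerProductSpace.toDual_symm_apply]

/-- The directional derivative of a `W^{1,∞}` function at a point of differentiability, tested
against a rescaled bump function. -/
lemma W1infLE.fderiv_mul_le {Ω : Set (E N)} {f : E N → ℝ} {M : ℝ}
    (hf : W1infLE Ω f M) {x₀ : E N} (φ : ContDiffBump (0 : E N)) (hφ : φ.rOut = 1)
    {ε η : ℝ} (hε : 0 < ε) (hball : Metric.closedBall x₀ ε ⊆ Ω) (ℓ : E N →L[ℝ] ℝ)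
    (happ : ∀ x ∈ Metric.closedBall x₀ ε, |f x - f x₀ - ℓ (x - x₀)| ≤ η * ε) (v : E N) :
    ℓ v * ∫ x, φ x ≤ M * ‖v‖ * (∫ x, φ x) + η * ∫ x, |fderiv ℝ φ x v| := by
  obtain ⟨hfm, hfb, G, hGm, hGb, hw⟩ := hf
  set ψ : E N → ℝ := fun x => φ (ε⁻¹ • (x - x₀)) with hψ
  have hψs : ContDiff ℝ ∞ ψ := φ.contDiff.comp (by fun_prop)
  have hψsupp : ∀ x, x ∉ Metric.closedBall x₀ ε → ψ x = 0 := by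
    intro x hx
    apply φ.zero_of_le_dist
    rw [hφ, dist_zero_right, norm_smul, norm_inv, Real.norm_of_nonneg hε.le, ← dist_eq_norm,
      inv_mul_eq_div, le_div_iff₀ hε]
    simp only [Metric.mem_closedBall, not_le] at hx
    linarith
  have hψt : tsupport ψ ⊆ Metric.closedBall x₀ ε :=
    closure_minimal (fun x hx => by_contra fun h => hx (hψsupp x h)) Metric.isClosed_closedBall
  have hψc : HasCompactSupport ψ := (isCompact_closedBall x₀ ε).of_isClosed_subset
    (isClosed_tsupport ψ) hψt
  have hψ0 : ∀ x, 0 ≤ ψ x := fun x => φ.nonneg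
  have hψi : Integrable ψ := hψs.continuous.integrable_of_hasCompactSupport hψc
  have hDc : Continuous (fun x => fderiv ℝ ψ x v) :=
    (hψs.continuous_fderiv (by simp)).clm_apply continuous_const
  have hDi : Integrable (fun x => fderiv ℝ ψ x v) :=
    hDc.integrable_of_hasCompactSupport (hψc.fderiv_apply ℝ v)
  have hDsupp : ∀ x, x ∉ Metric.closedBall x₀ ε → fderiv ℝ ψ x v = 0 := by
    intro x hx
    have : fderiv ℝ ψ x = 0 := by
      by_contra h
      exact hx (hψt (support_fderiv_subset ℝ h))
    rw [this]; rfl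
  -- Classical integration by parts applies to the affine approximant, the weak gradient to `f`;
  -- their difference is at most `ηε` on the support of the test function.
  set A : E N → ℝ := fun x => f x₀ + ℓ (x - x₀) with hA
  have hAd : ∀ x, HasFDerivAt A ℓ x := by
    intro x
    have := (ℓ.hasFDerivAt (x := x - x₀)).comp x ((hasFDerivAt_id x).sub_const x₀)
    exact this.const_add (f x₀)
  have hAc : Continuous A := continuous_iff_continuousAt.2 fun x => (hAd x).continuousAt
  have hADi : Integrable (fun x => A x * fderiv ℝ ψ x v) :=
    (hAc.mul hDc).integrable_of_hasCompactSupport (hψc.fderiv_apply ℝ v).mul_left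
  have hibp : ∫ x, A x * fderiv ℝ ψ x v = -(ℓ v * ∫ x, ψ x) := by
    rw [integral_mul_fderiv_eq_neg_fderiv_mul_of_integrable]
    · simp only [fun x => (hAd x).fderiv, integral_const_mul]
    · simp only [fun x => (hAd x).fderiv]
      exact hψi.const_mul _
    · exact hADi
    · exact (hAc.mul hψs.continuous).integrable_of_hasCompactSupport hψc.mul_left
    · exact fun x _ => (hAd x).differentiableAt
    · exact fun x _ => hψs.differentiable (by simp) x
  have hweak := hw ψ hψs hψc (hψt.trans hball) v
  have hsetA : ∫ x in Ω, A x * fderiv ℝ ψ x v = -(ℓ v * ∫ x, ψ x) := by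
    rw [setIntegral_eq_integral_of_forall_compl_eq_zero, hibp]
    intro x hx
    rw [hDsupp x fun h => hx (hball h), mul_zero]
  have hfD : IntegrableOn (fun x => f x * fderiv ℝ ψ x v) Ω :=
    hDi.integrableOn.bdd_mul hfm (by simpa using hfb)
  have hdiff : ∫ x in Ω, (f x - A x) * fderiv ℝ ψ x v =
      (-∫ x in Ω, inner ℝ (G x) v * ψ x) + ℓ v * ∫ x, ψ x := by
    simp only [sub_mul]
    rw [integral_sub hfD hADi.integrableOn, hweak, hsetA]
    ring
  have h1 : |∫ x in Ω, (f x - A x) * fderiv ℝ ψ x v| ≤ η * ε * ∫ x, |fderiv ℝ ψ x v| := by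
    rw [setIntegral_eq_integral_of_forall_compl_eq_zero
      (fun x hx => by rw [hDsupp x fun h => hx (hball h), mul_zero]), ← integral_const_mul]
    refine (abs_integral_le_integral_abs).trans ?_
    refine integral_mono_of_nonneg (Eventually.of_forall fun x => abs_nonneg _)
      (hDi.abs.const_mul _) (Eventually.of_forall fun x => ?_)
    simp only [abs_mul]
    by_cases hx : x ∈ Metric.closedBall x₀ ε
    · refine mul_le_mul_of_nonneg_right ?_ (abs_nonneg _)
      have := happ x hx
      simp only [hA]
      rwa [← sub_sub]
    · rw [hDsupp x hx]; simp
  have h2 : |∫ x in Ω, inner ℝ (G x) v * ψ x| ≤ M * ‖v‖ * ∫ x, ψ x := by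
    have h3 : ∫ x in Ω, M * ‖v‖ * ψ x = M * ‖v‖ * ∫ x, ψ x := by
      rw [integral_const_mul, setIntegral_eq_integral_of_forall_compl_eq_zero]
      exact fun x hx => hψsupp x fun h => hx (hball h)
    rw [← h3]
    refine (abs_integral_le_integral_abs).trans ?_
    refine integral_mono_of_nonneg (Eventually.of_forall fun x => abs_nonneg _)
      (hψi.const_mul _).integrableOn ?_
    filter_upwards [hGb] with x hx
    rw [abs_mul, abs_of_nonneg (hψ0 x)]
    refine mul_le_mul_of_nonneg_right ?_ (hψ0 x)
    exact (abs_real_inner_le_norm _ _).trans (mul_le_mul_of_nonneg_right hx (norm_nonneg _))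
  -- The Jacobian of the rescaling. The derivative of the rescaled bump carries an extra `ε⁻¹`,
  -- which cancels the `ε` in the approximation error `ηε`.
  set c := |ε ^ Module.finrank ℝ (E N)| with hc
  have hcpos : 0 < c := abs_pos.2 (pow_ne_zero _ hε.ne')
  have hI : ∫ x, ψ x = c * ∫ x, φ x := by
    simp only [hψ]
    rw [integral_sub_right_eq_self (fun x => φ (ε⁻¹ • x)) x₀, Measure.integral_comp_inv_smul,
      smul_eq_mul]
  have hDψ : ∀ x, fderiv ℝ ψ x v = ε⁻¹ * fderiv ℝ φ (ε⁻¹ • (x - x₀)) v := by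
    intro x
    simp only [hψ]
    rw [fderiv_comp_sub (f := fun x => φ (ε⁻¹ • x)), fderiv_comp_smul]
    rfl
  have hJ : ε * ∫ x, |fderiv ℝ ψ x v| = c * ∫ x, |fderiv ℝ φ x v| := by
    simp only [hDψ, abs_mul, abs_of_pos (inv_pos.2 hε), integral_const_mul]
    rw [integral_sub_right_eq_self (fun x => |fderiv ℝ φ (ε⁻¹ • x) v|) x₀,
      Measure.integral_comp_inv_smul volume (fun x => |fderiv ℝ φ x v|), smul_eq_mul, ← mul_assoc,
      mul_inv_cancel₀ hε.ne', one_mul]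
  have h4 := (abs_le.1 h1).2
  have h5 := (abs_le.1 h2).2
  rw [hdiff, mul_assoc, hJ, hI] at h4
  rw [hI] at h5
  refine le_of_mul_le_mul_left ?_ hcpos
  linarith

theorem W1infLE.nonneg {Ω : Set (E N)} (hΩ : IsOpen Ω) {f : E N → ℝ} {M : ℝ}
    (hf : W1infLE Ω f M) (hne : Ω.Nonempty) : 0 ≤ M := by
  have h1 : (volume.restrict Ω) ≠ 0 := by
    rw [Ne, Measure.restrict_eq_zero]
    exact (hΩ.measure_pos volume hne).ne'
  have : (ae (volume.restrict Ω)).NeBot := ae_neBot.2 h1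
  obtain ⟨x, hx⟩ := hf.2.1.exists
  exact (abs_nonneg _).trans hx

/-- The weak gradient is bounded only almost everywhere, but differentiability at `x₀` makes the
affine error `ηε` with `η` arbitrary on small balls, so `W1infLE.fderiv_mul_le` gives the bound as
`η → 0`. -/
theorem W1infLE.norm_gradient_le {Ω : Set (E N)} (hΩ : IsOpen Ω) {f : E N → ℝ} {M : ℝ}
    (hf : W1infLE Ω f M) {x₀ : E N} (hx₀ : x₀ ∈ Ω) (hd : DifferentiableAt ℝ f x₀) :
    ‖gradient f x₀‖ ≤ M := by
  have hM := hf.nonneg hΩ ⟨x₀, hx₀⟩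
  rw [norm_gradient_eq]
  let φ : ContDiffBump (0 : E N) := ⟨1 / 2, 1, by norm_num, by norm_num⟩
  have hI : 0 < ∫ x, φ x := φ.integral_pos
  have key : ∀ v : E N, fderiv ℝ f x₀ v ≤ M * ‖v‖ := by
    intro v
    set J := ∫ x, |fderiv ℝ φ x v|
    have hJ : 0 ≤ J := integral_nonneg fun x => abs_nonneg _
    have h1 : ∀ η > 0, fderiv ℝ f x₀ v * (∫ x, φ x) ≤ M * ‖v‖ * (∫ x, φ x) + η * J := by
      intro η hη
      have h2 := hd.hasFDerivAt.isLittleO.def hη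
      obtain ⟨r, hr, hr'⟩ := Metric.eventually_nhds_iff_ball.1 (h2.and (hΩ.mem_nhds hx₀))
      have hsub : ∀ x ∈ Metric.closedBall x₀ (r / 2), x ∈ Metric.ball x₀ r := fun x hx =>
        Metric.closedBall_subset_ball (by linarith) hx
      refine hf.fderiv_mul_le φ rfl (ε := r / 2) (by linarith) (fun x hx => (hr' x (hsub x hx)).2)
        _ (fun x hx => ?_) v
      have h3 := (hr' x (hsub x hx)).1
      rw [Real.norm_eq_abs] at h3
      refine h3.trans (mul_le_mul_of_nonneg_left ?_ hη.le)
      rw [← dist_eq_norm]; exact hx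
    have h3 : Tendsto (fun η : ℝ => M * ‖v‖ * (∫ x, φ x) + η * J) (𝓝[>] 0)
        (𝓝 (M * ‖v‖ * (∫ x, φ x) + 0 * J)) :=
      ((continuous_const.add (continuous_id.mul continuous_const)).tendsto 0).mono_left
        nhdsWithin_le_nhds
    have h4 := ge_of_tendsto h3 (eventually_mem_nhdsWithin.mono fun η hη => h1 η hη)
    rw [zero_mul, add_zero] at h4
    exact le_of_mul_le_mul_right h4 hI
  refine ContinuousLinearMap.opNorm_le_bound _ hM fun v => ?_
  rw [Real.norm_eq_abs, abs_le']
  refine ⟨key v, ?_⟩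
  simpa using key (-v)

theorem W1infLE.add {Ω : Set (E N)} {f g : E N → ℝ} {M M' : ℝ} (hf : W1infLE Ω f M)
    (hg : W1infLE Ω g M') : W1infLE Ω (fun x => f x + g x) (M + M') := by
  obtain ⟨hfm, hfb, G, hGm, hGb, hGw⟩ := hf
  obtain ⟨hgm, hgb, G', hGm', hGb', hGw'⟩ := hg
  refine ⟨hfm.add hgm, ?_, fun x => G x + G' x, hGm.add hGm', ?_, ?_⟩
  · filter_upwards [hfb, hgb] with x h1 h2 using (abs_add_le _ _).trans (add_le_add h1 h2)
  · filter_upwards [hGb, hGb'] with x h1 h2 using (norm_add_le _ _).trans (add_le_add h1 h2)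
  · intro φ hφ hφc hφΩ v
    have hD : IntegrableOn (fun x => fderiv ℝ φ x v) Ω :=
      (((hφ.continuous_fderiv (by simp)).clm_apply
        continuous_const).integrable_of_hasCompactSupport (hφc.fderiv_apply ℝ v)).integrableOn
    have hi : IntegrableOn φ Ω := (hφ.continuous.integrable_of_hasCompactSupport hφc).integrableOn
    have hin : ∀ {H : E N → E N} {m : ℝ}, AEStronglyMeasurable H (volume.restrict Ω) →
        (∀ᵐ x ∂(volume.restrict Ω), ‖H x‖ ≤ m) →
        IntegrableOn (fun x => inner ℝ (H x) v * φ x) Ω := by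
      intro H m hm hb
      refine hi.bdd_mul (c := m * ‖v‖) (hm.inner aestronglyMeasurable_const) ?_
      filter_upwards [hb] with x hx
      exact (abs_real_inner_le_norm _ _).trans (mul_le_mul_of_nonneg_right hx (norm_nonneg _))
    simp only [add_mul, inner_add_left]
    rw [integral_add (hD.bdd_mul hfm (by simpa using hfb)) (hD.bdd_mul hgm (by simpa using hgb)),
      integral_add (hin hGm hGb) (hin hGm' hGb'), hGw φ hφ hφc hφΩ v, hGw' φ hφ hφc hφΩ v]
    ring

/-- Along a trajectory in `C([t₀,T);H)`, gradients are bounded on compact time intervals. -/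
theorem ContInH.exists_gradient_bound {Ω : Set (E N)} (hΩ : IsOpen Ω) {ψ : E N → ℝ} {t₀ T : ℝ}
    {h : ℝ → E N → ℝ} (hψ : ContDiff ℝ ∞ ψ) (hh : ContInH Ω ψ t₀ T h) {t₁ : ℝ} (ht₁ : t₁ < T)
    (R : ℝ) :
    ∃ M, ∀ t ∈ Icc t₀ t₁, ∀ x ∈ Ω, ‖x‖ ≤ R → ‖gradient (h t) x‖ ≤ M := by
  have h1 : ∃ M, ∀ t ∈ Icc t₀ t₁, W1infLE Ω (fun x => h t x - ψ x) M := by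
    have hsub : Icc t₀ t₁ ⊆ Ico t₀ T := fun t ht => ⟨ht.1, ht.2.trans_lt ht₁⟩
    have mono : ∀ {f : E N → ℝ} {M M' : ℝ}, M ≤ M' → W1infLE Ω f M → W1infLE Ω f M' := by
      rintro f M M' hMM ⟨hm, hb, G, hGm, hGb, hw⟩
      exact ⟨hm, hb.mono fun x hx => hx.trans hMM, G, hGm, hGb.mono fun x hx => hx.trans hMM, hw⟩
    -- Continuity in time for the `W^{1,∞}` distance bounds `h t' - h t` by `1` near each `t`;
    -- compactness of the interval does the rest.
    refine isCompact_Icc.induction_on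
      (p := fun s => ∃ M, ∀ t ∈ s, W1infLE Ω (fun x => h t x - ψ x) M) ⟨0, by simp⟩ ?_ ?_ ?_
    · rintro s s' hss ⟨M, hM⟩
      exact ⟨M, fun t ht => hM t (hss ht)⟩
    · rintro s s' ⟨M, hM⟩ ⟨M', hM'⟩
      refine ⟨max M M', fun t ht => ?_⟩
      rcases ht with ht | ht
      · exact mono (le_max_left _ _) (hM t ht)
      · exact mono (le_max_right _ _) (hM' t ht)
    · intro t ht
      obtain ⟨M, hM⟩ := (hh.1 t (hsub ht)).1
      have h2 := hh.2 t (hsub ht) 1 one_pos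
      have h3 : ∀ᶠ t' in 𝓝[Icc t₀ t₁] t, W1infLE Ω (fun x => h t' x - h t x) 1 :=
        h2.filter_mono (nhdsWithin_mono t hsub)
      refine ⟨_, h3, 1 + M, fun t' ht' => ?_⟩
      have h4 := W1infLE.add ht' hM
      simpa using h4
  obtain ⟨M, hM⟩ := h1
  have hψc : Continuous (fderiv ℝ ψ) := hψ.continuous_fderiv (by simp)
  obtain ⟨M', hM'⟩ := (isCompact_closedBall (0 : E N) R).exists_bound_of_continuousOn
    hψc.continuousOn
  refine ⟨max 0 (M + M'), fun t ht x hx hxR => ?_⟩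
  by_cases hd : DifferentiableAt ℝ (h t) x
  · have hψd : DifferentiableAt ℝ ψ x := hψ.differentiable (by simp) x
    have h2 := (hM t ht).norm_gradient_le hΩ hx (hd.sub hψd)
    rw [norm_gradient_eq, fderiv_fun_sub hd hψd] at h2
    have h3 := hM' x (by simpa using hxR)
    rw [norm_gradient_eq]
    refine le_max_of_le_right ?_
    calc ‖fderiv ℝ (h t) x‖ = ‖fderiv ℝ (h t) x - fderiv ℝ ψ x + fderiv ℝ ψ x‖ := by simp
      _ ≤ M + M' := (norm_add_le _ _).trans (add_le_add h2 h3)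
  -- `h t₀` is not assumed differentiable; where it is not, `gradient` has the default value `0`.
  · rw [norm_gradient_eq, fderiv_zero_of_not_differentiableAt hd]
    simp

/-! ### Pointwise consequences of the spectral bounds -/

/-- The set where the bound fails is open, so it has positive measure unless it is empty. -/
lemma forall_le_of_ae_le {U : Set (E N)} (hU : IsOpen U) {f : E N → ℝ} {B : ℝ}
    (hf : ContinuousOn f U) (h : ∀ᵐ y : E N, y ∈ U → |f y| ≤ B) : ∀ y ∈ U, |f y| ≤ B := by
  intro y hy
  by_contra! hlt
  have hopen : IsOpen (U ∩ (fun y => |f y|) ⁻¹' Ioi B) := hf.abs.isOpen_inter_preimage hU isOpen_Ioi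
  have hpos := hopen.measure_pos volume ⟨y, hy, hlt⟩
  have hzero : volume (U ∩ (fun y => |f y|) ⁻¹' Ioi B) = 0 := by
    refine measure_mono_null ?_ (ae_iff.1 h)
    rintro z ⟨hz, hz'⟩ hcon
    exact absurd (hcon hz) (not_le.2 hz')
  exact hpos.ne' hzero

/-- The inner part of an element of `V` is the sum of its modes. -/
lemma MemV.inner_bound {χ₀ : ℝ → ℝ} {P : Params} {s₀ : ℝ} (hs₀ : 1 < s₀) :
    ∃ C, 0 ≤ C ∧ ∀ s, s₀ ≤ s → ∀ r : E N → ℝ, MemV χ₀ P s r → ∀ᵐ y : E N,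
      |innerPart χ₀ P.K₀ s r y| ≤ C * (Real.log s / s ^ 2) *
        ((1 + ‖y‖ ^ 2) + (1 + ‖y‖ ^ 3) / Real.sqrt s) := by
  have hl₀ : 0 < Real.log s₀ := Real.log_pos hs₀
  have hA := P.A_pos
  have hAα : 0 < P.A ^ P.αlo := Real.rpow_pos_of_pos hA _
  refine ⟨P.A / Real.log s₀ + N * (P.A / Real.log s₀) + (N * N * P.A ^ 2 + 2 * (N * P.A ^ 2)) +
    P.A ^ P.αlo, by positivity, fun s hs r hr => ?_⟩
  have hs1 : 1 < s := hs₀.trans_le hs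
  have hl : Real.log s₀ ≤ Real.log s := Real.log_le_log (by linarith) hs
  have hls : 0 < Real.log s := hl₀.trans_le hl
  set m := Real.log s / s ^ 2 with hm
  have hmpos : 0 < m := by positivity
  -- Modes `0` and `1` carry no logarithm; `log s ≥ log s₀ > 0` lets a common factor `m = log s /
  -- s²` be used for all modes.
  have hAm : P.A / s ^ 2 ≤ P.A / Real.log s₀ * m := by
    rw [hm, div_mul_div_comm, div_le_div_iff₀ (by positivity) (by positivity)]
    have : Real.log s₀ * (P.A * s ^ 2) ≤ Real.log s * (P.A * s ^ 2) :=
      mul_le_mul_of_nonneg_right hl (by positivity)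
    linarith
  set g := innerPart χ₀ P.K₀ s r with hg
  have hm2 : ∀ i j, |mode2 g i j| ≤ P.A ^ 2 * m := by
    intro i j
    have h1 : mode2 g i j ^ 2 ≤ ∑ i, ∑ j, mode2 g i j ^ 2 :=
      (Finset.single_le_sum (f := fun j => mode2 g i j ^ 2) (fun j _ => sq_nonneg _)
        (Finset.mem_univ j)).trans
        (Finset.single_le_sum (f := fun i => ∑ j, mode2 g i j ^ 2)
          (fun i _ => Finset.sum_nonneg fun j _ => sq_nonneg _) (Finset.mem_univ i))
    have h2 := Real.abs_le_sqrt h1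
    have h3 := hr.bound2
    rw [hm, ← mul_div_assoc]
    exact h2.trans h3
  filter_upwards [hr.boundNeg] with y hy
  have hyi : ∀ i, |y i| ≤ ‖y‖ := fun i => by
    simpa using PiLp.norm_apply_le y i
  have hs52 : s ^ (5 / 2 : ℝ) = s ^ 2 * Real.sqrt s := by
    rw [Real.sqrt_eq_rpow, ← Real.rpow_natCast, ← Real.rpow_add (by linarith)]
    norm_num
  have hneg : |modeNeg g y| ≤ P.A ^ P.αlo * m * ((1 + ‖y‖ ^ 3) / Real.sqrt s) := by
    rw [div_le_iff₀ (by positivity), hs52] at hy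
    refine hy.trans (le_of_eq ?_)
    have : Real.sqrt s ≠ 0 := (Real.sqrt_pos.2 (by linarith)).ne'
    rw [hm]; field_simp
  have hdec : g y = modeNeg g y + (mode0 g + ∑ i, mode1 g i * y i
      + (∑ i, ∑ j, mode2 g i j * y i * y j - 2 * ∑ i, mode2 g i i)) := by
    simp [modeNeg]
  have hy2 : ‖y‖ ≤ 1 + ‖y‖ ^ 2 := by nlinarith [sq_nonneg (‖y‖ - 1), norm_nonneg y]
  have h1y : 1 ≤ 1 + ‖y‖ ^ 2 := by nlinarith [sq_nonneg ‖y‖]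
  have e0 : |mode0 g| ≤ P.A / Real.log s₀ * m * (1 + ‖y‖ ^ 2) :=
    (hr.bound0.trans hAm).trans (le_mul_of_one_le_right (by positivity) h1y)
  have e1 : |∑ i, mode1 g i * y i| ≤ N * (P.A / Real.log s₀) * m * (1 + ‖y‖ ^ 2) := by
    calc |∑ i, mode1 g i * y i| ≤ ∑ i : Fin N, |mode1 g i * y i| := Finset.abs_sum_le_sum_abs _ _
      _ ≤ ∑ i : Fin N, P.A / Real.log s₀ * m * (1 + ‖y‖ ^ 2) := by
          refine Finset.sum_le_sum fun i _ => ?_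
          rw [abs_mul]
          exact mul_le_mul ((hr.bound1 i).trans hAm) ((hyi i).trans hy2) (abs_nonneg _)
            (by positivity)
      _ = _ := by simp; ring
  have e2 : |∑ i, ∑ j, mode2 g i j * y i * y j| ≤ N * N * P.A ^ 2 * m * (1 + ‖y‖ ^ 2) := by
    calc |∑ i, ∑ j, mode2 g i j * y i * y j| ≤ ∑ i : Fin N, ∑ j : Fin N,
          |mode2 g i j * y i * y j| :=
          (Finset.abs_sum_le_sum_abs _ _).trans
            (Finset.sum_le_sum fun i _ => Finset.abs_sum_le_sum_abs _ _)
      _ ≤ ∑ i : Fin N, ∑ j : Fin N, P.A ^ 2 * m * (1 + ‖y‖ ^ 2) := by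
          refine Finset.sum_le_sum fun i _ => Finset.sum_le_sum fun j _ => ?_
          rw [mul_assoc, abs_mul, abs_mul]
          refine mul_le_mul (hm2 i j) ?_ (by positivity) (by positivity)
          have : |y i| * |y j| ≤ ‖y‖ * ‖y‖ :=
            mul_le_mul (hyi i) (hyi j) (abs_nonneg _) (norm_nonneg _)
          nlinarith
      _ = _ := by simp; ring
  have e3 : |∑ i, mode2 g i i| ≤ N * P.A ^ 2 * m * (1 + ‖y‖ ^ 2) := by
    calc |∑ i, mode2 g i i| ≤ ∑ i : Fin N, |mode2 g i i| := Finset.abs_sum_le_sum_abs _ _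
      _ ≤ ∑ i : Fin N, P.A ^ 2 * m * (1 + ‖y‖ ^ 2) :=
          Finset.sum_le_sum fun i _ =>
            (hm2 i i).trans (le_mul_of_one_le_right (by positivity) h1y)
      _ = _ := by simp; ring
  set Y := 1 + ‖y‖ ^ 2
  set Z := (1 + ‖y‖ ^ 3) / Real.sqrt s
  have hY : 0 ≤ Y := by positivity
  have hZ : 0 ≤ Z := by positivity
  have htri : |g y| ≤ |modeNeg g y| + (|mode0 g| + |∑ i, mode1 g i * y i| +
      (|∑ i, ∑ j, mode2 g i j * y i * y j| + 2 * |∑ i, mode2 g i i|)) := by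
    rw [hdec]
    refine (abs_add_le _ _).trans (add_le_add le_rfl ((abs_add_le _ _).trans (add_le_add
      (abs_add_le _ _) ((abs_sub _ _).trans (le_of_eq ?_)))))
    rw [abs_mul, abs_two]
  refine htri.trans ?_
  have hq1 : 0 ≤ P.A ^ P.αlo * m * Y := by positivity
  have hq2 : 0 ≤ (P.A / Real.log s₀ + N * (P.A / Real.log s₀) +
    (N * N * P.A ^ 2 + 2 * (N * P.A ^ 2))) * m * Z := by positivity
  nlinarith

/-- Global and local sup bounds for an element of `V`. -/
lemma MemV.sup_bounds {χ₀ : ℝ → ℝ} (hχ₀ : IsCutoff χ₀) {P : Params} {s₀ : ℝ} (hs₀ : 1 < s₀) :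
    ∃ C, 0 ≤ C ∧ ∀ s, s₀ ≤ s → ∀ r : E N → ℝ, MemV χ₀ P s r →
      (∀ᵐ y : E N, |r y| ≤ C * (Real.log s / s)) ∧
      ∀ᵐ y : E N, ‖y‖ ≤ P.K₀ * Real.sqrt s → ‖y‖ ≤ 2 → |r y| ≤ C * (Real.log s / s ^ 2) := by
  obtain ⟨C, hC, hin⟩ := MemV.inner_bound (N := N) (χ₀ := χ₀) (P := P) hs₀
  have hK := P.K₀_pos
  have hAα : 0 < P.A ^ P.αhi := Real.rpow_pos_of_pos P.A_pos _
  refine ⟨C * (1 + 4 * P.K₀ ^ 2 + (1 + 8 * P.K₀ ^ 3)) + P.A ^ P.αhi + C * 14, by positivity,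
    fun s hs r hr => ?_⟩
  have hs1 : 1 < s := hs₀.trans_le hs
  have hls : 0 < Real.log s := Real.log_pos hs1
  set q := Real.sqrt s with hq
  have hq2 : q ^ 2 = s := Real.sq_sqrt (by linarith)
  have hqpos : 0 < q := Real.sqrt_pos.2 (by linarith)
  have hq1 : 1 ≤ q := by rw [hq]; exact Real.one_le_sqrt.2 hs1.le
  constructor
  · filter_upwards [hin s hs r hr, hr.boundOut] with y h1 h2
    have hsum : r y = innerPart χ₀ P.K₀ s r y + outerPart χ₀ P.K₀ s r y := by
      simp [innerPart, outerPart]; ring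
    have h3 : |innerPart χ₀ P.K₀ s r y| ≤
        C * (1 + 4 * P.K₀ ^ 2 + (1 + 8 * P.K₀ ^ 3)) * (Real.log s / s) := by
      by_cases hy : 2 ≤ ‖y‖ / (P.K₀ * q)
      · rw [innerPart, hχ₀.eq_zero _ hy]
        simp only [zero_mul, abs_zero]
        positivity
      -- On the support of the cut-off `|y| < 2K₀√s`, so `1 + |y|²` and `(1 + |y|³)/√s` are both
      -- `O(s)`: this loses one power of `s`.
      · rw [not_le, div_lt_iff₀ (by positivity)] at hy
        refine h1.trans ?_
        have h4 : ‖y‖ ^ 2 ≤ (2 * (P.K₀ * q)) ^ 2 := pow_le_pow_left₀ (norm_nonneg _) hy.le 2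
        have h5 : ‖y‖ ^ 3 ≤ (2 * (P.K₀ * q)) ^ 3 := pow_le_pow_left₀ (norm_nonneg _) hy.le 3
        have h6 : 1 + ‖y‖ ^ 2 ≤ (1 + 4 * P.K₀ ^ 2) * s := by
          have : (2 * (P.K₀ * q)) ^ 2 = 4 * P.K₀ ^ 2 * s := by rw [← hq2]; ring
          linarith
        have h7 : (1 + ‖y‖ ^ 3) / q ≤ (1 + 8 * P.K₀ ^ 3) * s := by
          rw [div_le_iff₀ hqpos]
          have e1 : (2 * (P.K₀ * q)) ^ 3 = 8 * P.K₀ ^ 3 * s * q := by rw [← hq2]; ring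
          nlinarith
        have h8 : (1 + ‖y‖ ^ 2) + (1 + ‖y‖ ^ 3) / q ≤
            (1 + 4 * P.K₀ ^ 2 + (1 + 8 * P.K₀ ^ 3)) * s := by linarith
        calc C * (Real.log s / s ^ 2) * ((1 + ‖y‖ ^ 2) + (1 + ‖y‖ ^ 3) / q) ≤
              C * (Real.log s / s ^ 2) * ((1 + 4 * P.K₀ ^ 2 + (1 + 8 * P.K₀ ^ 3)) * s) :=
              mul_le_mul_of_nonneg_left h8 (by positivity)
          _ = _ := by field_simp
    have h4 : |outerPart χ₀ P.K₀ s r y| ≤ P.A ^ P.αhi * (Real.log s / s) := by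
      rw [← mul_div_assoc]; exact h2
    have h5 : 0 ≤ C * 14 * (Real.log s / s) := by positivity
    rw [hsum]
    refine (abs_add_le _ _).trans ?_
    linarith
  · filter_upwards [hin s hs r hr] with y h1 hyK hy2
    have h2 : innerPart χ₀ P.K₀ s r y = r y := by
      rw [innerPart, hχ₀.eq_one _ (by positivity)
        (by rw [div_le_one (by positivity)]; exact hyK), one_mul]
    rw [h2] at h1
    refine h1.trans ?_
    have h3 : ‖y‖ ^ 2 ≤ 2 ^ 2 := pow_le_pow_left₀ (norm_nonneg _) hy2 2
    have h4 : ‖y‖ ^ 3 ≤ 2 ^ 3 := pow_le_pow_left₀ (norm_nonneg _) hy2 3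
    have h5 : (1 + ‖y‖ ^ 3) / q ≤ 9 := by
      rw [div_le_iff₀ hqpos]; nlinarith
    -- For `|y| ≤ 2` and `q = √s ≥ 1` the bracket is at most `(1 + 4) + (1 + 8) = 14`.
    have h6 : C * (Real.log s / s ^ 2) * ((1 + ‖y‖ ^ 2) + (1 + ‖y‖ ^ 3) / q) ≤
        C * (Real.log s / s ^ 2) * 14 := mul_le_mul_of_nonneg_left (by linarith) (by positivity)
    refine h6.trans ?_
    have h7 : 0 ≤ (C * (1 + 4 * P.K₀ ^ 2 + (1 + 8 * P.K₀ ^ 3)) + P.A ^ P.αhi) *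
      (Real.log s / s ^ 2) := by positivity
    linarith

/-! ### The standing assumptions -/

/-- The part of the hypotheses common to the two settings which the proof uses. -/
structure Setup (β : ℝ) (F : ℝ → ℝ) (χ₀ : ℝ → ℝ) (Ω : Set (E N)) (ψ Hs : E N → ℝ) (T t₀ : ℝ)
    (P : Params) (h : ℝ → E N → ℝ) : Prop where
  β_pos : 0 < β
  nonlin : IsNonlinearity β F
  cutoff : IsCutoff χ₀
  isOpen : IsOpen Ω
  zero_mem : (0 : E N) ∈ Ω
  ψ_smooth : ContDiff ℝ ∞ ψ
  Hs_near : ∃ c > 0, ∀ x : E N, 0 < ‖x‖ → ‖x‖ ≤ c → Hs x = finalExpr β x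
  T_lt : T < Real.exp (-1)
  t₀_nonneg : 0 ≤ t₀
  t₀_lt : t₀ < T
  ε₀_le : P.ε₀ ≤ P.K₀ / 4 * Real.sqrt (Real.exp (-1))
  sol : IsSolution F Ω t₀ T h
  trap : Trapped β Ω ψ χ₀ P t₀ T h
  δ₀_le : P.δ₀ ≤ 1 / 2 * kHat β P.K₀ 1
  η₀_le : ∀ x ∈ Ω, P.ε₀ / 4 ≤ ‖x‖ → P.η₀ ≤ 1 / 2 * h t₀ x

lemma one_lt_neg_log {l : ℝ} (h0 : 0 < l) (h1 : l < Real.exp (-1)) : 1 < -Real.log l := by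
  have := (Real.log_lt_iff_lt_exp h0).2 h1
  linarith

lemma abs_log_eq_neg_log {l : ℝ} (h0 : 0 < l) (h1 : l < Real.exp (-1)) :
    |Real.log l| = -Real.log l :=
  abs_of_neg (by linarith [one_lt_neg_log h0 h1])

lemma coeff_pos {β : ℝ} (hβ : 0 < β) : 0 < (β + 1) ^ 2 / (4 * β) := by positivity

lemma Phi_pos {β : ℝ} (hβ : 0 < β) (z : E N) : 0 < Phi β z :=
  Real.rpow_pos_of_pos (by have := coeff_pos hβ; positivity) _

lemma one_div_PhiHat {β : ℝ} (hβ : 0 < β) (z : E N) : 1 / PhiHat β z = Phi β z := by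
  rw [PhiHat, Phi, Real.rpow_neg (by have := coeff_pos hβ; positivity), one_div]

lemma kappa_pos {β : ℝ} (hβ : 0 < β) : 0 < kappa β := Real.rpow_pos_of_pos (by linarith) _

/-! ### The function `θ`, which matches a radius with its parabolic scale. -/

section theta

/-- `θ(r)` solves its defining equation. -/
lemma theta_spec {K₀ r : ℝ} (hK : 0 < K₀) (hr : 0 < r)
    (hr' : r ≤ K₀ / 4 * Real.sqrt (Real.exp (-1))) :
    0 < theta K₀ r ∧ theta K₀ r ≤ Real.exp (-1) ∧
      K₀ / 4 * Real.sqrt (theta K₀ r * |Real.log (theta K₀ r)|) = r := by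
  set S := {θ : ℝ | 0 < θ ∧ θ ≤ Real.exp (-1) ∧ K₀ / 4 * Real.sqrt (θ * |Real.log θ|) = r}
    with hS
  have habs : ∀ θ, 0 < θ → θ ≤ Real.exp (-1) → θ * |Real.log θ| = Real.negMulLog θ := by
    intro θ h0 h1
    have : Real.log θ ≤ -1 := (Real.log_le_iff_le_exp h0).2 h1
    rw [abs_of_neg (by linarith), Real.negMulLog]; ring
  have hex : S.Nonempty := by
    have hc : ContinuousOn (fun θ => K₀ / 4 * Real.sqrt (Real.negMulLog θ))
        (Icc 0 (Real.exp (-1))) :=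
      (continuous_const.mul (Real.continuous_sqrt.comp Real.continuous_negMulLog)).continuousOn
    have hmem : r ∈ Icc (K₀ / 4 * Real.sqrt (Real.negMulLog 0))
        (K₀ / 4 * Real.sqrt (Real.negMulLog (Real.exp (-1)))) := by
      refine ⟨by simpa using hr.le, ?_⟩
      simpa [Real.negMulLog] using hr'
    obtain ⟨θ, hθ, hθr⟩ := intermediate_value_Icc (Real.exp_pos _).le hc hmem
    have hθ0 : 0 < θ := by
      rcases hθ.1.eq_or_lt with h | h
      · rw [← h] at hθr; simp at hθr; linarith
      · exact h
    refine ⟨θ, hθ0, hθ.2, ?_⟩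
    rw [habs θ hθ0 hθ.2]; exact hθr
  have hinj : ∀ a ∈ S, ∀ b ∈ S, ¬ a < b := by
    rintro a ⟨ha0, ha1, ha⟩ b ⟨hb0, hb1, hb⟩ hab
    have h1 : Real.sqrt (a * |Real.log a|) = Real.sqrt (b * |Real.log b|) :=
      mul_left_cancel₀ (by positivity : K₀ / 4 ≠ 0) (ha.trans hb.symm)
    rw [Real.sqrt_inj (by positivity) (by positivity), habs a ha0 ha1, habs b hb0 hb1] at h1
    have hmono : StrictMonoOn Real.negMulLog (Icc 0 (Real.exp (-1))) := by
      refine strictMonoOn_of_deriv_pos (convex_Icc _ _) Real.continuous_negMulLog.continuousOn ?_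
      intro x hx
      rw [interior_Icc] at hx
      rw [Real.deriv_negMulLog hx.1.ne']
      have := (Real.log_lt_iff_lt_exp hx.1).2 hx.2
      linarith
    exact absurd h1 (hmono ⟨ha0.le, ha1⟩ ⟨hb0.le, hb1⟩ hab).ne
  obtain ⟨θ, hθ⟩ := hex
  -- Existence and uniqueness make the infimum in `theta` range over a singleton, so it returns the
  -- solution rather than a default value.
  have hSs : S = {θ} := by
    refine Subset.antisymm (fun b hb => ?_) (singleton_subset_iff.2 hθ)
    exact le_antisymm (not_lt.1 (hinj θ hθ b hb)) (not_lt.1 (hinj b hb θ hθ))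
  have : theta K₀ r = θ := by
    rw [theta, ← hS, hSs, csInf_singleton]
  rw [this]; exact hθ

lemma one_le_abs_log_theta {K₀ r : ℝ} (hK : 0 < K₀) (hr : 0 < r)
    (hr' : r ≤ K₀ / 4 * Real.sqrt (Real.exp (-1))) : 1 ≤ |Real.log (theta K₀ r)| := by
  obtain ⟨h0, h1, -⟩ := theta_spec hK hr hr'
  have : Real.log (theta K₀ r) ≤ -1 := (Real.log_le_iff_le_exp h0).2 h1
  rw [abs_of_neg (by linarith)]; linarith

lemma theta_mul_abs_log {K₀ r : ℝ} (hK : 0 < K₀) (hr : 0 < r)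
    (hr' : r ≤ K₀ / 4 * Real.sqrt (Real.exp (-1))) :
    theta K₀ r * |Real.log (theta K₀ r)| = (4 * r / K₀) ^ 2 := by
  obtain ⟨h0, h1, h2⟩ := theta_spec hK hr hr'
  have h3 : Real.sqrt (theta K₀ r * |Real.log (theta K₀ r)|) = 4 * r / K₀ := by
    rw [eq_div_iff hK.ne']; linarith
  rw [← h3, Real.sq_sqrt (by positivity)]

lemma theta_le {K₀ r : ℝ} (hK : 0 < K₀) (hr : 0 < r)
    (hr' : r ≤ K₀ / 4 * Real.sqrt (Real.exp (-1))) : theta K₀ r ≤ (4 * r / K₀) ^ 2 := by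
  rw [← theta_mul_abs_log hK hr hr']
  exact le_mul_of_one_le_right (theta_spec hK hr hr').1.le (one_le_abs_log_theta hK hr hr')

lemma tendsto_theta {K₀ : ℝ} (hK : 0 < K₀) :
    Tendsto (fun x : E N => theta K₀ ‖x‖) (𝓝[≠] 0) (𝓝[>] 0) := by
  have hpos : 0 < K₀ / 4 * Real.sqrt (Real.exp (-1)) := by positivity
  have hev : ∀ᶠ x : E N in 𝓝[≠] 0, 0 < ‖x‖ ∧ ‖x‖ ≤ K₀ / 4 * Real.sqrt (Real.exp (-1)) := by
    have h1 : ∀ᶠ x : E N in 𝓝[≠] 0, ‖x‖ < K₀ / 4 * Real.sqrt (Real.exp (-1)) := by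
      have := (continuous_norm (E := E N)).tendsto 0
      rw [norm_zero] at this
      exact (this.mono_left nhdsWithin_le_nhds).eventually (gt_mem_nhds hpos)
    filter_upwards [h1, self_mem_nhdsWithin] with x hx hx'
    exact ⟨norm_pos_iff.2 hx', hx.le⟩
  rw [tendsto_nhdsWithin_iff]
  refine ⟨?_, hev.mono fun x hx => (theta_spec hK hx.1 hx.2).1⟩
  refine tendsto_of_tendsto_of_tendsto_of_le_of_le' tendsto_const_nhds
    (h := fun x : E N => (4 * ‖x‖ / K₀) ^ 2) ?_
    (hev.mono fun x hx => (theta_spec hK hx.1 hx.2).1.le)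
    (hev.mono fun x hx => theta_le hK hx.1 hx.2)
  have : Continuous fun x : E N => (4 * ‖x‖ / K₀) ^ 2 := by fun_prop
  have h2 := this.tendsto 0
  simp only [norm_zero, mul_zero, zero_div, ne_eq, OfNat.ofNat_ne_zero, not_false_eq_true,
    zero_pow] at h2
  exact h2.mono_left nhdsWithin_le_nhds

end theta

/-! ### Pointwise bounds on `q` and the intermediate profile. -/

namespace Setup

variable {β : ℝ} {F χ₀ : ℝ → ℝ} {Ω : Set (E N)} {ψ Hs : E N → ℝ} {T t₀ : ℝ} {P : Params}
  {h : ℝ → E N → ℝ}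

lemma sub_pos (S : Setup β F χ₀ Ω ψ Hs T t₀ P h) {t : ℝ} (ht : t ∈ Ico t₀ T) : 0 < T - t := by
  have := S.t₀_lt; linarith [ht.2]

lemma sub_lt (S : Setup β F χ₀ Ω ψ Hs T t₀ P h) {t : ℝ} (ht : t ∈ Ico t₀ T) :
    T - t < Real.exp (-1) := by
  have := S.T_lt; linarith [ht.1, S.t₀_nonneg]

lemma one_lt_s (S : Setup β F χ₀ Ω ψ Hs T t₀ P h) {t : ℝ} (ht : t ∈ Ico t₀ T) :
    1 < -Real.log (T - t) := one_lt_neg_log (S.sub_pos ht) (S.sub_lt ht)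

lemma s_mono (S : Setup β F χ₀ Ω ψ Hs T t₀ P h) {t : ℝ} (ht : t ∈ Ico t₀ T) :
    -Real.log (T - t₀) ≤ -Real.log (T - t) :=
  neg_le_neg (Real.log_le_log (S.sub_pos ht) (by linarith [ht.1]))

lemma t₀_mem (S : Setup β F χ₀ Ω ψ Hs T t₀ P h) : t₀ ∈ Ico t₀ T := ⟨le_rfl, S.t₀_lt⟩

lemma isHeat (S : Setup β F χ₀ Ω ψ Hs T t₀ P h) :
    IsHeat (Ioo t₀ T) Ω h (fun t x => -F (h t x)) :=
  ⟨S.sol.cont.mono (prod_mono Ioo_subset_Ico_self le_rfl),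
    fun t ht x hx => (S.sol.c2 t ht).contDiffAt (S.isOpen.mem_nhds hx),
    fun t ht x hx => by simpa [sub_eq_add_neg] using S.sol.eqn t ht x hx⟩

lemma zvar_eq (S : Setup β F χ₀ Ω ψ Hs T t₀ P h) {t : ℝ} (ht : t ∈ Ico t₀ T) (y : E N) :
    zvar T t (Real.sqrt (T - t) • y) = (Real.sqrt (-Real.log (T - t)))⁻¹ • y := by
  have h1 := S.sub_pos ht
  rw [zvar, scale, abs_log_eq_neg_log h1 (S.sub_lt ht), Real.sqrt_mul h1.le, smul_smul]
  congr 1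
  have : Real.sqrt (T - t) ≠ 0 := (Real.sqrt_pos.2 h1).ne'
  field_simp

lemma continuousOn_slice (S : Setup β F χ₀ Ω ψ Hs T t₀ P h) {t : ℝ} (ht : t ∈ Ico t₀ T) :
    ContinuousOn (h t) Ω :=
  S.sol.cont.comp (f := fun x => (t, x)) (by fun_prop) fun x hx => ⟨ht, hx⟩

lemma continuous_Phi (hβ : 0 < β) : Continuous (Phi β : E N → ℝ) := by
  unfold Phi
  refine Continuous.rpow_const (by fun_prop) fun z => Or.inl ?_
  have := coeff_pos hβ
  positivity

lemma continuousOn_q (S : Setup β F χ₀ Ω ψ Hs T t₀ P h) {t : ℝ} (ht : t ∈ Ico t₀ T) :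
    IsOpen {y : E N | Real.sqrt (T - t) • y ∈ Ω} ∧
    ContinuousOn (fun y : E N => (T - t) ^ (1 / (β + 1)) * (1 / h t (Real.sqrt (T - t) • y)) -
      varphi β y (-Real.log (T - t))) {y | Real.sqrt (T - t) • y ∈ Ω} := by
  refine ⟨S.isOpen.preimage (continuous_const_smul _), ?_⟩
  refine ContinuousOn.sub (continuousOn_const.mul ?_) ?_
  · refine ContinuousOn.div continuousOn_const ?_ fun y hy => (S.sol.pos t ht _ hy).ne'
    exact (S.continuousOn_slice ht).comp (continuous_const_smul _).continuousOn fun y hy => hy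
  · unfold varphi
    exact (((continuous_Phi S.β_pos).comp (continuous_const_smul _)).add
      continuous_const).continuousOn

/-- Pointwise form of the bounds on `q`. -/
lemma exists_q_bounds (S : Setup β F χ₀ Ω ψ Hs T t₀ P h) :
    ∃ C, 0 ≤ C ∧ ∀ t ∈ Ico t₀ T, ∀ y : E N, Real.sqrt (T - t) • y ∈ Ω →
      |(T - t) ^ (1 / (β + 1)) / h t (Real.sqrt (T - t) • y) - varphi β y (-Real.log (T - t))| ≤
        C * (Real.log (-Real.log (T - t)) / -Real.log (T - t)) ∧
      (2 ≤ P.K₀ * Real.sqrt (-Real.log (T - t)) → ‖y‖ < 2 →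
        |(T - t) ^ (1 / (β + 1)) / h t (Real.sqrt (T - t) • y) - varphi β y (-Real.log (T - t))| ≤
        C * (Real.log (-Real.log (T - t)) / (-Real.log (T - t)) ^ 2)) := by
  obtain ⟨C, hC, hb⟩ := MemV.sup_bounds (N := N) S.cutoff (P := P) (S.one_lt_s S.t₀_mem)
  refine ⟨C, hC, fun t ht => ?_⟩
  obtain ⟨h1, h2⟩ := hb _ (S.s_mono ht) _ (S.trap.2 t ht).region1
  obtain ⟨hU, hc⟩ := S.continuousOn_q ht
  simp only [mul_one_div] at hc
  have hq : ∀ y ∈ {y : E N | Real.sqrt (T - t) • y ∈ Ω}, qOf β Ω T t (h t) y =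
      (T - t) ^ (1 / (β + 1)) / h t (Real.sqrt (T - t) • y) -
        varphi β y (-Real.log (T - t)) := by
    intro y hy
    rw [qOf, indicator_of_mem hy, mul_one_div]
  intro y hy
  -- The shrinking set only gives bounds almost everywhere; inside the dilated domain `q` is
  -- continuous, so they hold at every point.
  refine ⟨forall_le_of_ae_le hU hc (h1.mono fun y hy hyU => by rw [← hq y hyU]; exact hy) y hy,
    fun hK hy2 => ?_⟩
  refine forall_le_of_ae_le (hU.inter Metric.isOpen_ball) (hc.mono inter_subset_left)
    (U := _ ∩ Metric.ball (0 : E N) 2)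
    (h2.mono fun y hy hyU => ?_) y ⟨hy, by simpa using hy2⟩
  have h3 : ‖y‖ < 2 := by simpa using hyU.2
  rw [← hq y hyU.1]
  exact hy (by linarith) h3.le

/-- The intermediate profile. -/
theorem exists_profile_bound (S : Setup β F χ₀ Ω ψ Hs T t₀ P h) :
    ∃ C, 0 ≤ C ∧ ∀ t ∈ Ico t₀ T, ∀ x ∈ Ω,
      |(T - t) ^ (1 / (β + 1)) / h t x - Phi β (zvar T t x)| ≤
        C * (Real.log (-Real.log (T - t)) / -Real.log (T - t)) := by
  obtain ⟨C, hC, hb⟩ := S.exists_q_bounds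
  have hs₀ := S.one_lt_s S.t₀_mem
  have hl₀ := Real.log_pos hs₀
  have hβ := S.β_pos
  have hκ := kappa_pos hβ
  refine ⟨C + N * kappa β / (2 * β * Real.log (-Real.log (T - t₀))), by positivity,
    fun t ht x hx => ?_⟩
  have h0 := S.sub_pos ht
  have hq : Real.sqrt (T - t) ≠ 0 := (Real.sqrt_pos.2 h0).ne'
  set y := (Real.sqrt (T - t))⁻¹ • x with hy
  have hxy : Real.sqrt (T - t) • y = x := smul_inv_smul₀ hq x
  have h1 := (hb t ht y (by rw [hxy]; exact hx)).1
  rw [hxy, varphi, ← S.zvar_eq ht y, hxy] at h1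
  set s := -Real.log (T - t)
  have hs : 1 < s := S.one_lt_s ht
  have hl : Real.log (-Real.log (T - t₀)) ≤ Real.log s :=
    Real.log_le_log (by linarith) (S.s_mono ht)
  -- The correction is of order `1/s`, absorbed into `log s / s` because `log s` stays above its
  -- positive value at `t₀`.
  have h2 : |(N : ℝ) * kappa β / (2 * β * s)| ≤
      N * kappa β / (2 * β * Real.log (-Real.log (T - t₀))) * (Real.log s / s) := by
    rw [abs_of_nonneg (by positivity), div_mul_div_comm, div_le_div_iff₀ (by positivity)
      (by positivity)]
    have : 0 ≤ (N : ℝ) * kappa β * (2 * β * s) := by positivity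
    nlinarith
  have h3 := abs_le.1 h1
  have h4 := abs_le.1 h2
  rw [abs_le]
  constructor <;> nlinarith [h3.1, h3.2, h4.1, h4.2]

end Setup

/-! ### Convergence of a bounded solution and of its gradient at the final time -/

/-- Completeness: being uniformly close to convergent functions makes `φ` Cauchy along `l`. It is
used to pass from convergent difference quotients to the gradient. -/
lemma exists_tendsto_of_approx {l : Filter ℝ} [l.NeBot] {φ : ℝ → ℝ}
    (h : ∀ ε > 0, ∃ φ' : ℝ → ℝ, (∃ L, Tendsto φ' l (𝓝 L)) ∧ ∀ᶠ t in l, |φ t - φ' t| ≤ ε) :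
    ∃ L, Tendsto φ l (𝓝 L) := by
  refine CompleteSpace.complete (f := map φ l) (Metric.cauchy_iff.2 ⟨inferInstance, ?_⟩)
  intro ε hε
  obtain ⟨φ', ⟨L, hL⟩, hφ⟩ := h (ε / 8) (by positivity)
  have h1 : ∀ᶠ t in l, |φ' t - L| < ε / 8 := by
    simpa [Real.dist_eq] using Metric.tendsto_nhds.1 hL (ε / 8) (by positivity)
  refine ⟨Metric.ball L (ε / 2), ?_, fun x hx y hy => ?_⟩
  · rw [mem_map]
    filter_upwards [h1, hφ] with t h2 h3
    rw [mem_preimage, Metric.mem_ball, Real.dist_eq]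
    rw [abs_lt] at *
    rw [abs_le] at h3
    constructor <;> linarith [h2.1, h2.2, h3.1, h3.2]
  · have := dist_triangle_right x y L
    rw [Metric.mem_ball] at hx hy
    linarith

lemma exists_tendsto_of_lipschitz {a T K : ℝ} (ha : a < T) {φ : ℝ → ℝ}
    (h : ∀ t ∈ Ico a T, ∀ t' ∈ Ico a T, |φ t - φ t'| ≤ K * |t - t'|) :
    ∃ L, Tendsto φ (𝓝[<] T) (𝓝 L) := by
  refine exists_tendsto_of_approx fun ε hε => ?_
  have hK : 0 ≤ K := by
    by_contra! hneg
    have h1 := h a ⟨le_rfl, ha⟩ ((a + T) / 2) ⟨by linarith, by linarith⟩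
    have h2 : 0 < |a - (a + T) / 2| := abs_pos.2 (by linarith)
    nlinarith [abs_nonneg (φ a - φ ((a + T) / 2))]
  set b := max a (T - ε / (K + 1)) with hb
  have hbT : b < T := max_lt ha (by have : 0 < ε / (K + 1) := by positivity
                                    linarith)
  have hba : b ∈ Ico a T := ⟨le_max_left _ _, hbT⟩
  refine ⟨fun _ => φ b, ⟨φ b, tendsto_const_nhds⟩, ?_⟩
  filter_upwards [Ioo_mem_nhdsLT hbT] with t ht
  refine (h t ⟨hba.1.trans ht.1.le, ht.2⟩ b hba).trans ?_
  rw [abs_of_pos (by linarith [ht.1])]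
  have h3 : t - b ≤ ε / (K + 1) := by
    have := le_max_right a (T - ε / (K + 1)); linarith [ht.2]
  calc K * (t - b) ≤ (K + 1) * (ε / (K + 1)) :=
        mul_le_mul (by linarith) h3 (by linarith [ht.1]) (by positivity)
    _ = ε := mul_div_cancel₀ _ (by positivity)

lemma gradient_sub_apply {f g : E N → ℝ} {x : E N} (hf : DifferentiableAt ℝ f x)
    (hg : DifferentiableAt ℝ g x) :
    gradient (fun y => f y - g y) x = gradient f x - gradient g x := by
  simp [gradient, fderiv_fun_sub hf hg]

lemma gradient_comp_add_right (f : E N → ℝ) (x v : E N) :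
    gradient (fun y => f (y + v)) x = gradient f (x + v) := by
  simp [gradient, fderiv_comp_add_right]

lemma exists_bound_lipschitz_of_smooth {F : ℝ → ℝ} (hF : ContDiffOn ℝ ∞ F (Ioi 0)) {c C : ℝ}
    (hc : 0 < c) : ∃ B L, 0 ≤ B ∧ 0 ≤ L ∧ (∀ v ∈ Icc c C, |F v| ≤ B) ∧
      ∀ v ∈ Icc c C, ∀ w ∈ Icc c C, |F v - F w| ≤ L * |v - w| := by
  have hsub : Icc c C ⊆ Ioi 0 := fun v hv => hc.trans_le hv.1
  obtain ⟨B, hB⟩ := isCompact_Icc.exists_bound_of_continuousOn (hF.continuousOn.mono hsub)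
  have hd : ContinuousOn (deriv F) (Ioi 0) := hF.continuousOn_deriv_of_isOpen isOpen_Ioi (by simp)
  obtain ⟨L, hL⟩ := isCompact_Icc.exists_bound_of_continuousOn (hd.mono hsub)
  refine ⟨max B 0, max L 0, le_max_right _ _, le_max_right _ _,
    fun v hv => (hB v hv).trans (le_max_left _ _), fun v hv w hw => ?_⟩
  exact (convex_Icc c C).norm_image_sub_le_of_norm_deriv_le (f := F)
    (fun x hx => (hF.contDiffAt (isOpen_Ioi.mem_nhds (hsub hx))).differentiableAt (by simp))
    (fun x hx => (hL x hx).trans (le_max_left _ _)) hw hv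

/-- A solution of `∂ₜD = ΔD - F(D)` bounded away from `0` and `∞` near `(T, x)` is of class
`C^{1,1}` in space and Lipschitz in time near `(T, x)`. -/
theorem IsHeat.exists_regularity {D : ℝ → E N → ℝ} {F : ℝ → ℝ} (hF : ContDiffOn ℝ ∞ F (Ioi 0))
    {x : E N} {r c C t₂ T : ℝ} (hr : 0 < r) (hc : 0 < c) (ht₂ : t₂ < T)
    (h : IsHeat (Ico t₂ T) (Metric.closedBall x r) D (fun t y => -F (D t y)))
    (hb : ∀ t ∈ Ico t₂ T, ∀ y ∈ Metric.closedBall x r, D t y ∈ Icc c C) :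
    ∃ d > 0, ∃ a ∈ Ico t₂ T, ∃ K, 0 ≤ K ∧ d ≤ r ∧
      (∀ t ∈ Ico a T, ∀ y ∈ Metric.closedBall x d, ∀ v : E N, ‖v‖ ≤ d →
        ‖gradient (D t) (y + v) - gradient (D t) y‖ ≤ K * ‖v‖) ∧
      ∀ y ∈ Metric.closedBall x d, ∀ t ∈ Ico a T, ∀ t' ∈ Ico a T,
        |D t y - D t' y| ≤ K * |t - t'| := by
  obtain ⟨B, L, hB0, hL0, hB, hL⟩ := exists_bound_lipschitz_of_smooth hF (C := C) hc
  -- Room is needed for three spatial shrinkings by `d` with a ball of radius `d` left over, and for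
  -- two waiting times `d²` ending before `T`.
  set d := min (r / 4) (Real.sqrt ((T - t₂) / 3)) with hd
  have hTt : 0 < T - t₂ := by linarith
  have hdpos : 0 < d := lt_min (by positivity) (Real.sqrt_pos.2 (by positivity))
  have hdr : d ≤ r / 4 := min_le_left _ _
  have hd2 : d ^ 2 ≤ (T - t₂) / 3 := by
    have h1 : d ≤ Real.sqrt ((T - t₂) / 3) := min_le_right _ _
    have h2 := pow_le_pow_left₀ hdpos.le h1 2
    rwa [Real.sq_sqrt (by positivity)] at h2
  have hC0 : 0 ≤ C := by
    have h1 := hb t₂ ⟨le_rfl, ht₂⟩ x (Metric.mem_closedBall_self hr.le)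
    linarith [h1.1, h1.2]
  have hsubI : ∀ {a b : ℝ}, a ∈ Ico t₂ T → b ∈ Ico t₂ T → Icc a b ⊆ Ico t₂ T :=
    fun ha hb t ht => ⟨ha.1.trans ht.1, ht.2.trans_lt hb.2⟩
  have hball : ∀ {y : E N} {ρ ρ' : ℝ}, y ∈ Metric.closedBall x ρ → ρ + d ≤ ρ' →
      Metric.closedBall y d ⊆ Metric.closedBall x ρ' := by
    intro y ρ ρ' hy hρ
    refine Metric.closedBall_subset_closedBall' ?_
    rw [Metric.mem_closedBall] at hy; linarith
  have hadd : ∀ {y v : E N} {ρ ρ' : ℝ}, y ∈ Metric.closedBall x ρ → ‖v‖ ≤ d → ρ + d ≤ ρ' →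
      y + v ∈ Metric.closedBall x ρ' := by
    intro y v ρ ρ' hy hv hρ
    exact hball hy hρ (by simpa using hv)
  set K₁ := (N + 1) * C / d + B * d / 2 with hK₁
  have hK₁0 : 0 ≤ K₁ := by positivity
  have hdiff : ∀ t ∈ Ico t₂ T, ∀ y ∈ Metric.closedBall x r, DifferentiableAt ℝ (D t) y :=
    fun t ht y hy => (h.c2 t ht y hy).differentiableAt (by simp)
  have hgrad : ∀ t ∈ Ico (t₂ + d ^ 2) T, ∀ y ∈ Metric.closedBall x (r - d),
      ‖gradient (D t) y‖ ≤ K₁ := by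
    intro t ht y hy
    have hI : Icc (t - d ^ 2) t ⊆ Ico t₂ T :=
      hsubI ⟨by linarith [ht.1], by nlinarith [ht.2]⟩ ⟨by nlinarith [ht.1], ht.2⟩
    have hO : Metric.closedBall y d ⊆ Metric.closedBall x r := hball hy (by linarith)
    refine (h.mono hI hO).norm_gradient_le hdpos hC0 hB0 (fun t' ht' z hz => ?_)
      fun t' ht' z hz => ?_
    · rw [abs_neg]; exact hB _ (hb t' (hI ht') z (hO hz))
    · have := hb t' (hI ht') z (hO hz)
      rw [abs_of_nonneg (hc.le.trans this.1)]; exact this.2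
  have hlip : ∀ t ∈ Ico (t₂ + d ^ 2) T, ∀ y ∈ Metric.closedBall x (r - 2 * d), ∀ v : E N, ‖v‖ ≤ d →
      |D t (y + v) - D t y| ≤ K₁ * ‖v‖ := by
    intro t ht y hy v hv
    have hO : Metric.closedBall y d ⊆ Metric.closedBall x (r - d) := hball hy (by linarith)
    have ht' : t ∈ Ico t₂ T := ⟨by nlinarith [ht.1], ht.2⟩
    have := (convex_closedBall y d).norm_image_sub_le_of_norm_fderiv_le (𝕜 := ℝ) (f := D t)
      (C := K₁) (fun z hz => hdiff t ht' z
        (Metric.closedBall_subset_closedBall (by linarith) (hO hz)))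
      (fun z hz => by rw [← norm_gradient_eq]; exact hgrad t ht z (hO hz))
      (Metric.mem_closedBall_self hdpos.le) (y := y + v) (by simpa using hv)
    simpa using this
  -- The gradient estimate is applied a second time, to the increment `D(· + v) - D`, which is
  -- bounded by `K₁|v|` and whose source is bounded by `L K₁|v|`.
  set K₂ := (N + 1) * K₁ / d + L * K₁ * d / 2 with hK₂
  have hK₂0 : 0 ≤ K₂ := by positivity
  have hgl : ∀ t ∈ Ico (t₂ + 2 * d ^ 2) T, ∀ y ∈ Metric.closedBall x (r - 3 * d), ∀ v : E N,
      ‖v‖ ≤ d → ‖gradient (D t) (y + v) - gradient (D t) y‖ ≤ K₂ * ‖v‖ := by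
    intro t ht y hy v hv
    have hI : Icc (t - d ^ 2) t ⊆ Ico (t₂ + d ^ 2) T := fun t' ht' =>
      ⟨by linarith [ht.1, ht'.1], by linarith [ht.2, ht'.2]⟩
    have hI' : Icc (t - d ^ 2) t ⊆ Ico t₂ T := fun t' ht' =>
      ⟨by nlinarith [(hI ht').1], (hI ht').2⟩
    have hO : Metric.closedBall y d ⊆ Metric.closedBall x (r - 2 * d) := hball hy (by linarith)
    have hO' : Metric.closedBall y d ⊆ Metric.closedBall x r :=
      hO.trans (Metric.closedBall_subset_closedBall (by linarith))
    have hOv : ∀ z ∈ Metric.closedBall y d, z + v ∈ Metric.closedBall x r := fun z hz =>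
      hadd (hO hz) hv (by linarith)
    have h1 := ((h.mono hI' le_rfl).translate (O' := Metric.closedBall y d) v hOv).sub
      (h.mono hI' hO')
    have h2 := h1.norm_gradient_le hdpos (M := K₁ * ‖v‖) (F₀ := L * (K₁ * ‖v‖)) (by positivity)
      (by positivity) (fun t' ht' z hz => ?_)
      (fun t' ht' z hz => hlip t' (hI ht') z (hO hz) v hv)
    · have ht' := hI' (right_mem_Icc.2 (by nlinarith) : t ∈ Icc (t - d ^ 2) t)
      have hyy : y ∈ Metric.closedBall y d := Metric.mem_closedBall_self hdpos.le
      rw [gradient_sub_apply (f := fun z => D t (z + v)), gradient_comp_add_right] at h2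
      · refine h2.trans (le_of_eq ?_)
        rw [hK₂]; field_simp
      · exact (hdiff t ht' _ (hOv y hyy)).comp (f := fun z => z + v) y (by fun_prop)
      · exact hdiff t ht' y (hO' hyy)
    · have e1 := hL _ (hb t' (hI' ht') (z + v) (hOv z hz)) _ (hb t' (hI' ht') z (hO' hz))
      have e2 := hlip t' (hI ht') z (hO hz) v hv
      rw [← abs_neg]
      have e3 : -(-F (D t' (z + v)) - -F (D t' z)) = F (D t' (z + v)) - F (D t' z) := by ring
      rw [e3]
      exact e1.trans (mul_le_mul_of_nonneg_left e2 hL0)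
  -- A Lipschitz gradient bounds every second derivative; the equation then turns the bound on the
  -- Laplacian into a Lipschitz bound in time.
  have hlap : ∀ t ∈ Ico (t₂ + 2 * d ^ 2) T, ∀ y ∈ Metric.closedBall x d,
      |Laplacian.laplacian (D t) y| ≤ N * K₂ := by
    intro t ht y hy
    have hy' : y ∈ Metric.closedBall x (r - 3 * d) :=
      Metric.closedBall_subset_closedBall (by linarith) hy
    have hy'' : y ∈ Metric.closedBall x r := Metric.closedBall_subset_closedBall (by linarith) hy
    have ht' : t ∈ Ico t₂ T := ⟨by nlinarith [ht.1], ht.2⟩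
    have hdd : HasFDerivAt (fderiv ℝ (D t)) (fderiv ℝ (fderiv ℝ (D t)) y) y :=
      (((h.c2 t ht' y hy'').fderiv_right (m := 1) (by norm_num)).differentiableAt
        (by simp)).hasFDerivAt
    have hn : ‖fderiv ℝ (fderiv ℝ (D t)) y‖ ≤ K₂ := by
      refine hdd.le_of_lip' hK₂0 ?_
      filter_upwards [Metric.closedBall_mem_nhds y hdpos] with z hz
      have e1 := hgl t ht y hy' (z - y) (by rw [← dist_eq_norm]; exact hz)
      rw [add_sub_cancel, gradient, gradient, ← map_sub, LinearIsometryEquiv.norm_map] at e1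
      exact e1
    rw [laplacian_eq_sum_fderiv (EuclideanSpace.basisFun (Fin N) ℝ)]
    refine (Finset.abs_sum_le_sum_abs _ _).trans ?_
    have : ∀ i ∈ Finset.univ, |fderiv ℝ (fderiv ℝ (D t)) y (EuclideanSpace.basisFun (Fin N) ℝ i)
        (EuclideanSpace.basisFun (Fin N) ℝ i)| ≤ K₂ := by
      intro i _
      have h1 : ‖EuclideanSpace.basisFun (Fin N) ℝ i‖ = 1 :=
        (EuclideanSpace.basisFun (Fin N) ℝ).norm_eq_one i
      have e1 := (fderiv ℝ (fderiv ℝ (D t)) y).le_opNorm₂ (EuclideanSpace.basisFun (Fin N) ℝ i)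
        (EuclideanSpace.basisFun (Fin N) ℝ i)
      rw [h1, mul_one, mul_one] at e1
      exact e1.trans hn
    simpa using Finset.sum_le_sum this
  refine ⟨d, hdpos, t₂ + 2 * d ^ 2, ⟨by nlinarith, by nlinarith⟩, N * K₂ + B + K₂, by positivity,
    by linarith, fun t ht y hy v hv => ?_, fun y hy t ht t' ht' => ?_⟩
  · refine (hgl t ht y (Metric.closedBall_subset_closedBall (by linarith) hy) v hv).trans ?_
    refine mul_le_mul_of_nonneg_right ?_ (norm_nonneg _)
    have : 0 ≤ N * K₂ + B := by positivity
    linarith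
  · have hy'' : y ∈ Metric.closedBall x r := Metric.closedBall_subset_closedBall (by linarith) hy
    have := (convex_Ico (t₂ + 2 * d ^ 2) T).norm_image_sub_le_of_norm_hasDerivWithin_le
      (f := fun t => D t y) (C := N * K₂ + B + K₂)
      (fun t ht => (h.eqn t ⟨by nlinarith [ht.1], ht.2⟩ y hy'').hasDerivWithinAt)
      (fun t ht => ?_) ht' ht
    · simpa using this
    · have e1 := hlap t ht y hy
      have e2 := hB _ (hb t ⟨by nlinarith [ht.1], ht.2⟩ y hy'')
      refine (norm_add_le _ _).trans ?_
      rw [norm_neg, Real.norm_eq_abs, Real.norm_eq_abs]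
      linarith

/-- A solution bounded away from `0` and `∞` near `(T, x)` converges at `x` together with its
gradient as `t → T`. -/
theorem IsHeat.exists_limits {D : ℝ → E N → ℝ} {F : ℝ → ℝ} (hF : ContDiffOn ℝ ∞ F (Ioi 0))
    {x : E N} {r c C t₂ T : ℝ} (hr : 0 < r) (hc : 0 < c) (ht₂ : t₂ < T)
    (h : IsHeat (Ico t₂ T) (Metric.closedBall x r) D (fun t y => -F (D t y)))
    (hb : ∀ t ∈ Ico t₂ T, ∀ y ∈ Metric.closedBall x r, D t y ∈ Icc c C) :
    (∃ l, Tendsto (fun t => D t x) (𝓝[<] T) (𝓝 l)) ∧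
      ∃ g, Tendsto (fun t => gradient (D t) x) (𝓝[<] T) (𝓝 g) := by
  obtain ⟨d, hd, a, ha, K, hK, hdr, hgl, htl⟩ := h.exists_regularity hF hr hc ht₂ hb
  have hlim : ∀ y ∈ Metric.closedBall x d, ∃ l, Tendsto (fun t => D t y) (𝓝[<] T) (𝓝 l) :=
    fun y hy => exists_tendsto_of_lipschitz ha.2 (htl y hy)
  have hxx : x ∈ Metric.closedBall x d := Metric.mem_closedBall_self hd.le
  refine ⟨hlim x hxx, ?_⟩
  have hdir : ∀ e : E N, ‖e‖ = 1 →
      ∃ l, Tendsto (fun t => inner ℝ (gradient (D t) x) e) (𝓝[<] T) (𝓝 l) := by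
    intro e he
    refine exists_tendsto_of_approx fun ε hε => ?_
    -- Uniformly in `t`, the directional derivative is within `Kδ ≤ ε` of the difference quotient
    -- with step `δ`, and that quotient converges as `t → T`.
    set δ := min d (ε / (K + 1)) with hδ
    have hδpos : 0 < δ := lt_min hd (by positivity)
    have hδd : δ ≤ d := min_le_left _ _
    have hnδ : ‖δ • e‖ = δ := by rw [norm_smul, he, mul_one, Real.norm_of_nonneg hδpos.le]
    obtain ⟨l, hl⟩ := hlim x hxx
    obtain ⟨l', hl'⟩ := hlim (x + δ • e) (by simpa [hnδ] using hδd)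
    refine ⟨fun t => δ⁻¹ * (D t (x + δ • e) - D t x), ⟨_, (hl'.sub hl).const_mul δ⁻¹⟩, ?_⟩
    filter_upwards [Ioo_mem_nhdsLT ha.2] with t ht
    have hta : t ∈ Ico a T := ⟨ht.1.le, ht.2⟩
    have hdiff : ∀ z ∈ Metric.closedBall x δ, DifferentiableAt ℝ (D t) z := fun z hz =>
      (h.c2 t ⟨ha.1.trans ht.1.le, ht.2⟩ z (Metric.closedBall_subset_closedBall
        (hδd.trans hdr) hz)).differentiableAt (by simp)
    have hmv := (convex_closedBall x δ).norm_image_sub_le_of_norm_fderiv_le' (𝕜 := ℝ)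
      (f := D t) (φ := fderiv ℝ (D t) x) (C := K * δ) hdiff (fun z hz => ?_)
      (Metric.mem_closedBall_self hδpos.le) (y := x + δ • e) (by simp [hnδ])
    · rw [add_sub_cancel_left, hnδ, map_smul, smul_eq_mul, Real.norm_eq_abs] at hmv
      rw [inner_gradient]
      have e1 : fderiv ℝ (D t) x e - δ⁻¹ * (D t (x + δ • e) - D t x) =
          -(δ⁻¹ * (D t (x + δ • e) - D t x - δ * fderiv ℝ (D t) x e)) := by
        field_simp; ring
      rw [e1, abs_neg, abs_mul, abs_of_pos (inv_pos.2 hδpos), inv_mul_le_iff₀ hδpos]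
      refine hmv.trans ?_
      rw [mul_comm δ ε]
      refine mul_le_mul_of_nonneg_right ?_ hδpos.le
      have e2 : δ ≤ ε / (K + 1) := min_le_right _ _
      calc K * δ ≤ (K + 1) * (ε / (K + 1)) :=
            mul_le_mul (by linarith) e2 hδpos.le (by positivity)
        _ = ε := mul_div_cancel₀ _ (by positivity)
    · have hz' : ‖z - x‖ ≤ δ := by rw [← dist_eq_norm]; exact hz
      have e1 := hgl t hta x hxx (z - x) (hz'.trans hδd)
      rw [add_sub_cancel, gradient, gradient, ← map_sub, LinearIsometryEquiv.norm_map] at e1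
      exact e1.trans (mul_le_mul_of_nonneg_left hz' hK)
  set b := EuclideanSpace.basisFun (Fin N) ℝ with hbb
  choose l hl using fun i => hdir (b i) (b.norm_eq_one i)
  refine ⟨∑ i, l i • b i, ?_⟩
  have h1 : ∀ t, gradient (D t) x = ∑ i, inner ℝ (gradient (D t) x) (b i) • b i := by
    intro t
    conv_lhs => rw [← b.sum_repr' (gradient (D t) x)]
    simp only [real_inner_comm]
  refine Tendsto.congr (fun t => (h1 t).symm) ?_
  exact tendsto_finsetSum _ fun i _ => (hl i).smul_const (b i)

/-! ### Behaviour near the extinction time -/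

lemma tendsto_sub_nhdsLT (T : ℝ) : Tendsto (fun t => T - t) (𝓝[<] T) (𝓝[>] 0) := by
  rw [tendsto_nhdsWithin_iff]
  constructor
  · have : Tendsto (fun t => T - t) (𝓝 T) (𝓝 (T - T)) := (continuous_const.sub continuous_id).tendsto T
    rw [sub_self] at this
    exact this.mono_left nhdsWithin_le_nhds
  · filter_upwards [self_mem_nhdsWithin] with t ht
    have : t < T := ht
    exact _root_.sub_pos.2 this

lemma tendsto_neg_log_zero : Tendsto (fun l : ℝ => -Real.log l) (𝓝[>] 0) atTop :=
  tendsto_neg_atBot_atTop.comp Real.tendsto_log_nhdsGT_zero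

lemma tendsto_log_div_self : Tendsto (fun s : ℝ => Real.log s / s) atTop (𝓝 0) :=
  Real.isLittleO_log_id_atTop.tendsto_div_nhds_zero

lemma tendsto_scale (T : ℝ) : Tendsto (scale T) (𝓝[<] T) (𝓝 0) := by
  have h1 : Tendsto (fun l : ℝ => Real.sqrt (l * |Real.log l|)) (𝓝[>] 0) (𝓝 0) := by
    have h2 : Continuous fun l : ℝ => Real.sqrt |l * Real.log l| :=
      Real.continuous_sqrt.comp Real.continuous_mul_log.abs
    have h3 := h2.tendsto 0
    simp only [zero_mul, abs_zero, Real.sqrt_zero] at h3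
    refine (h3.mono_left nhdsWithin_le_nhds).congr' ?_
    filter_upwards [self_mem_nhdsWithin] with l hl
    have : 0 < l := hl
    rw [abs_mul, abs_of_pos this]
  exact h1.comp (tendsto_sub_nhdsLT T)

lemma kHat_base_pos {β K₀ τ : ℝ} (hβ : 0 < β) (hK : 0 < K₀) (hτ : τ ≤ 1) :
    0 < (β + 1) * (1 - τ) + (β + 1) ^ 2 / (4 * β) * (K₀ ^ 2 / 16) := by
  have h1 : 0 ≤ (β + 1) * (1 - τ) := mul_nonneg (by linarith) (by linarith)
  have h2 : 0 < (β + 1) ^ 2 / (4 * β) * (K₀ ^ 2 / 16) := by positivity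
  linarith

lemma kHat_pos {β K₀ τ : ℝ} (hβ : 0 < β) (hK : 0 < K₀) (hτ : τ ≤ 1) : 0 < kHat β K₀ τ :=
  Real.rpow_pos_of_pos (kHat_base_pos hβ hK hτ) _

lemma kHat_anti {β K₀ τ τ' : ℝ} (hβ : 0 < β) (hK : 0 < K₀) (hτ : τ ≤ τ') (hτ' : τ' ≤ 1) :
    kHat β K₀ τ' ≤ kHat β K₀ τ := by
  refine Real.rpow_le_rpow (kHat_base_pos hβ hK hτ').le ?_ (by positivity)
  have : (β + 1) * (1 - τ') ≤ (β + 1) * (1 - τ) :=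
    mul_le_mul_of_nonneg_left (by linarith) (by linarith)
  linarith

namespace Setup

variable {β : ℝ} {F χ₀ : ℝ → ℝ} {Ω : Set (E N)} {ψ Hs : E N → ℝ} {T t₀ : ℝ} {P : Params}
  {h : ℝ → E N → ℝ}

lemma eventually_mem_Ico (S : Setup β F χ₀ Ω ψ Hs T t₀ P h) : ∀ᶠ t in 𝓝[<] T, t ∈ Ioo t₀ T :=
  Ioo_mem_nhdsLT S.t₀_lt

/-- Extinction at the origin. -/
theorem tendsto_zero (S : Setup β F χ₀ Ω ψ Hs T t₀ P h) :
    Tendsto (fun t => h t 0) (𝓝[<] T) (𝓝 0) := by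
  obtain ⟨C, hC, hb⟩ := S.exists_profile_bound
  have hP : (0 : ℝ) < Phi β (0 : E N) := Phi_pos S.β_pos 0
  have hβ := S.β_pos
  have hs : Tendsto (fun t => -Real.log (T - t)) (𝓝[<] T) atTop :=
    tendsto_neg_log_zero.comp (tendsto_sub_nhdsLT T)
  have h1 : Tendsto (fun t => C * (Real.log (-Real.log (T - t)) / -Real.log (T - t)))
      (𝓝[<] T) (𝓝 0) := by
    simpa using (tendsto_log_div_self.comp hs).const_mul C
  have h2 : ∀ᶠ t in 𝓝[<] T, C * (Real.log (-Real.log (T - t)) / -Real.log (T - t)) <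
      Phi β (0 : E N) / 2 := h1.eventually (gt_mem_nhds (by positivity))
  have h3 : Tendsto (fun t => (2 / Phi β (0 : E N)) * (T - t) ^ (1 / (β + 1))) (𝓝[<] T) (𝓝 0) := by
    have h4 : ContinuousAt (fun l : ℝ => l ^ (1 / (β + 1))) 0 :=
      Real.continuousAt_rpow_const _ _ (Or.inr (by positivity))
    have h5 := (h4.tendsto.mono_left nhdsWithin_le_nhds).comp (tendsto_sub_nhdsLT T)
    rw [Real.zero_rpow (by positivity)] at h5
    simpa using h5.const_mul (2 / Phi β (0 : E N))
  refine tendsto_of_tendsto_of_tendsto_of_le_of_le' tendsto_const_nhds h3 ?_ ?_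
  · filter_upwards [S.eventually_mem_Ico] with t ht
    exact (S.sol.pos t ⟨ht.1.le, ht.2⟩ 0 S.zero_mem).le
  · filter_upwards [S.eventually_mem_Ico, h2] with t ht ht2
    have ht' : t ∈ Ico t₀ T := ⟨ht.1.le, ht.2⟩
    have h4 := hb t ht' 0 S.zero_mem
    have hz : zvar T t (0 : E N) = 0 := by simp [zvar]
    rw [hz] at h4
    have hpos := S.sol.pos t ht' 0 S.zero_mem
    have h5 : Phi β (0 : E N) / 2 ≤ (T - t) ^ (1 / (β + 1)) / h t 0 := by
      linarith [(abs_le.1 h4).1]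
    rw [le_div_iff₀ hpos] at h5
    rw [div_mul_eq_mul_div, le_div_iff₀ hP]
    linarith

lemma tauOf_eq (x : E N) (t : ℝ) (hθ : theta P.K₀ ‖x‖ ≠ 0) :
    tauOf P.K₀ T t x = 1 - (T - t) / theta P.K₀ ‖x‖ := by
  rw [tauOf, tOf]; field_simp; ring

/-- Two-sided bounds for the solution near a point other than the origin. -/
theorem exists_local_bounds (S : Setup β F χ₀ Ω ψ Hs T t₀ P h) {x : E N} (hx : x ∈ Ω)
    (hx0 : x ≠ 0) : ∃ r > 0, Metric.closedBall x r ⊆ Ω ∧ ∃ c > 0, ∃ C,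
      ∀ᶠ t in 𝓝[<] T, ∀ y ∈ Metric.closedBall x r, h t y ∈ Icc c C := by
  have hβ := S.β_pos
  have hK := P.K₀_pos
  obtain ⟨r₀, hr₀, hr₀Ω⟩ := Metric.nhds_basis_closedBall.mem_iff.1 (S.isOpen.mem_nhds hx)
  -- For `‖x‖ ≤ ε₀` the second region applies at fixed `x` once `t` is late: `k̂ ≥ k̂(1)` and `δ₀ ≤
  -- k̂(1)/2` give the lower bound. Otherwise a ball of radius at most `ε₀/2` stays in the third
  -- region, where `η₀` is at most half the initial value.
  by_cases hxε : ‖x‖ ≤ P.ε₀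
  · have hxpos : 0 < ‖x‖ := norm_pos_iff.2 hx0
    obtain ⟨hθ0, hθ1, hθ2⟩ := theta_spec hK hxpos (hxε.trans S.ε₀_le)
    have hlog := one_le_abs_log_theta hK hxpos (hxε.trans S.ε₀_le)
    set θ := theta P.K₀ ‖x‖ with hθ
    have hsq : 0 < Real.sqrt θ := Real.sqrt_pos.2 hθ0
    have hα := P.α₀_pos
    have hθp : 0 < θ ^ (1 / (β + 1)) := Real.rpow_pos_of_pos hθ0 _
    have hk1 : 0 < kHat β P.K₀ 1 := kHat_pos hβ hK le_rfl
    refine ⟨min r₀ (Real.sqrt θ * (P.α₀ * Real.sqrt |Real.log θ|)),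
      lt_min hr₀ (by positivity), (Metric.closedBall_subset_closedBall (min_le_left _ _)).trans hr₀Ω,
      θ ^ (1 / (β + 1)) * (1 / 2 * kHat β P.K₀ 1), by positivity,
      θ ^ (1 / (β + 1)) * (kHat β P.K₀ 0 + P.δ₀), ?_⟩
    have h1 : ∀ᶠ t in 𝓝[<] T, scale T t < ‖x‖ / (P.K₀ / 4) :=
      (tendsto_scale T).eventually (gt_mem_nhds (by positivity))
    have h2 : ∀ᶠ t in 𝓝[<] T, T - t < θ :=
      ((tendsto_sub_nhdsLT T).mono_right nhdsWithin_le_nhds).eventually (gt_mem_nhds hθ0)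
    filter_upwards [S.eventually_mem_Ico, h1, h2] with t ht ht1 ht2 y hy
    have ht' : t ∈ Ico t₀ T := ⟨ht.1.le, ht.2⟩
    have hyΩ : y ∈ Ω := hr₀Ω (Metric.closedBall_subset_closedBall (min_le_left _ _) hy)
    set ξ := (Real.sqrt θ)⁻¹ • (y - x) with hξ
    have hxy : x + Real.sqrt θ • ξ = y := by
      rw [hξ, smul_inv_smul₀ hsq.ne', add_sub_cancel]
    have hξn : ‖ξ‖ ≤ P.α₀ * Real.sqrt |Real.log θ| := by
      rw [hξ, norm_smul, norm_inv, Real.norm_of_nonneg hsq.le, inv_mul_le_iff₀ hsq,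
        ← dist_eq_norm]
      exact (Metric.mem_closedBall.1 hy).trans (min_le_right _ _)
    have h3 := ((S.trap.2 t ht').region2 x hx
      (by rw [lt_div_iff₀ (by positivity)] at ht1; linarith) hxε ξ hξn
      (by rw [← hθ, hxy]; exact hyΩ)).1
    rw [kOf, ← hθ, hxy, tauOf_eq x t (by rw [← hθ]; exact hθ0.ne'), ← hθ] at h3
    have hτ0 : 0 ≤ (T - t) / θ := div_nonneg (S.sub_pos ht').le hθ0.le
    have hτ1 : (T - t) / θ ≤ 1 := (div_le_one hθ0).2 ht2.le
    have h4 := kHat_anti (β := β) hβ hK (τ := 1 - (T - t) / θ) (τ' := 1) (by linarith) le_rfl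
    have h5 := kHat_anti (β := β) hβ hK (τ := 0) (τ' := 1 - (T - t) / θ) (by linarith)
      (by linarith)
    have h6 := S.δ₀_le
    have h7 := abs_le.1 h3
    constructor
    · have : 1 / 2 * kHat β P.K₀ 1 ≤ h t y / θ ^ (1 / (β + 1)) := by linarith [h7.1]
      rw [le_div_iff₀ hθp] at this
      linarith
    · have : h t y / θ ^ (1 / (β + 1)) ≤ kHat β P.K₀ 0 + P.δ₀ := by linarith [h7.2]
      rw [div_le_iff₀ hθp] at this
      linarith
  · rw [not_le] at hxε
    have hε := P.ε₀_pos
    set r := min r₀ (P.ε₀ / 2) with hr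
    have hrpos : 0 < r := lt_min hr₀ (by positivity)
    have hrΩ : Metric.closedBall x r ⊆ Ω :=
      (Metric.closedBall_subset_closedBall (min_le_left _ _)).trans hr₀Ω
    have hcont : ContinuousOn (h t₀) (Metric.closedBall x r) :=
      (S.continuousOn_slice S.t₀_mem).mono hrΩ
    have hne : (Metric.closedBall x r).Nonempty := ⟨x, Metric.mem_closedBall_self hrpos.le⟩
    obtain ⟨y₁, hy₁, hmin⟩ := (isCompact_closedBall x r).exists_isMinOn hne hcont
    obtain ⟨y₂, hy₂, hmax⟩ := (isCompact_closedBall x r).exists_isMaxOn hne hcont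
    refine ⟨r, hrpos, hrΩ, 1 / 2 * h t₀ y₁,
      by have := S.sol.pos t₀ S.t₀_mem y₁ (hrΩ hy₁); positivity, h t₀ y₂ + P.η₀, ?_⟩
    filter_upwards [S.eventually_mem_Ico] with t ht y hy
    have ht' : t ∈ Ico t₀ T := ⟨ht.1.le, ht.2⟩
    have hyn : P.ε₀ / 4 ≤ ‖y‖ := by
      have h1 : dist y x ≤ P.ε₀ / 2 := (Metric.mem_closedBall.1 hy).trans (min_le_right _ _)
      rw [dist_eq_norm] at h1
      have h2 := norm_sub_norm_le x y
      rw [norm_sub_rev] at h2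
      linarith
    have h1 := abs_le.1 ((S.trap.2 t ht').region3 y (hrΩ hy) hyn).1
    have h2 := S.η₀_le y (hrΩ hy) hyn
    have h3 : h t₀ y₁ ≤ h t₀ y := hmin hy
    have h4 : h t₀ y ≤ h t₀ y₂ := hmax hy
    exact ⟨by linarith [h1.1], by linarith [h1.2]⟩

/-- Away from the origin the solution and its gradient converge as `t → T`. -/
theorem exists_limits (S : Setup β F χ₀ Ω ψ Hs T t₀ P h) {x : E N} (hx : x ∈ Ω) (hx0 : x ≠ 0) :
    (∃ l, Tendsto (fun t => h t x) (𝓝[<] T) (𝓝 l)) ∧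
      ∃ g, Tendsto (fun t => gradient (h t) x) (𝓝[<] T) (𝓝 g) := by
  obtain ⟨r, hr, hrΩ, c, hc, C, hb⟩ := S.exists_local_bounds hx hx0
  obtain ⟨t₁, ht₁, ht₁'⟩ := mem_nhdsLT_iff_exists_Ioo_subset.1 (hb.and S.eventually_mem_Ico)
  have ht₁T : t₁ < T := ht₁
  have hsub : ∀ t ∈ Ico ((t₁ + T) / 2) T, t ∈ Ioo t₁ T := fun t ht =>
    ⟨by linarith [ht.1], ht.2⟩
  exact IsHeat.exists_limits S.nonlin.smooth hr hc (t₂ := (t₁ + T) / 2) (C := C)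
    (by linarith) (S.isHeat.mono (fun t ht => (ht₁' (hsub t ht)).2) hrΩ)
    (fun t ht => (ht₁' (hsub t ht)).1)

end Setup

/-! ### The rescaled nonlinearity -/

/-- The nonlinearity seen at scale `l`, that is `l^{β/(β+1)} F(l^{1/(β+1)} r)`. -/
def scaledF (β : ℝ) (F : ℝ → ℝ) (l r : ℝ) : ℝ := l ^ (β / (β + 1)) * F (l ^ (1 / (β + 1)) * r)

/-- The deviation of the rescaled nonlinearity from the pure power. -/
def scaledErr (β : ℝ) (F : ℝ → ℝ) (l r : ℝ) : ℝ := scaledF β F l r - r ^ (-β)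

/-- The exponents in `scaledF` are those of the scale invariance of `∂ₜh = Δh - h^{-β}`, so the pure
power is unchanged. -/
lemma rpow_mul_scaled_rpow {β l r : ℝ} (hβ : 0 < β) (hl : 0 < l) (hr : 0 < r) :
    l ^ (β / (β + 1)) * (l ^ (1 / (β + 1)) * r) ^ (-β) = r ^ (-β) := by
  rw [Real.mul_rpow (by positivity) hr.le, ← Real.rpow_mul hl.le, ← mul_assoc,
    ← Real.rpow_add hl]
  have : β / (β + 1) + 1 / (β + 1) * -β = 0 := by field_simp; ring
  rw [this, Real.rpow_zero, one_mul]

lemma mul_scaled_rpow {β l r : ℝ} (hβ : 0 < β) (hl : 0 < l) (hr : 0 < r) :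
    l * (l ^ (1 / (β + 1)) * r) ^ (-(β + 1)) = r ^ (-(β + 1)) := by
  rw [Real.mul_rpow (by positivity) hr.le, ← Real.rpow_mul hl.le, ← mul_assoc]
  have : 1 / (β + 1) * -(β + 1) = -1 := by field_simp
  rw [this, Real.rpow_neg_one, mul_inv_cancel₀ hl.ne', one_mul]

lemma eventually_scaled_lt {β C v₀ : ℝ} (hβ : 0 < β) (hv₀ : 0 < v₀) :
    ∀ᶠ l in 𝓝[>] (0 : ℝ), ∀ r, r ≤ C → l ^ (1 / (β + 1)) * r < v₀ := by
  have h1 : ContinuousAt (fun l : ℝ => l ^ (1 / (β + 1)) * max C 0) 0 :=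
    (Real.continuousAt_rpow_const _ _ (Or.inr (by positivity))).mul continuousAt_const
  have h2 := h1.tendsto
  rw [Real.zero_rpow (by positivity), zero_mul] at h2
  filter_upwards [(h2.mono_left nhdsWithin_le_nhds).eventually (gt_mem_nhds hv₀),
    self_mem_nhdsWithin] with l hl hl0 r hr
  refine lt_of_le_of_lt (mul_le_mul_of_nonneg_left (hr.trans (le_max_left _ _)) ?_) hl
  exact Real.rpow_nonneg (le_of_lt hl0) _

namespace IsNonlinearity

variable {β : ℝ} {F : ℝ → ℝ}

/-- By invariance of the pure power, an error `o(v^{-β})` at `v = l^{1/(β+1)} r` becomes `o(1)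
r^{-β}`, and `r^{-β} ≤ c^{-β}`. -/
lemma eventually_scaledErr_le (hF : IsNonlinearity β F) (hβ : 0 < β) {c C ε : ℝ} (hc : 0 < c)
    (hε : 0 < ε) : ∀ᶠ l in 𝓝[>] (0 : ℝ), ∀ r ∈ Icc c C, |scaledErr β F l r| ≤ ε := by
  have hcβ : 0 < c ^ (-β) := Real.rpow_pos_of_pos hc _
  have h1 := hF.pert.def (c := ε / c ^ (-β)) (by positivity)
  obtain ⟨v₀, hv₀, hv₀'⟩ := mem_nhdsGT_iff_exists_Ioo_subset.1 h1
  filter_upwards [eventually_scaled_lt (C := C) hβ hv₀, self_mem_nhdsWithin] with l hl hl0 r hr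
  have hl0 : 0 < l := hl0
  have hr0 : 0 < r := hc.trans_le hr.1
  have hv : 0 < l ^ (1 / (β + 1)) * r := mul_pos (Real.rpow_pos_of_pos hl0 _) hr0
  have h2 := hv₀' ⟨hv, hl r hr.2⟩
  have hlp : 0 < l ^ (β / (β + 1)) := Real.rpow_pos_of_pos hl0 _
  simp only [mem_ofPred_eq, Real.norm_eq_abs] at h2
  rw [abs_of_pos (Real.rpow_pos_of_pos hv _)] at h2
  have h3 : scaledErr β F l r = l ^ (β / (β + 1)) *
      (F (l ^ (1 / (β + 1)) * r) - (l ^ (1 / (β + 1)) * r) ^ (-β)) := by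
    rw [mul_sub, rpow_mul_scaled_rpow hβ hl0 hr0]; rfl
  rw [h3, abs_mul, abs_of_pos hlp]
  calc l ^ (β / (β + 1)) * |F (l ^ (1 / (β + 1)) * r) - (l ^ (1 / (β + 1)) * r) ^ (-β)| ≤
        l ^ (β / (β + 1)) * (ε / c ^ (-β) * (l ^ (1 / (β + 1)) * r) ^ (-β)) :=
        mul_le_mul_of_nonneg_left h2 hlp.le
    _ = ε / c ^ (-β) * r ^ (-β) := by rw [← rpow_mul_scaled_rpow hβ hl0 hr0]; ring
    _ ≤ ε / c ^ (-β) * c ^ (-β) := by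
        refine mul_le_mul_of_nonneg_left ?_ (by positivity)
        exact Real.rpow_le_rpow_of_nonpos hc hr.1 (by linarith)
    _ = ε := div_mul_cancel₀ _ hcβ.ne'

/-- The chain rule adds a factor `l^{1/(β+1)}`, so the total weight is `l`, under which `v^{-(β+1)}`
is invariant; the hypothesis on the derivative then scales like the one on `F`. -/
lemma eventually_hasDerivAt_scaledF (hF : IsNonlinearity β F) (hβ : 0 < β) {c C ε : ℝ}
    (hc : 0 < c) (hε : 0 < ε) : ∀ᶠ l in 𝓝[>] (0 : ℝ), ∀ r ∈ Icc c C,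
      ∃ d, HasDerivAt (scaledF β F l) d r ∧ |d + β * r ^ (-(β + 1))| ≤ ε := by
  have hcβ : 0 < c ^ (-(β + 1)) := Real.rpow_pos_of_pos hc _
  have h1 := hF.pert_deriv.def (c := ε / c ^ (-(β + 1))) (by positivity)
  obtain ⟨v₀, hv₀, hv₀'⟩ := mem_nhdsGT_iff_exists_Ioo_subset.1 h1
  filter_upwards [eventually_scaled_lt (C := C) hβ hv₀, self_mem_nhdsWithin] with l hl hl0 r hr
  have hl0 : 0 < l := hl0
  have hr0 : 0 < r := hc.trans_le hr.1
  have hv : 0 < l ^ (1 / (β + 1)) * r := mul_pos (Real.rpow_pos_of_pos hl0 _) hr0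
  have h2 := hv₀' ⟨hv, hl r hr.2⟩
  simp only [mem_ofPred_eq, Real.norm_eq_abs] at h2
  rw [abs_of_pos (Real.rpow_pos_of_pos hv _)] at h2
  set v := l ^ (1 / (β + 1)) * r with hvdef
  have hFd : HasDerivAt F (deriv F v) v :=
    ((hF.smooth.contDiffAt (isOpen_Ioi.mem_nhds hv)).differentiableAt (by simp)).hasDerivAt
  have hpow : HasDerivAt (fun w : ℝ => w ^ (-β)) (-β * v ^ (-β - 1)) v :=
    Real.hasDerivAt_rpow_const (Or.inl hv.ne')
  rw [(hFd.fun_sub hpow).deriv, show -β - 1 = -(β + 1) by ring] at h2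
  have hlin : HasDerivAt (fun r : ℝ => l ^ (1 / (β + 1)) * r) (l ^ (1 / (β + 1))) r := by
    simpa using (hasDerivAt_id r).const_mul (l ^ (1 / (β + 1)))
  have hll : l ^ (β / (β + 1)) * l ^ (1 / (β + 1)) = l := by
    rw [← Real.rpow_add hl0, ← add_div, div_self (by linarith), Real.rpow_one]
  refine ⟨l * deriv F v, ?_, ?_⟩
  · refine ((hFd.comp r hlin).const_mul (l ^ (β / (β + 1)))).congr_deriv ?_
    rw [mul_left_comm, hll, mul_comm]
  · have h3 : l * deriv F v + β * r ^ (-(β + 1)) =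
        l * (deriv F v - -β * v ^ (-(β + 1))) := by
      rw [← mul_scaled_rpow hβ hl0 hr0, ← hvdef]; ring
    rw [h3, abs_mul, abs_of_pos hl0]
    calc l * |deriv F v - -β * v ^ (-(β + 1))| ≤ l * (ε / c ^ (-(β + 1)) * v ^ (-(β + 1))) :=
          mul_le_mul_of_nonneg_left h2 hl0.le
      _ = ε / c ^ (-(β + 1)) * r ^ (-(β + 1)) := by
          rw [← mul_scaled_rpow hβ hl0 hr0, ← hvdef]; ring
      _ ≤ ε / c ^ (-(β + 1)) * c ^ (-(β + 1)) := by
          refine mul_le_mul_of_nonneg_left ?_ (by positivity)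
          exact Real.rpow_le_rpow_of_nonpos hc hr.1 (by linarith)
      _ = ε := div_mul_cancel₀ _ hcβ.ne'

lemma eventually_scaledErr_lipschitz (hF : IsNonlinearity β F) (hβ : 0 < β) {c C ε : ℝ}
    (hc : 0 < c) (hε : 0 < ε) : ∀ᶠ l in 𝓝[>] (0 : ℝ), ∀ r ∈ Icc c C, ∀ r' ∈ Icc c C,
      |scaledErr β F l r - scaledErr β F l r'| ≤ ε * |r - r'| := by
  filter_upwards [hF.eventually_hasDerivAt_scaledF hβ (C := C) hc hε] with l hl r hr r' hr'
  choose! d hd hd' using hl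
  refine (convex_Icc c C).norm_image_sub_le_of_norm_hasDerivWithin_le (f := scaledErr β F l)
    (f' := fun r => d r - -β * r ^ (-β - 1)) (fun x hx => ?_) (fun x hx => ?_) hr' hr
  · exact ((hd x hx).sub (Real.hasDerivAt_rpow_const
      (Or.inl (hc.trans_le hx.1).ne'))).hasDerivWithinAt
  · have := hd' x hx
    rw [Real.norm_eq_abs, show -β - 1 = -(β + 1) by ring]
    simpa using this

end IsNonlinearity

/-- Change of scale for the deviation. -/
lemma scaledErr_change {β : ℝ} {F : ℝ → ℝ} (hβ : 0 < β) {l r r₀ : ℝ} (hl : 0 < l) (hr : 0 < r)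
    (hr₀ : 0 < r₀) :
    scaledErr β F l r =
      (r₀ / r) ^ β * scaledErr β F (l * (r / r₀) ^ (β + 1)) r₀ := by
  have hq : 0 < r / r₀ := by positivity
  have h1 : (l * (r / r₀) ^ (β + 1)) ^ (1 / (β + 1)) * r₀ = l ^ (1 / (β + 1)) * r := by
    rw [Real.mul_rpow hl.le (by positivity), ← Real.rpow_mul hq.le,
      mul_one_div_cancel (by linarith), Real.rpow_one]
    field_simp
  have h2 : (l * (r / r₀) ^ (β + 1)) ^ (β / (β + 1)) = l ^ (β / (β + 1)) * (r / r₀) ^ β := by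
    rw [Real.mul_rpow hl.le (by positivity), ← Real.rpow_mul hq.le]
    congr 2
    field_simp
  have h3 : (r₀ / r) ^ β * (r / r₀) ^ β = 1 := by
    rw [← Real.mul_rpow (by positivity) hq.le]
    have : r₀ / r * (r / r₀) = 1 := by field_simp
    rw [this, Real.one_rpow]
  have h4 : (r₀ / r) ^ β * r₀ ^ (-β) = r ^ (-β) := by
    rw [Real.div_rpow hr₀.le hr.le, Real.rpow_neg hr₀.le, Real.rpow_neg hr.le]
    have : r₀ ^ β ≠ 0 := (Real.rpow_pos_of_pos hr₀ _).ne'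
    field_simp
  rw [scaledErr, scaledErr, scaledF, scaledF, h1, h2, mul_sub, h4]
  rw [show (r₀ / r) ^ β * (l ^ (β / (β + 1)) * (r / r₀) ^ β * F (l ^ (1 / (β + 1)) * r)) =
    ((r₀ / r) ^ β * (r / r₀) ^ β) * (l ^ (β / (β + 1)) * F (l ^ (1 / (β + 1)) * r)) by ring, h3,
    one_mul]

namespace Setup

variable {β : ℝ} {F χ₀ : ℝ → ℝ} {Ω : Set (E N)} {ψ Hs : E N → ℝ} {T t₀ : ℝ} {P : Params}
  {h : ℝ → E N → ℝ}

/-- The parabolic rescaling of a solution. -/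
lemma isHeat_rescaled (S : Setup β F χ₀ Ω ψ Hs T t₀ P h) {l : ℝ} (hl : 0 < l) (t₁ : ℝ) (x₁ : E N)
    {J : Set ℝ} {O : Set (E N)} (hJ : ∀ t ∈ J, t₁ + l * t ∈ Ioo t₀ T)
    (hO : ∀ x ∈ O, x₁ + Real.sqrt l • x ∈ Ω) :
    IsHeat J O (fun τ ξ => l ^ (-(1 / (β + 1))) * h (t₁ + l * τ) (x₁ + Real.sqrt l • ξ))
      (fun τ ξ => -scaledF β F l
        (l ^ (-(1 / (β + 1))) * h (t₁ + l * τ) (x₁ + Real.sqrt l • ξ))) := by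
  have hβ := S.β_pos
  have h1 := (S.isHeat.rescale (J := J) (O' := O) (l := l) (c := Real.sqrt l)
    (Real.sqrt_pos.2 hl).ne' (Real.sq_sqrt hl.le) t₁ x₁ hJ hO).const_mul (l ^ (-(1 / (β + 1))))
  refine h1.congr_source fun τ hτ ξ hξ => ?_
  rw [scaledF, ← mul_assoc (l ^ (1 / (β + 1))), ← Real.rpow_add hl, add_neg_cancel, Real.rpow_zero,
    one_mul, ← mul_assoc]
  have : l ^ (-(1 / (β + 1))) * l = l ^ (β / (β + 1)) := by
    conv_lhs => rw [← Real.rpow_one l, ← Real.rpow_mul hl.le, one_mul, ← Real.rpow_add hl]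
    congr 1; field_simp; ring
  rw [this]; ring

end Setup

/-! ### Second-order expansion of the solution near the origin -/

lemma taylor_two_isBigO {f : ℝ → ℝ} {f' a : ℝ} (hf : ContDiffAt ℝ 2 f a)
    (hf' : HasDerivAt f f' a) :
    (fun x => f x - f a - f' * (x - a)) =O[𝓝 a] fun x => (x - a) ^ 2 := by
  have h1 : ContDiffAt ℝ 1 (deriv f) a := by
    have := (hf.fderiv_right (m := 1) (by norm_num)).clm_apply
      (contDiffAt_const (c := (1 : ℝ)))
    exact this
  obtain ⟨K, t, ht, hK⟩ := h1.exists_lipschitzOnWith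
  have h2 : ∀ᶠ x in 𝓝 a, ContDiffAt ℝ 2 f x := hf.eventually (by simp)
  obtain ⟨r, hr, hr'⟩ := Metric.eventually_nhds_iff_ball.1 (h2.and ht)
  refine IsBigO.of_bound K ?_
  filter_upwards [Metric.ball_mem_nhds a hr] with x hx
  have hsub : ∀ z ∈ Metric.closedBall a (dist x a), z ∈ Metric.ball a r := fun z hz =>
    lt_of_le_of_lt (Metric.mem_closedBall.1 hz) hx
  have hd : ∀ z ∈ Metric.closedBall a (dist x a),
      HasDerivWithinAt (fun z => f z - f' * z) (deriv f z - f') (Metric.closedBall a (dist x a)) z := by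
    intro z hz
    have := ((hr' z (hsub z hz)).1.differentiableAt (by simp)).hasDerivAt.fun_sub
      ((hasDerivAt_id' z).const_mul f')
    exact (this.congr_deriv (by rw [mul_one])).hasDerivWithinAt
  have hb : ∀ z ∈ Metric.closedBall a (dist x a), ‖deriv f z - f'‖ ≤ K * dist x a := by
    intro z hz
    rw [← hf'.deriv, ← dist_eq_norm]
    exact (hK.dist_le_mul z (hr' z (hsub z hz)).2 a (mem_of_mem_nhds ht)).trans
      (mul_le_mul_of_nonneg_left hz K.2)
  have := (convex_closedBall a (dist x a)).norm_image_sub_le_of_norm_hasDerivWithin_le hd hb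
    (Metric.mem_closedBall_self dist_nonneg) (Metric.mem_closedBall.2 le_rfl)
  rw [Real.dist_eq] at this
  rw [norm_pow, Real.norm_eq_abs (x - a)]
  calc ‖f x - f a - f' * (x - a)‖ = ‖f x - f' * x - (f a - f' * a)‖ := by congr 1; ring
    _ ≤ K * |x - a| * ‖x - a‖ := this
    _ = K * |x - a| ^ 2 := by rw [Real.norm_eq_abs]; ring

/-- Space-time points `(l, τ, ξ)` with `l → 0⁺`, `-1/|log l| ≤ τ ≤ 0` and `|ξ| ≤ 1`. -/
def innerCyl (N : ℕ) : Filter (ℝ × ℝ × E N) :=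
  comap Prod.fst (𝓝[>] 0) ⊓
    𝓟 {q | q.2.1 ∈ Icc (-(-Real.log q.1)⁻¹) 0 ∧ ‖q.2.2‖ ≤ 1}

lemma eventually_innerCyl {p : ℝ × ℝ × E N → Prop} :
    (∀ᶠ q in innerCyl N, p q) ↔ ∀ᶠ l in 𝓝[>] (0 : ℝ), ∀ τ ∈ Icc (-(-Real.log l)⁻¹) 0,
      ∀ ξ : E N, ‖ξ‖ ≤ 1 → p (l, τ, ξ) := by
  rw [innerCyl, eventually_inf_principal, eventually_comap]
  refine eventually_congr (Eventually.of_forall fun l => ?_)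
  constructor
  · intro h τ hτ ξ hξ
    exact h (l, τ, ξ) rfl ⟨hτ, hξ⟩
  · rintro h ⟨l', τ, ξ⟩ rfl ⟨hτ, hξ⟩
    exact h τ hτ ξ hξ

lemma tendsto_fst_innerCyl : Tendsto Prod.fst (innerCyl N) (𝓝[>] 0) :=
  tendsto_comap.mono_left inf_le_left

/-- The coefficient of `1/s` in the expansion of the self-similar profile. -/
def firstCoeff (β : ℝ) (ξ : E N) : ℝ :=
  -(1 / (β + 1)) * (β + 1) ^ (-(1 / (β + 1)) - 1) * ((β + 1) ^ 2 / (4 * β)) * ‖ξ‖ ^ 2 +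
    N * kappa β / (2 * β)

namespace Setup

variable {β : ℝ} {F χ₀ : ℝ → ℝ} {Ω : Set (E N)} {ψ Hs : E N → ℝ} {T t₀ : ℝ} {P : Params}
  {h : ℝ → E N → ℝ}

/-- The solution rescaled around `(0, T - l)`. -/
def Hres (β T : ℝ) (h : ℝ → E N → ℝ) (l τ : ℝ) (ξ : E N) : ℝ :=
  l ^ (-(1 / (β + 1))) * h (T - l + l * τ) (Real.sqrt l • ξ)

/-- For `|ξ| ≤ 1` the cut-off is inactive and `q = O(log s / s²)`, one power of `s` better than the
global bound. As `|τ| ≤ 1/s`, every quadratic term in `τ` and `1/s` is `O(1/s²)`, so first-order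
expansions of the profile, of the inverse and of `(1-τ)^{1/(β+1)}` suffice. -/
theorem expansion_isBigO (S : Setup β F χ₀ Ω ψ Hs T t₀ P h) :
    (fun q : ℝ × ℝ × E N => Hres β T h q.1 q.2.1 q.2.2 - ((kappa β)⁻¹ -
      1 / (β + 1) * (kappa β)⁻¹ * q.2.1 -
      firstCoeff β q.2.2 * ((kappa β) ^ 2)⁻¹ * (-Real.log q.1)⁻¹)) =O[innerCyl N]
      fun q => Real.log (-Real.log q.1) / (-Real.log q.1) ^ 2 := by
  have hβ := S.β_pos
  have hκ := kappa_pos hβ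
  have hb := coeff_pos hβ
  have hK := P.K₀_pos
  obtain ⟨C, hC, hq⟩ := S.exists_q_bounds
  set 𝓕 := innerCyl N
  set p := 1 / (β + 1) with hp
  have hppos : 0 < p := by positivity
  set b := (β + 1) ^ 2 / (4 * β) with hbdef
  set s : ℝ × ℝ × E N → ℝ := fun q => -Real.log q.1 with hs
  set τ : ℝ × ℝ × E N → ℝ := fun q => q.2.1 with hτ
  set ξ : ℝ × ℝ × E N → E N := fun q => q.2.2 with hξ
  set i : ℝ × ℝ × E N → ℝ := fun q => (s q)⁻¹ with hi
  set m : ℝ × ℝ × E N → ℝ := fun q => Real.log (s q) / s q ^ 2 with hm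
  have hst : Tendsto s 𝓕 atTop := tendsto_neg_log_zero.comp tendsto_fst_innerCyl
  have hit : Tendsto i 𝓕 (𝓝 0) := tendsto_inv_atTop_zero.comp hst
  have hpos : ∀ᶠ q in 𝓕, 0 < q.1 := tendsto_fst_innerCyl.eventually self_mem_nhdsWithin
  have hs3 : ∀ᶠ q in 𝓕, 3 ≤ s q := hst.eventually_ge_atTop 3
  have hτb : ∀ᶠ q in 𝓕, -i q ≤ τ q ∧ τ q ≤ 0 ∧ ‖ξ q‖ ≤ 1 := by
    have : {q : ℝ × ℝ × E N | q.2.1 ∈ Icc (-(-Real.log q.1)⁻¹) 0 ∧ ‖q.2.2‖ ≤ 1} ∈ 𝓕 :=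
      mem_inf_of_right (mem_principal_self _)
    filter_upwards [this] with q hq using ⟨hq.1.1, hq.1.2, hq.2⟩
  have hτi : τ =O[𝓕] i := by
    refine IsBigO.of_bound 1 ?_
    filter_upwards [hτb, hs3] with q h1 h2
    have : 0 ≤ i q := by simp only [hi]; exact inv_nonneg.2 (by linarith)
    rw [Real.norm_eq_abs, Real.norm_eq_abs, abs_of_nonpos h1.2.1, abs_of_nonneg this]
    linarith [h1.1]
  have hτt : Tendsto τ 𝓕 (𝓝 0) := hτi.trans_tendsto hit
  have hξ1 : (fun q => ‖ξ q‖ ^ 2) =O[𝓕] fun _ => (1 : ℝ) := by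
    refine IsBigO.of_bound 1 ?_
    filter_upwards [hτb] with q h1
    rw [norm_pow, norm_norm, norm_one, mul_one]
    exact pow_le_one₀ (norm_nonneg _) h1.2.2
  have hiim : (fun q => i q * i q) =O[𝓕] m := by
    refine IsBigO.of_bound 1 ?_
    filter_upwards [hst.eventually_ge_atTop (Real.exp 1)] with q h1
    have h0 : 0 < s q := (Real.exp_pos 1).trans_le h1
    have h2 : 1 ≤ Real.log (s q) := (Real.le_log_iff_exp_le h0).2 h1
    simp only [hi, hm]
    rw [Real.norm_of_nonneg (by positivity), Real.norm_of_nonneg (by positivity), one_mul,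
      ← mul_inv, ← sq, ← one_div]
    exact div_le_div_of_nonneg_right h2 (by positivity)
  have hmi : m =O[𝓕] i := by
    have h1 : (fun q => Real.log (s q) / s q) =O[𝓕] fun _ => (1 : ℝ) :=
      (tendsto_log_div_self.comp hst).isBigO_one ℝ
    refine ((h1.mul (isBigO_refl i 𝓕)).congr_left fun q => ?_).congr_right fun q => by simp
    simp only [hi, hm]; rw [sq]; rw [div_mul_eq_div_mul_one_div, one_div]
  set g : ℝ × ℝ × E N → ℝ := fun q => Real.log (1 - τ q) with hg
  have hgb : ∀ᶠ q in 𝓕, 0 ≤ g q ∧ g q ≤ i q := by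
    filter_upwards [hτb] with q h1
    refine ⟨Real.log_nonneg (by linarith [h1.2.1]), ?_⟩
    have := Real.log_le_sub_one_of_pos (show 0 < 1 - τ q by linarith [h1.2.1])
    simp only [hg]
    linarith [h1.1]
  have hgi : g =O[𝓕] i := by
    refine IsBigO.of_bound 1 ?_
    filter_upwards [hgb] with q h1
    rw [Real.norm_of_nonneg h1.1, Real.norm_of_nonneg (h1.1.trans h1.2), one_mul]
    exact h1.2
  -- The similarity time `-log(T - t)` at `t = T - l + lτ`; replacing it by `s` changes its inverse
  -- by `O(1/s²)`.
  set s' : ℝ × ℝ × E N → ℝ := fun q => s q - g q with hs'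
  have hs'b : ∀ᶠ q in 𝓕, s q / 2 ≤ s' q ∧ s' q ≤ s q ∧ 1 < s' q := by
    filter_upwards [hgb, hs3] with q h1 h2
    have : i q ≤ 1 := by simp only [hi]; exact inv_le_one_of_one_le₀ (by linarith)
    simp only [hs']
    exact ⟨by linarith, by linarith, by linarith⟩
  set i' : ℝ × ℝ × E N → ℝ := fun q => (s' q)⁻¹ with hi'
  have hi'i : i' =O[𝓕] i := by
    refine IsBigO.of_bound 2 ?_
    filter_upwards [hs'b, hs3] with q h1 h2
    simp only [hi', hi]
    rw [Real.norm_of_nonneg (inv_nonneg.2 (by linarith)),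
      Real.norm_of_nonneg (inv_nonneg.2 (by linarith)), ← div_eq_mul_inv,
      ← inv_div, inv_le_inv₀ (by linarith) (by linarith)]
    exact h1.1
  have hi1 : i =O[𝓕] fun _ => (1 : ℝ) := hit.isBigO_one ℝ
  have hi'd : (fun q => i' q - i q) =O[𝓕] fun q => i q * i q := by
    have h1 : (fun q => g q * (i' q * i q)) =O[𝓕] fun q => i q * (i q * 1) :=
      hgi.mul (hi'i.mul hi1)
    refine (h1.congr' ?_ (Eventually.of_forall fun q => by simp))
    filter_upwards [hs'b, hs3] with q h1 h2
    have e1 : s q ≠ 0 := by linarith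
    have e2 : s' q ≠ 0 := by linarith
    simp only [hi', hi]
    field_simp
    simp only [hs']; ring
  have hoτ : (fun q => (1 - τ q)⁻¹ - 1) =O[𝓕] i := by
    refine IsBigO.trans (IsBigO.of_bound 1 ?_) hτi
    filter_upwards [hτb] with q h1
    have e1 : 1 ≤ 1 - τ q := by linarith [h1.2.1]
    have e2 : (1 - τ q)⁻¹ - 1 = τ q * (1 - τ q)⁻¹ := by
      have : 1 - τ q ≠ 0 := by linarith
      field_simp; ring
    rw [e2, norm_mul, one_mul]
    refine mul_le_of_le_one_right (norm_nonneg _) ?_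
    rw [norm_inv, Real.norm_of_nonneg (by linarith)]
    exact inv_le_one_of_one_le₀ e1
  -- The non-constant part of the base of `Φ` at the similarity variable `y = ξ/√(1-τ)` and
  -- similarity time `s'`.
  set u : ℝ × ℝ × E N → ℝ := fun q => b * ‖ξ q‖ ^ 2 * ((1 - τ q)⁻¹ * i' q) with hu
  have hud : (fun q => u q - b * ‖ξ q‖ ^ 2 * i q) =O[𝓕] m := by
    have h1 : (fun q => b * ‖ξ q‖ ^ 2) =O[𝓕] fun _ => (1 : ℝ) := hξ1.const_mul_left b
    have h2 : (fun q => ((1 - τ q)⁻¹ - 1) * i' q + (i' q - i q)) =O[𝓕] fun q => i q * i q :=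
      (hoτ.mul hi'i).add hi'd
    have h3 := (h1.mul h2).trans (g := fun q => 1 * (i q * i q)) (k := m) (by simpa using hiim)
    refine h3.congr_left fun q => ?_
    simp only [hu]; ring
  have hui : u =O[𝓕] i := by
    have h1 : (fun q => b * ‖ξ q‖ ^ 2 * i q) =O[𝓕] i := by
      simpa using (hξ1.const_mul_left b).mul (isBigO_refl i 𝓕)
    refine ((hud.trans hmi).add h1).congr_left fun q => by ring
  have hut : Tendsto u 𝓕 (𝓝 0) := hui.trans_tendsto hit
  -- the profile
  have hκp : kappa β = (β + 1 + 0) ^ (-p) := by rw [add_zero]; rfl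
  have hΦ : (fun q => (β + 1 + u q) ^ (-p) - kappa β -
      -p * (β + 1) ^ (-p - 1) * u q) =O[𝓕] m := by
    have hd : HasDerivAt (fun x : ℝ => (β + 1 + x) ^ (-p)) (-p * (β + 1) ^ (-p - 1)) 0 := by
      have h1 : HasDerivAt (fun x : ℝ => β + 1 + x) 1 0 := (hasDerivAt_id 0).const_add _
      have := h1.rpow_const (p := -p) (Or.inl (by linarith))
      refine this.congr_deriv ?_
      rw [add_zero]; ring
    have hc : ContDiffAt ℝ 2 (fun x : ℝ => (β + 1 + x) ^ (-p)) 0 :=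
      (contDiffAt_const.add contDiffAt_id).rpow_const_of_ne (by simp; linarith)
    have h1 := (taylor_two_isBigO hc hd).comp_tendsto hut
    have h2 : (fun q => (u q - 0) ^ 2) =O[𝓕] m := by
      refine ((hui.mul hui).trans hiim).congr_left fun q => by ring
    refine (h1.trans h2).congr_left fun q => ?_
    simp only [Function.comp, ← hκp]; ring
  -- the solution
  set w : ℝ × ℝ × E N → ℝ := fun q => (q.1 * (1 - τ q)) ^ p / h (T - q.1 + q.1 * τ q)
    (Real.sqrt q.1 • ξ q) with hw
  have hmem : ∀ᶠ q in 𝓕, T - q.1 + q.1 * τ q ∈ Ico t₀ T ∧ Real.sqrt q.1 • ξ q ∈ Ω ∧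
      2 ≤ P.K₀ * Real.sqrt (s' q) := by
    have h1 : ∀ᶠ q in 𝓕, q.1 < (T - t₀) / 2 :=
      (tendsto_fst_innerCyl.mono_right nhdsWithin_le_nhds).eventually
        (gt_mem_nhds (by linarith [S.t₀_lt]))
    have h2 : ∀ᶠ q in 𝓕, Real.sqrt q.1 • ξ q ∈ Ω := by
      obtain ⟨r, hr, hrΩ⟩ := Metric.isOpen_iff.1 S.isOpen 0 S.zero_mem
      have h3 : Tendsto (fun q : ℝ × ℝ × E N => Real.sqrt q.1) 𝓕 (𝓝 0) := by
        have := (Real.continuous_sqrt.tendsto 0).comp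
          (tendsto_fst_innerCyl (N := N) |>.mono_right nhdsWithin_le_nhds)
        simpa [Function.comp_def] using this
      filter_upwards [h3.eventually (gt_mem_nhds hr), hτb] with q h4 h5
      refine hrΩ ?_
      rw [mem_ball_zero_iff, norm_smul, Real.norm_of_nonneg (Real.sqrt_nonneg _)]
      exact (mul_le_of_le_one_right (Real.sqrt_nonneg _) h5.2.2).trans_lt h4
    have h3 : ∀ᶠ q in 𝓕, 2 * (2 / P.K₀) ^ 2 ≤ s q := hst.eventually_ge_atTop _
    filter_upwards [hpos, h1, h2, h3, hτb, hs'b, hs3] with q e0 e1 e2 e3 e4 e5 e6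
    have e7 : i q ≤ 1 := by simp only [hi]; exact inv_le_one_of_one_le₀ (by linarith)
    refine ⟨⟨by nlinarith, by nlinarith [e4.2.1]⟩, e2, ?_⟩
    have : 2 / P.K₀ ≤ Real.sqrt (s' q) := by
      apply Real.le_sqrt_of_sq_le; linarith [e5.1]
    rw [div_le_iff₀ hK] at this
    linarith
  have hwφ : (fun q => w q - ((β + 1 + u q) ^ (-p) + N * kappa β / (2 * β) * i' q)) =O[𝓕] m := by
    -- The factor `4` comes from `s' ≥ s/2` in the denominator `s'²`.
    refine IsBigO.of_bound (C * 4) ?_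
    filter_upwards [hpos, hmem, hτb, hs'b, hs3] with q e0 ⟨e1, e2, e3⟩ e4 e5 e6
    have h1τ : 1 ≤ 1 - τ q := by linarith [e4.2.1]
    have hTt : T - (T - q.1 + q.1 * τ q) = q.1 * (1 - τ q) := by ring
    have hlog : -Real.log (q.1 * (1 - τ q)) = s' q := by
      rw [Real.log_mul e0.ne' (by linarith)]; simp only [hs', hs, hg]; ring
    have hsq : 0 < Real.sqrt (1 - τ q) := Real.sqrt_pos.2 (by linarith)
    set y : E N := (Real.sqrt (1 - τ q))⁻¹ • ξ q with hy
    have hxy : Real.sqrt (q.1 * (1 - τ q)) • y = Real.sqrt q.1 • ξ q := by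
      rw [Real.sqrt_mul e0.le, hy, smul_smul, mul_assoc, mul_inv_cancel₀ hsq.ne', mul_one]
    have hyn : ‖y‖ < 2 := by
      rw [hy, norm_smul, norm_inv, Real.norm_of_nonneg hsq.le]
      have h1 : (Real.sqrt (1 - τ q))⁻¹ ≤ 1 := inv_le_one_of_one_le₀ (Real.one_le_sqrt.2 h1τ)
      have h2 : (Real.sqrt (1 - τ q))⁻¹ * ‖ξ q‖ ≤ 1 * 1 :=
        mul_le_mul h1 e4.2.2 (norm_nonneg _) zero_le_one
      linarith
    have h1 := (hq _ e1 y (by rw [hTt, hxy]; exact e2)).2 (by rw [hTt, hlog]; exact e3) hyn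
    rw [hTt, hxy, hlog] at h1
    have h2 : varphi β y (s' q) = (β + 1 + u q) ^ (-p) + N * kappa β / (2 * β) * i' q := by
      rw [varphi, Phi]
      congr 1
      · refine congrArg (fun v => (β + 1 + v) ^ (-p)) ?_
        simp only [hu, hy]
        rw [norm_smul, norm_smul, mul_pow, mul_pow, norm_inv, norm_inv, inv_pow, inv_pow,
          Real.norm_of_nonneg hsq.le, Real.norm_of_nonneg (Real.sqrt_nonneg _),
          Real.sq_sqrt (by linarith), Real.sq_sqrt (by linarith)]
        simp only [hi']
        ring
      · simp only [hi']; rw [← div_div, div_eq_mul_inv _ (s' q)]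
    rw [h2] at h1
    rw [Real.norm_eq_abs]
    refine h1.trans ?_
    have h3 : Real.log (s' q) ≤ Real.log (s q) := Real.log_le_log (by linarith) e5.2.1
    have h4 : 0 ≤ Real.log (s' q) := Real.log_nonneg e5.2.2.le
    simp only [hm]
    rw [Real.norm_of_nonneg (div_nonneg (h4.trans h3) (by positivity)), mul_assoc]
    refine mul_le_mul_of_nonneg_left ?_ hC
    calc Real.log (s' q) / s' q ^ 2 ≤ Real.log (s q) / (s q / 2) ^ 2 := by
          refine div_le_div₀ (h4.trans h3) h3 (by positivity) ?_
          exact pow_le_pow_left₀ (by linarith) e5.1 2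
      _ = 4 * (Real.log (s q) / s q ^ 2) := by
          have : s q ≠ 0 := by linarith
          field_simp; norm_num
  set a : ℝ × ℝ × E N → ℝ := fun q => firstCoeff β (ξ q) with ha
  have ha1 : a =O[𝓕] fun _ => (1 : ℝ) :=
    (hξ1.const_mul_left _).add (isBigO_const_const _ one_ne_zero _)
  have hwe : (fun q => w q - kappa β - a q * i q) =O[𝓕] m := by
    have h1 := (hwφ.add hΦ).add ((hud.const_mul_left (-p * (β + 1) ^ (-p - 1))).add
      ((hi'd.trans hiim).const_mul_left (N * kappa β / (2 * β))))
    refine h1.congr_left fun q => ?_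
    simp only [ha, firstCoeff, ← hp, ← hbdef]; ring
  have hei : (fun q => w q - kappa β) =O[𝓕] i := by
    have h1 : (fun q => a q * i q) =O[𝓕] i := by simpa using ha1.mul (isBigO_refl i 𝓕)
    exact ((hwe.trans hmi).add h1).congr_left fun q => by ring
  have hwt : Tendsto w 𝓕 (𝓝 (kappa β)) := by
    have := (hei.trans_tendsto hit).add_const (kappa β)
    simpa using this
  have hinv : (fun q => (w q)⁻¹ - (kappa β)⁻¹ + a q * ((kappa β) ^ 2)⁻¹ * i q) =O[𝓕] m := by
    have h1 := (taylor_two_isBigO (contDiffAt_inv ℝ hκ.ne') (hasDerivAt_inv hκ.ne')).comp_tendsto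
      hwt
    have h2 : (fun q => (w q - kappa β) ^ 2) =O[𝓕] m :=
      ((hei.mul hei).trans hiim).congr_left fun q => by ring
    refine ((h1.trans h2).sub (hwe.const_mul_left ((kappa β) ^ 2)⁻¹)).congr_left fun q => ?_
    simp only [Function.comp]; ring
  have hpow : (fun q => (1 - τ q) ^ p - 1 + p * τ q) =O[𝓕] m := by
    have hd : HasDerivAt (fun x : ℝ => (1 - x) ^ p) (-p) 0 := by
      have h1 : HasDerivAt (fun x : ℝ => 1 - x) (-1) 0 := (hasDerivAt_id 0).const_sub 1
      refine (h1.rpow_const (p := p) (Or.inl (by norm_num))).congr_deriv ?_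
      simp
    have hc : ContDiffAt ℝ 2 (fun x : ℝ => (1 - x) ^ p) 0 :=
      (contDiffAt_const.sub contDiffAt_id).rpow_const_of_ne (by simp)
    have h1 := (taylor_two_isBigO hc hd).comp_tendsto hτt
    have h2 : (fun q => (τ q - 0) ^ 2) =O[𝓕] m :=
      ((hτi.mul hτi).trans hiim).congr_left fun q => by ring
    refine (h1.trans h2).congr_left fun q => ?_
    simp
  have hw1 : (fun q => (w q)⁻¹) =O[𝓕] fun _ => (1 : ℝ) := (hwt.inv₀ hκ.ne').isBigO_one ℝ
  have hτ1 : (fun q => 1 - p * τ q) =O[𝓕] fun _ => (1 : ℝ) :=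
    (isBigO_const_const _ one_ne_zero _).sub ((hτi.trans hi1).const_mul_left p)
  have hlast : (fun q => τ q * (a q * i q)) =O[𝓕] m := by
    have h1 := hτi.mul (ha1.mul (isBigO_refl i 𝓕))
    refine (h1.trans (k := m) ?_)
    simpa using hiim
  -- An exact decomposition of the error of the product `(1-τ)^p w⁻¹`: the error of each factor, and
  -- the cross term of the two linear parts.
  have htot : (fun q => ((1 - τ q) ^ p - 1 + p * τ q) * (w q)⁻¹ +
      (1 - p * τ q) * ((w q)⁻¹ - (kappa β)⁻¹ + a q * ((kappa β) ^ 2)⁻¹ * i q) +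
      p * ((kappa β) ^ 2)⁻¹ * (τ q * (a q * i q))) =O[𝓕] m := by
    refine ((?_ : _ =O[𝓕] m).add ?_).add (hlast.const_mul_left _)
    · simpa using hpow.mul hw1
    · simpa using hτ1.mul hinv
  refine htot.congr' ?_ (Eventually.of_forall fun q => rfl)
  filter_upwards [hpos, hmem, hτb] with q e0 ⟨e1, e2, e3⟩ e4
  have hhpos := S.sol.pos _ e1 _ e2
  have hH : Hres β T h q.1 q.2.1 q.2.2 = (1 - τ q) ^ p * (w q)⁻¹ := by
    have h1τ : 0 < 1 - τ q := by linarith [e4.2.1]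
    simp only [Hres, hw]
    rw [Real.mul_rpow e0.le h1τ.le, Real.rpow_neg e0.le, inv_div]
    have e5 : q.1 ^ p ≠ 0 := (Real.rpow_pos_of_pos e0 _).ne'
    have e6 : (1 - τ q) ^ p ≠ 0 := (Real.rpow_pos_of_pos h1τ _).ne'
    field_simp
    exact mul_comm _ _
  rw [hH]
  simp only [ha, hi, hs, hτ, hξ, hp]
  ring

end Setup

/-! ### The rate of convergence of the rescaled nonlinearity -/

lemma isHeat_quadratic (A B c : ℝ) (I : Set ℝ) (O : Set (E N)) :
    IsHeat I O (fun t x => A + B * t + c * ‖x‖ ^ 2) (fun _ _ => B - 2 * N * c) := by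
  have hx : ∀ t : ℝ, (fun x : E N => A + B * t + c * ‖x‖ ^ 2) = fun x : E N =>
      (A + B * t) + c * ‖x‖ ^ 2 + 0 * inner ℝ (0 : E N) x + 0 * inner ℝ (0 : E N) x ^ 2 := by
    intro t; funext x; ring
  refine ⟨by fun_prop, fun t _ x _ => ?_, fun t _ x _ => ?_⟩
  · rw [hx]; exact (contDiff_quadratic _ _ _ _ _).contDiffAt
  · have h1 : Laplacian.laplacian (fun x : E N => A + B * t + c * ‖x‖ ^ 2) x = 2 * N * c := by
      rw [hx, laplacian_quadratic]; ring
    rw [h1]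
    have := (((hasDerivAt_id' t).const_mul B).const_add A).add_const (c * ‖x‖ ^ 2)
    exact this.congr_deriv (by ring)

/-- `κ⁻¹` is the value at `τ = 0` of the flat solution `((β+1)(1-τ))^{1/(β+1)}`; its slope there is
the coefficient of `τ` in `Setup.expansion_isBigO`. -/
lemma inv_kappa_rpow {β : ℝ} (hβ : 0 < β) :
    ((kappa β)⁻¹) ^ (-β) = 1 / (β + 1) * (kappa β)⁻¹ := by
  have h1 : (0 : ℝ) < β + 1 := by linarith
  have h2 : (kappa β)⁻¹ = (β + 1) ^ (1 / (β + 1)) := by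
    rw [kappa, Real.rpow_neg h1.le, inv_inv]
  rw [h2, ← Real.rpow_mul h1.le, one_div, ← Real.rpow_neg_one (β + 1), ← Real.rpow_add h1,
    Real.rpow_neg_one]
  congr 1
  field_simp
  ring

namespace Setup

variable {β : ℝ} {F χ₀ : ℝ → ℝ} {Ω : Set (E N)} {ψ Hs : E N → ℝ} {T t₀ : ℝ} {P : Params}
  {h : ℝ → E N → ℝ}

set_option maxHeartbeats 1000000 in
/-- Being trapped forces a rate on the deviation of the nonlinearity from the pure power. -/
theorem exists_rate_at_inv_kappa (S : Setup β F χ₀ Ω ψ Hs T t₀ P h) :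
    ∃ C, 0 ≤ C ∧ ∀ᶠ l in 𝓝[>] (0 : ℝ), |scaledErr β F l (kappa β)⁻¹| ≤
      C * (Real.log (-Real.log l) / -Real.log l) := by
  have hβ := S.β_pos
  have hκ := kappa_pos hβ
  obtain ⟨C₁, hC₁, hexp⟩ := S.expansion_isBigO.exists_pos
  rw [IsBigOWith, eventually_innerCyl] at hexp
  set r₀ := (kappa β)⁻¹ with hr₀
  have hr₀pos : 0 < r₀ := inv_pos.2 hκ
  set p := 1 / (β + 1) with hp
  have hppos : 0 < p := by positivity
  set k := -(1 / (β + 1)) * (β + 1) ^ (-(1 / (β + 1)) - 1) * ((β + 1) ^ 2 / (4 * β)) with hk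
  set c₀ := N * kappa β / (2 * β) with hc₀
  set κ2 := ((kappa β) ^ 2)⁻¹ with hκ2
  have hκ2pos : 0 < κ2 := by positivity
  obtain ⟨-, Lp, -, hLp0, -, hLp⟩ := exists_bound_lipschitz_of_smooth (F := fun v : ℝ => v ^ (-β))
    (contDiffOn_id.rpow_const_of_ne fun x hx => ne_of_gt hx) (c := r₀ / 2) (C := 2 * r₀)
    (by positivity)
  set C₃ := C₁ + p * r₀ + (|k| + |c₀|) * κ2 with hC₃
  have hC₃0 : 0 < C₃ := by positivity
  -- Three source errors of order `1/s`: freezing the pure power at `r₀`, freezing the deviation at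
  -- `r₀` (eventually Lipschitz with constant `1`), and the Laplacian of the quadratic term of the
  -- expansion.
  set C₂ := Lp * C₃ + C₃ + 2 * N * (|k| * κ2) with hC₂
  have hC₂0 : 0 ≤ C₂ := by positivity
  refine ⟨5 * C₁ + 2 * C₂, by positivity, ?_⟩
  have hlog : ∀ᶠ l in 𝓝[>] (0 : ℝ), Real.exp 1 + 4 * N + 2 * C₃ / r₀ ≤ -Real.log l :=
    tendsto_neg_log_zero.eventually_ge_atTop _
  have hl1 : ∀ᶠ l in 𝓝[>] (0 : ℝ), l < (T - t₀) / 2 :=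
    (tendsto_id.mono_right nhdsWithin_le_nhds : Tendsto id (𝓝[>] (0 : ℝ)) (𝓝 0)).eventually
      (gt_mem_nhds (by linarith [S.t₀_lt]))
  obtain ⟨ρ, hρ, hρΩ⟩ := Metric.isOpen_iff.1 S.isOpen 0 S.zero_mem
  have hl2 : ∀ᶠ l in 𝓝[>] (0 : ℝ), Real.sqrt l < ρ := by
    have := Real.continuous_sqrt.tendsto 0
    rw [Real.sqrt_zero] at this
    exact (this.mono_left nhdsWithin_le_nhds).eventually (gt_mem_nhds hρ)
  filter_upwards [hexp, hlog, hl1, hl2, self_mem_nhdsWithin,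
    S.nonlin.eventually_scaledErr_lipschitz hβ (c := r₀ / 2) (C := 2 * r₀) (ε := 1)
      (by positivity) one_pos] with l hexp hs hl1 hl2 hl0 hlip
  have hl0 : 0 < l := hl0
  set s := -Real.log l with hsdef
  have h4N : (0 : ℝ) ≤ 4 * N := by positivity
  have hC3r : 0 ≤ 2 * C₃ / r₀ := by positivity
  have he2 : (1 : ℝ) < Real.exp 1 := by
    have := Real.add_one_lt_exp (one_ne_zero (α := ℝ)); linarith
  have hs1 : 1 < s := by linarith
  have hs0 : 0 < s := by linarith
  have hlogs : 1 ≤ Real.log s := (Real.le_log_iff_exp_le hs0).2 (by linarith)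
  set m := Real.log s / s ^ 2 with hm
  have hm0 : 0 < m := by positivity
  have hsm : s⁻¹ * s⁻¹ ≤ m := by
    rw [hm, ← mul_inv, ← sq, ← one_div]
    exact div_le_div_of_nonneg_right hlogs (by positivity)
  have hms : m ≤ s⁻¹ := by
    rw [hm, sq, ← div_div, ← one_div]
    refine div_le_div_of_nonneg_right ?_ hs0.le
    rw [div_le_one hs0]
    have := Real.log_le_sub_one_of_pos hs0
    linarith
  have hsinv : 0 < s⁻¹ := inv_pos.2 hs0
  have hsinv1 : s⁻¹ ≤ 1 := inv_le_one_of_one_le₀ hs1.le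
  set G := scaledErr β F l r₀ with hG
  set I : Set ℝ := Icc (-s⁻¹) 0 with hI
  set B : Set (E N) := Metric.closedBall 0 1 with hB
  have hBn : ∀ x ∈ B, ‖x‖ ≤ 1 := fun x hx => by simpa [hB] using hx
  have hH : IsHeat I B (Hres β T h l) (fun τ ξ => -scaledF β F l (Hres β T h l τ ξ)) := by
    have := S.isHeat_rescaled hl0 (T - l) 0 (J := I) (O := B)
      (fun t ht => ⟨by nlinarith [ht.1], by nlinarith [ht.2]⟩)
      (fun x hx => hρΩ (by
        rw [zero_add, mem_ball_zero_iff, norm_smul, Real.norm_of_nonneg (Real.sqrt_nonneg _)]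
        exact (mul_le_of_le_one_right (Real.sqrt_nonneg _) (hBn x hx)).trans_lt hl2))
    simp only [zero_add] at this
    exact this
  set D : ℝ → E N → ℝ := fun τ ξ => Hres β T h l τ ξ - (r₀ - p * r₀ * τ -
    firstCoeff β ξ * κ2 * s⁻¹) with hD
  have hDb : ∀ τ ∈ I, ∀ ξ ∈ B, |D τ ξ| ≤ C₁ * m := by
    intro τ hτ ξ hξ
    have := hexp τ hτ ξ (hBn ξ hξ)
    rwa [Real.norm_eq_abs, Real.norm_of_nonneg hm0.le] at this
  have hHr : ∀ τ ∈ I, ∀ ξ ∈ B, |Hres β T h l τ ξ - r₀| ≤ C₃ * s⁻¹ := by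
    intro τ hτ ξ hξ
    have h1 := hDb τ hτ ξ hξ
    have h2 : |τ| ≤ s⁻¹ := by rw [abs_of_nonpos hτ.2]; linarith [hτ.1]
    have h3 : |firstCoeff β ξ| ≤ |k| + |c₀| := by
      rw [firstCoeff, ← hk, ← hc₀]
      refine (abs_add_le _ _).trans (add_le_add ?_ le_rfl)
      rw [abs_mul, abs_of_nonneg (sq_nonneg ‖ξ‖)]
      exact mul_le_of_le_one_right (abs_nonneg _) (pow_le_one₀ (norm_nonneg _) (hBn ξ hξ))
    have h4 : Hres β T h l τ ξ - r₀ = D τ ξ - p * r₀ * τ - firstCoeff β ξ * κ2 * s⁻¹ := by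
      simp only [hD]; ring
    rw [h4]
    have h5 : |p * r₀ * τ| ≤ p * r₀ * s⁻¹ := by
      rw [abs_mul, abs_of_pos (by positivity : 0 < p * r₀)]
      exact mul_le_mul_of_nonneg_left h2 (by positivity)
    have h6 : |firstCoeff β ξ * κ2 * s⁻¹| ≤ (|k| + |c₀|) * κ2 * s⁻¹ := by
      rw [abs_mul, abs_mul, abs_of_pos hκ2pos, abs_of_pos hsinv]
      gcongr
    have h7 : C₁ * m ≤ C₁ * s⁻¹ := mul_le_mul_of_nonneg_left hms hC₁.le
    refine (abs_sub _ _).trans ((add_le_add (abs_sub _ _) h6).trans ?_)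
    rw [hC₃]; linarith
  have hHmem : ∀ τ ∈ I, ∀ ξ ∈ B, Hres β T h l τ ξ ∈ Icc (r₀ / 2) (2 * r₀) := by
    intro τ hτ ξ hξ
    have h1 := abs_le.1 (hHr τ hτ ξ hξ)
    have h2 : C₃ * s⁻¹ ≤ r₀ / 2 := by
      rw [← div_eq_mul_inv, div_le_iff₀ hs0]
      have h3 : 2 * C₃ / r₀ ≤ s := by linarith [Real.exp_pos 1]
      rw [div_le_iff₀ hr₀pos] at h3
      linarith
    exact ⟨by linarith [h1.1], by linarith [h1.2]⟩
  have hr₀mem : r₀ ∈ Icc (r₀ / 2) (2 * r₀) := ⟨by linarith, by linarith⟩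
  -- the comparison function
  have hQ := isHeat_quadratic (N := N) (r₀ - c₀ * κ2 * s⁻¹ - G * s⁻¹) (-(p * r₀) - G)
    (-(k * κ2 * s⁻¹)) I B
  have hW := hH.sub hQ
  have hWD : ∀ τ ξ, Hres β T h l τ ξ - (r₀ - c₀ * κ2 * s⁻¹ - G * s⁻¹ + (-(p * r₀) - G) * τ +
      -(k * κ2 * s⁻¹) * ‖ξ‖ ^ 2) = D τ ξ + G * (τ + s⁻¹) := by
    intro τ ξ
    simp only [hD, firstCoeff, ← hk, ← hc₀]; ring
  have key := hW.abs_le_center (R := 1) (L := 0) (ε₁ := C₂ * s⁻¹) (ε₂ := C₁ * m)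
    (M := C₁ * m + |G| * s⁻¹) one_pos le_rfl (by positivity) (by positivity) (by positivity)
    ?_ ?_ ?_ 0 ⟨by linarith, le_rfl⟩
  · rw [hWD] at key
    have h0 := hDb 0 ⟨by linarith, le_rfl⟩ 0 (by simp [hB])
    simp only [zero_mul, Real.exp_zero, one_mul, sub_neg_eq_add, zero_add, one_pow,
      div_one] at key
    have h1 : |G| * s⁻¹ ≤ |D 0 0 + G * s⁻¹| + |D 0 0| := by
      have : |G| * s⁻¹ = |(D 0 0 + G * s⁻¹) - D 0 0| := by
        rw [add_sub_cancel_left, abs_mul, abs_of_pos hsinv]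
      rw [this]; exact abs_sub _ _
    -- The lateral contribution contains `|G|/s` itself; the shortness `1/s` of the window gives it
    -- a factor at most `1/2`, so it is absorbed on the left.
    have h2 : 2 * N * s⁻¹ ≤ 1 / 2 := by
      rw [← div_eq_mul_inv, div_le_iff₀ hs0]; linarith [Real.exp_pos 1]
    have h3 : (C₁ * m + |G| * s⁻¹) * (2 * N * s⁻¹) ≤ (C₁ * m + |G| * s⁻¹) * (1 / 2) :=
      mul_le_mul_of_nonneg_left h2 (by positivity)
    have h4 : C₂ * s⁻¹ * s⁻¹ ≤ C₂ * m := by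
      rw [mul_assoc]; exact mul_le_mul_of_nonneg_left hsm hC₂0
    have h5 : |G| * s⁻¹ ≤ (5 * C₁ + 2 * C₂) * m := by linarith
    calc |G| = |G| * s⁻¹ * s := by field_simp
      _ ≤ (5 * C₁ + 2 * C₂) * m * s := mul_le_mul_of_nonneg_right h5 hs0.le
      _ = _ := by rw [hm]; field_simp
  · intro τ hτ ξ hξ
    have h1 := hHr τ hτ ξ hξ
    have h2 := hHmem τ hτ ξ hξ
    have h3 := hLp _ h2 _ hr₀mem
    have h4 := hlip _ h2 _ hr₀mem
    rw [one_mul] at h4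
    rw [zero_mul, zero_add]
    set H := Hres β T h l τ ξ
    have h5 : -scaledF β F l H - (-(p * r₀) - G - 2 * N * -(k * κ2 * s⁻¹)) =
        -(H ^ (-β) - r₀ ^ (-β)) - (scaledErr β F l H - scaledErr β F l r₀) -
          2 * N * (k * κ2 * s⁻¹) := by
      rw [hr₀, inv_kappa_rpow hβ, ← hr₀, ← hp, scaledErr, ← hG]; ring
    rw [h5]
    have h6 : |2 * N * (k * κ2 * s⁻¹)| = 2 * N * (|k| * κ2) * s⁻¹ := by
      rw [abs_mul, abs_of_nonneg (by positivity : (0 : ℝ) ≤ 2 * N), abs_mul, abs_mul,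
        abs_of_pos hκ2pos, abs_of_pos hsinv]; ring
    refine (abs_sub _ _).trans ((add_le_add (abs_sub _ _) h6.le).trans ?_)
    rw [abs_neg, hC₂]
    have h7 : Lp * |H - r₀| ≤ Lp * (C₃ * s⁻¹) := mul_le_mul_of_nonneg_left h1 hLp0
    linarith
  · intro τ hτ ξ hξ
    rw [hWD]
    refine (abs_add_le _ _).trans (add_le_add (hDb τ hτ ξ hξ) ?_)
    rw [abs_mul, abs_of_nonneg (by linarith [hτ.1] : 0 ≤ τ + s⁻¹)]
    exact mul_le_mul_of_nonneg_left (by linarith [hτ.2]) (abs_nonneg _)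
  · intro ξ hξ
    rw [hWD, neg_add_cancel, mul_zero, add_zero]
    exact hDb _ ⟨le_rfl, by linarith⟩ ξ hξ

/-- The deviation of the rescaled nonlinearity from the pure power, uniformly on compact sets. -/
theorem exists_rate (S : Setup β F χ₀ Ω ψ Hs T t₀ P h) {c c' : ℝ} (hc : 0 < c) :
    ∃ C, 0 ≤ C ∧ ∀ᶠ l in 𝓝[>] (0 : ℝ), ∀ r ∈ Icc c c', |scaledErr β F l r| ≤
      C * (Real.log (-Real.log l) / -Real.log l) := by
  have hβ := S.β_pos
  obtain ⟨C, hC, hrate⟩ := S.exists_rate_at_inv_kappa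
  set r₀ := (kappa β)⁻¹ with hr₀
  have hr₀pos : 0 < r₀ := inv_pos.2 (kappa_pos hβ)
  set Q := (β + 1) * (|Real.log (c / r₀)| + |Real.log (c' / r₀)|) with hQ
  have hQ0 : 0 ≤ Q := by positivity
  obtain ⟨l₀, hl₀, hl₀'⟩ := mem_nhdsGT_iff_exists_Ioo_subset.1 hrate
  have hl₀ : 0 < l₀ := hl₀
  refine ⟨(r₀ / c) ^ β * (C * 4), by positivity, ?_⟩
  have hlog : ∀ᶠ l in 𝓝[>] (0 : ℝ), 2 * Q + 2 ≤ -Real.log l :=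
    tendsto_neg_log_zero.eventually_ge_atTop _
  have hl1 : ∀ᶠ l in 𝓝[>] (0 : ℝ), l < l₀ / Real.exp Q :=
    (tendsto_id.mono_right nhdsWithin_le_nhds : Tendsto id (𝓝[>] (0 : ℝ)) (𝓝 0)).eventually
      (gt_mem_nhds (by positivity))
  filter_upwards [hlog, hl1, self_mem_nhdsWithin] with l hs hl1 hl0 r hr
  have hl0 : 0 < l := hl0
  have hrpos : 0 < r := hc.trans_le hr.1
  have hq : 0 < r / r₀ := by positivity
  have hlogq : |(β + 1) * Real.log (r / r₀)| ≤ Q := by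
    rw [abs_mul, abs_of_pos (by linarith : 0 < β + 1), hQ]
    refine mul_le_mul_of_nonneg_left ?_ (by linarith)
    have h1 : Real.log (c / r₀) ≤ Real.log (r / r₀) :=
      Real.log_le_log (by positivity) (div_le_div_of_nonneg_right hr.1 hr₀pos.le)
    have h2 : Real.log (r / r₀) ≤ Real.log (c' / r₀) :=
      Real.log_le_log (by positivity) (div_le_div_of_nonneg_right hr.2 hr₀pos.le)
    rw [abs_le]
    constructor
    · linarith [neg_abs_le (Real.log (c / r₀)), abs_nonneg (Real.log (c' / r₀))]
    · linarith [le_abs_self (Real.log (c' / r₀)), abs_nonneg (Real.log (c / r₀))]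
  -- The scale at which the value `r₀` represents the same argument of `F` as `r` does at scale `l`.
  -- Its logarithm differs from `log l` by at most `Q`, so the rate changes only by a constant.
  set l' := l * (r / r₀) ^ (β + 1) with hl'
  have hlogl' : Real.log l' = Real.log l + (β + 1) * Real.log (r / r₀) := by
    rw [hl', Real.log_mul hl0.ne' (Real.rpow_pos_of_pos hq _).ne', Real.log_rpow hq]
  have hl'pos : 0 < l' := mul_pos hl0 (Real.rpow_pos_of_pos hq _)
  have hl'lt : l' < l₀ := by
    rw [lt_div_iff₀ (Real.exp_pos _)] at hl1
    refine lt_of_le_of_lt (mul_le_mul_of_nonneg_left ?_ hl0.le) hl1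
    rw [← Real.log_le_iff_le_exp (Real.rpow_pos_of_pos hq _), Real.log_rpow hq]
    exact (le_abs_self _).trans hlogq
  have h1 := hl₀' ⟨hl'pos, hl'lt⟩
  simp only [mem_ofPred_eq] at h1
  rw [scaledErr_change hβ hl0 hrpos hr₀pos, abs_mul,
    abs_of_nonneg (Real.rpow_nonneg (by positivity) _), mul_assoc]
  set s := -Real.log l with hsd
  have hs' : -Real.log l' = s - (β + 1) * Real.log (r / r₀) := by rw [hlogl', hsd]; ring
  have hb := abs_le.1 hlogq
  have hs1 : 2 ≤ s := by linarith
  refine mul_le_mul ?_ (h1.trans ?_) (abs_nonneg _) (by positivity)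
  · exact Real.rpow_le_rpow (by positivity)
      (div_le_div_of_nonneg_left hr₀pos.le hc hr.1) hβ.le
  · rw [mul_assoc]
    refine mul_le_mul_of_nonneg_left ?_ hC
    have e1 : s / 2 ≤ -Real.log l' := by rw [hs']; linarith [hb.2]
    have e2 : -Real.log l' ≤ 2 * s := by rw [hs']; linarith [hb.1]
    have e3 : Real.log (-Real.log l') ≤ 2 * Real.log s := by
      refine (Real.log_le_log (by linarith) e2).trans ?_
      rw [Real.log_mul two_ne_zero (by linarith)]
      have := Real.log_le_log two_pos hs1
      linarith
    have e4 : 0 ≤ Real.log s := Real.log_nonneg (by linarith)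
    calc Real.log (-Real.log l') / -Real.log l' ≤ 2 * Real.log s / (s / 2) :=
          div_le_div₀ (by linarith) e3 (by linarith) e1
      _ = 4 * (Real.log s / s) := by
          have : s ≠ 0 := by linarith
          field_simp; ring

end Setup

/-! ### The intermediate gradient profile -/

/-- The base of the approximate solution `[(β+1)(1-τ) + b|ξ+y|²/s]^{1/(β+1)}`. -/
def profBase (β s : ℝ) (y : E N) (τ : ℝ) (ξ : E N) : ℝ :=
  (β + 1) * (1 - τ) + (β + 1) ^ 2 / (4 * β) / s * ‖ξ + y‖ ^ 2

lemma one_le_profBase {β s τ : ℝ} (hβ : 0 < β) (hs : 0 < s) (hτ : τ ≤ 0) (y ξ : E N) :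
    1 ≤ profBase β s y τ ξ := by
  have h1 : 0 ≤ (β + 1) ^ 2 / (4 * β) / s * ‖ξ + y‖ ^ 2 := by positivity
  rw [profBase]; nlinarith

lemma norm_add_sq_le {K s : ℝ} {y ξ : E N} (hs : 1 ≤ s) (hy : ‖y‖ ≤ K * Real.sqrt s)
    (hξ : ‖ξ‖ ≤ 1) : ‖ξ + y‖ ^ 2 ≤ (K + 1) ^ 2 * s := by
  have h1 : 1 ≤ Real.sqrt s := Real.one_le_sqrt.2 hs
  have h2 : ‖ξ + y‖ ≤ (K + 1) * Real.sqrt s := by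
    have := norm_add_le ξ y; linarith
  calc ‖ξ + y‖ ^ 2 ≤ ((K + 1) * Real.sqrt s) ^ 2 := pow_le_pow_left₀ (norm_nonneg _) h2 2
    _ = (K + 1) ^ 2 * s := by rw [mul_pow, Real.sq_sqrt (by linarith)]

lemma profBase_le {β s τ K : ℝ} {y ξ : E N} (hβ : 0 < β) (hs : 1 ≤ s) (hτ : -1 ≤ τ)
    (hy : ‖y‖ ≤ K * Real.sqrt s) (hξ : ‖ξ‖ ≤ 1) :
    profBase β s y τ ξ ≤ 2 * (β + 1) + (β + 1) ^ 2 / (4 * β) * (K + 1) ^ 2 := by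
  have h1 := norm_add_sq_le hs hy hξ
  have hb := coeff_pos hβ
  have h2 : (β + 1) ^ 2 / (4 * β) / s * ‖ξ + y‖ ^ 2 ≤
      (β + 1) ^ 2 / (4 * β) / s * ((K + 1) ^ 2 * s) :=
    mul_le_mul_of_nonneg_left h1 (by positivity)
  have h3 : (β + 1) ^ 2 / (4 * β) / s * ((K + 1) ^ 2 * s) =
      (β + 1) ^ 2 / (4 * β) * (K + 1) ^ 2 := by
    have : s ≠ 0 := by linarith
    field_simp
  rw [profBase]
  nlinarith

lemma contDiffAt_profBase_rpow {β s τ : ℝ} (hβ : 0 < β) (hs : 0 < s) (hτ : τ ≤ 0) (y ξ : E N)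
    (p : ℝ) : ContDiffAt ℝ 2 (fun ξ => profBase β s y τ ξ ^ p) ξ := by
  have h1 : ContDiffAt ℝ 2 (profBase β s y τ) ξ :=
    contDiffAt_const.add (contDiff_const_mul_norm_sq _ _).contDiffAt
  exact h1.rpow_const_of_ne (by linarith [one_le_profBase hβ hs hτ y ξ])

/-- For each fixed `ξ` this power solves the pure-power ordinary differential equation in `τ`
exactly, so its Laplacian is the whole residual. -/
lemma isHeat_profBase {β s : ℝ} (hβ : 0 < β) (hs : 0 < s) (y : E N) (O : Set (E N)) :
    IsHeat (Icc (-1) 0) O (fun τ ξ => profBase β s y τ ξ ^ (1 / (β + 1)))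
      (fun τ ξ => -(profBase β s y τ ξ ^ (1 / (β + 1))) ^ (-β) -
        Laplacian.laplacian (fun ξ => profBase β s y τ ξ ^ (1 / (β + 1))) ξ) := by
  refine ⟨?_, fun τ hτ ξ _ => contDiffAt_profBase_rpow hβ hs hτ.2 y ξ _, fun τ hτ ξ _ => ?_⟩
  · refine ContinuousOn.rpow_const ?_ ?_
    · unfold profBase; fun_prop
    · rintro ⟨τ, ξ⟩ ⟨hτ, -⟩
      exact Or.inl (by linarith [one_le_profBase hβ hs hτ.2 y ξ])
  · have h1 := one_le_profBase hβ hs hτ.2 y ξ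
    have h2 : HasDerivAt (fun τ => profBase β s y τ ξ) (-(β + 1)) τ := by
      have := ((((hasDerivAt_id' τ).const_sub 1).const_mul (β + 1)).add_const
        ((β + 1) ^ 2 / (4 * β) / s * ‖ξ + y‖ ^ 2))
      exact this.congr_deriv (by ring)
    refine (h2.rpow_const (p := 1 / (β + 1)) (Or.inl (by linarith))).congr_deriv ?_
    rw [← Real.rpow_mul (by linarith)]
    have h3 : 1 / (β + 1) * -β = 1 / (β + 1) - 1 := by field_simp; ring
    rw [h3]
    have h4 : β + 1 ≠ 0 := by linarith
    field_simp
    ring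

/-- The base depends on `|ξ + y|²/s`: differentiating twice yields `1/s` or `|ξ + y|²/s²`, and `|ξ +
y|² ≤ (K+1)² s`. The base is at least `1`, so its powers with negative exponents are harmless. -/
lemma abs_laplacian_profBase_le {β s τ K : ℝ} {y ξ : E N} (hβ : 0 < β) (hs : 1 ≤ s)
    (hτ : τ ≤ 0) (hy : ‖y‖ ≤ K * Real.sqrt s) (hξ : ‖ξ‖ ≤ 1) :
    |Laplacian.laplacian (fun ξ => profBase β s y τ ξ ^ (1 / (β + 1))) ξ| ≤
      (4 * ((β + 1) ^ 2 / (4 * β)) ^ 2 * (K + 1) ^ 2 + 2 * N * ((β + 1) ^ 2 / (4 * β))) * s⁻¹ := by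
  set b := (β + 1) ^ 2 / (4 * β) with hb
  have hbpos : 0 < b := coeff_pos hβ
  set p := 1 / (β + 1) with hp
  have hppos : 0 < p := by positivity
  have hp1 : p < 1 := by rw [hp, div_lt_one (by linarith)]; linarith
  have hs0 : 0 < s := by linarith
  have hP := one_le_profBase hβ hs0 hτ y ξ
  set U := ‖ξ + y‖ ^ 2 with hU
  have hPU : profBase β s y τ ξ = (β + 1) * (1 - τ) + b / s * U := rfl
  rw [hPU] at hP
  have hlin : ∀ u : ℝ, HasDerivAt (fun u : ℝ => (β + 1) * (1 - τ) + b / s * u) (b / s) u := by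
    intro u
    have := ((hasDerivAt_id' u).const_mul (b / s)).const_add ((β + 1) * (1 - τ))
    exact this.congr_deriv (by ring)
  have hev : ∀ᶠ u in 𝓝 U, 0 < (β + 1) * (1 - τ) + b / s * u := by
    have := (hlin U).continuousAt.tendsto
    exact this.eventually (lt_mem_nhds (by linarith))
  have hlap := laplacian_comp_norm_sq (φ := fun u => ((β + 1) * (1 - τ) + b / s * u) ^ p)
    (φ' := fun u => b / s * p * ((β + 1) * (1 - τ) + b / s * u) ^ (p - 1))
    (φ'' := b / s * p * (b / s * (p - 1) * ((β + 1) * (1 - τ) + b / s * U) ^ (p - 1 - 1))) y ξ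
    (by
      refine ContDiffAt.rpow_const_of_ne ?_ (by linarith)
      fun_prop)
    (by
      filter_upwards [hev] with u hu
      exact (hlin u).rpow_const (Or.inl hu.ne'))
    (((hlin U).rpow_const (Or.inl (by linarith))).const_mul (b / s * p))
  have hfun : (fun ξ : E N => profBase β s y τ ξ ^ p) =
      fun ξ => ((β + 1) * (1 - τ) + b / s * ‖ξ + y‖ ^ 2) ^ p := rfl
  rw [hfun, hlap, ← hU]
  set Q := (β + 1) * (1 - τ) + b / s * U
  have hQ1 : Q ^ (p - 1) ≤ 1 := Real.rpow_le_one_of_one_le_of_nonpos hP (by linarith)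
  have hQ2 : Q ^ (p - 1 - 1) ≤ 1 := Real.rpow_le_one_of_one_le_of_nonpos hP (by linarith)
  have hQ1' : 0 ≤ Q ^ (p - 1) := Real.rpow_nonneg (by linarith) _
  have hQ2' : 0 ≤ Q ^ (p - 1 - 1) := Real.rpow_nonneg (by linarith) _
  have hUb : U ≤ (K + 1) ^ 2 * s := norm_add_sq_le hs hy hξ
  have hU0 : 0 ≤ U := by positivity
  have hbs : 0 < b / s := by positivity
  have e1 : |4 * (b / s * p * (b / s * (p - 1) * Q ^ (p - 1 - 1))) * U| ≤
      4 * b ^ 2 * (K + 1) ^ 2 * s⁻¹ := by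
    have h1 : 4 * (b / s * p * (b / s * (p - 1) * Q ^ (p - 1 - 1))) * U =
        -(4 * (b / s) ^ 2 * U * ((p * (1 - p)) * Q ^ (p - 1 - 1))) := by ring
    have h2 : p * (1 - p) * Q ^ (p - 1 - 1) ≤ 1 :=
      mul_le_one₀ (by nlinarith) hQ2' hQ2
    have h3 : 0 ≤ p * (1 - p) * Q ^ (p - 1 - 1) :=
      mul_nonneg (mul_nonneg hppos.le (by linarith)) hQ2'
    rw [h1, abs_neg, abs_of_nonneg (mul_nonneg (by positivity) h3)]
    calc 4 * (b / s) ^ 2 * U * (p * (1 - p) * Q ^ (p - 1 - 1)) ≤ 4 * (b / s) ^ 2 * U :=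
          mul_le_of_le_one_right (by positivity) h2
      _ ≤ 4 * (b / s) ^ 2 * ((K + 1) ^ 2 * s) := mul_le_mul_of_nonneg_left hUb (by positivity)
      _ = _ := by field_simp
  have e2 : |2 * N * (b / s * p * Q ^ (p - 1))| ≤ 2 * N * b * s⁻¹ := by
    have h2 : p * Q ^ (p - 1) ≤ 1 := mul_le_one₀ hp1.le hQ1' hQ1
    rw [abs_of_nonneg (by positivity)]
    calc 2 * N * (b / s * p * Q ^ (p - 1)) = 2 * N * (b / s) * (p * Q ^ (p - 1)) := by ring
      _ ≤ 2 * N * (b / s) := mul_le_of_le_one_right (by positivity) h2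
      _ = _ := by rw [div_eq_mul_inv]; ring
  refine (abs_add_le _ _).trans ((add_le_add e1 e2).trans (le_of_eq ?_))
  ring

lemma differentiableAt_PhiHat {β : ℝ} (hβ : 0 < β) (z : E N) :
    DifferentiableAt ℝ (PhiHat β : E N → ℝ) z := by
  have hb := coeff_pos hβ
  have h1 : ContDiffAt ℝ 2 (fun z : E N => β + 1 + (β + 1) ^ 2 / (4 * β) * ‖z‖ ^ 2) z := by
    have := (contDiff_const_mul_norm_sq (N := N) ((β + 1) ^ 2 / (4 * β)) 0).contDiffAt (x := z)
    simp only [add_zero] at this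
    exact contDiffAt_const.add this
  exact (h1.rpow_const_of_ne (p := 1 / (β + 1)) (by positivity)).differentiableAt (by simp)

lemma gradient_const_mul_comp_affine {f : E N → ℝ} (c r : ℝ) (a x : E N)
    (hf : DifferentiableAt ℝ f (a + r • x)) :
    gradient (fun ξ => c * f (a + r • ξ)) x = (c * r) • gradient f (a + r • x) := by
  have h1 : HasFDerivAt (fun ξ : E N => a + r • ξ) (r • ContinuousLinearMap.id ℝ (E N)) x :=
    ((hasFDerivAt_id x).const_smul r).const_add a
  have h2 := (hf.hasFDerivAt.comp x h1).const_mul c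
  have h3 : fderiv ℝ (fun ξ => c * f (a + r • ξ)) x = (c * r) • fderiv ℝ f (a + r • x) := by
    refine HasFDerivAt.fderiv (h2.congr_fderiv ?_)
    ext v
    simp [mul_assoc]
  rw [gradient, h3, gradient, map_smul]

namespace Setup

variable {β : ℝ} {F χ₀ : ℝ → ℝ} {Ω : Set (E N)} {ψ Hs : E N → ℝ} {T t₀ : ℝ} {P : Params}
  {h : ℝ → E N → ℝ}

/-- The domain of the rescaled solution near the extinction time. -/
lemma eventually_mem_domain (S : Setup β F χ₀ Ω ψ Hs T t₀ P h) (K : ℝ) :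
    ∀ᶠ l in 𝓝[>] (0 : ℝ), ∀ x₁ : E N, ‖x₁‖ ≤ K * Real.sqrt (l * -Real.log l) →
      ∀ τ ∈ Icc (-1 : ℝ) 0, ∀ ξ : E N, ‖ξ‖ ≤ 1 →
        T - l + l * τ ∈ Ioo t₀ T ∧ x₁ + Real.sqrt l • ξ ∈ Ω := by
  obtain ⟨ρ, hρ, hρΩ⟩ := Metric.isOpen_iff.1 S.isOpen 0 S.zero_mem
  have h1 : ∀ᶠ l in 𝓝[>] (0 : ℝ), l < (T - t₀) / 2 :=
    (tendsto_id.mono_right nhdsWithin_le_nhds : Tendsto id (𝓝[>] (0 : ℝ)) (𝓝 0)).eventually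
      (gt_mem_nhds (by linarith [S.t₀_lt]))
  have h2 : ∀ᶠ l in 𝓝[>] (0 : ℝ), K * Real.sqrt (l * -Real.log l) + Real.sqrt l < ρ := by
    have hc : Continuous fun l : ℝ => K * Real.sqrt (-(l * Real.log l)) + Real.sqrt l :=
      (continuous_const.mul (Real.continuous_sqrt.comp Real.continuous_mul_log.neg)).add
        Real.continuous_sqrt
    have := hc.tendsto 0
    simp only [zero_mul, neg_zero, Real.sqrt_zero, mul_zero, add_zero] at this
    have h3 : ∀ᶠ l in 𝓝[>] (0 : ℝ), K * Real.sqrt (-(l * Real.log l)) + Real.sqrt l < ρ :=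
      (this.mono_left nhdsWithin_le_nhds).eventually (gt_mem_nhds hρ)
    filter_upwards [h3] with l hl
    rwa [mul_neg]
  filter_upwards [h1, h2, self_mem_nhdsWithin] with l h1 h2 hl x₁ hx₁ τ hτ ξ hξ
  have hl : 0 < l := hl
  refine ⟨⟨by nlinarith [hτ.1], by nlinarith [hτ.2]⟩, hρΩ ?_⟩
  rw [mem_ball_zero_iff]
  refine (norm_add_le _ _).trans_lt ?_
  rw [norm_smul, Real.norm_of_nonneg (Real.sqrt_nonneg _)]
  have := mul_le_of_le_one_right (Real.sqrt_nonneg l) hξ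
  linarith

set_option maxHeartbeats 1000000 in
/-- The profile in the variables rescaled around `(x₁, T - l)`. -/
theorem exists_rescaled_profile (S : Setup β F χ₀ Ω ψ Hs T t₀ P h) {K : ℝ} (hK : 0 < K) :
    ∃ C, 0 ≤ C ∧ ∀ᶠ l in 𝓝[>] (0 : ℝ), ∀ x₁ : E N, ‖x₁‖ ≤ K * Real.sqrt (l * -Real.log l) →
      ∀ τ ∈ Icc (-1 : ℝ) 0, ∀ ξ : E N, ‖ξ‖ ≤ 1 →
        |l ^ (-(1 / (β + 1))) * h (T - l + l * τ) (x₁ + Real.sqrt l • ξ) -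
          profBase β (-Real.log l) ((Real.sqrt l)⁻¹ • x₁) τ ξ ^ (1 / (β + 1))| ≤
          C * (Real.log (-Real.log l) / -Real.log l) := by
  have hβ := S.β_pos
  have hb := coeff_pos hβ
  obtain ⟨C₀, hC₀, hprof⟩ := S.exists_profile_bound
  set p := 1 / (β + 1) with hp
  have hppos : 0 < p := by positivity
  set b := (β + 1) ^ 2 / (4 * β) with hbd
  set P₂ := 2 * (β + 1) + 2 * b * (K + 1) ^ 2 with hP₂
  have hP₂pos : 0 < P₂ := by positivity
  -- A uniform lower bound for `Φ` in this region, which makes passing from `1/h` to `h` Lipschitz.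
  set μ := P₂ ^ (-p) with hμ
  have hμpos : 0 < μ := Real.rpow_pos_of_pos hP₂pos _
  obtain ⟨-, Lp, -, hLp0, -, hLp⟩ := exists_bound_lipschitz_of_smooth (F := fun v : ℝ => v ^ p)
    (contDiffOn_id.rpow_const_of_ne fun x hx => ne_of_gt hx) (c := 1) (C := P₂) one_pos
  set C₁ := C₀ * 2 with hC₁
  refine ⟨2 * (C₁ / (μ / 2 * μ)) + Lp * (2 * b * (K + 1) ^ 2), by positivity, ?_⟩
  have hrate : Tendsto (fun l => C₁ * (Real.log (-Real.log l) / -Real.log l)) (𝓝[>] (0 : ℝ))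
      (𝓝 0) := by
    simpa using (tendsto_log_div_self.comp tendsto_neg_log_zero).const_mul C₁
  filter_upwards [S.eventually_mem_domain K, hrate.eventually (gt_mem_nhds (half_pos hμpos)),
    tendsto_neg_log_zero.eventually_ge_atTop (Real.exp 1 + 2), self_mem_nhdsWithin]
    with l hdom hsmall hs hl x₁ hx₁ τ hτ ξ hξ
  have hl : 0 < l := hl
  obtain ⟨ht, hx⟩ := hdom x₁ hx₁ τ hτ ξ hξ
  set s := -Real.log l with hsd
  have he := Real.exp_pos 1
  have hs2 : 2 ≤ s := by linarith
  have hlogs : 1 ≤ Real.log s := (Real.le_log_iff_exp_le (by linarith)).2 (by linarith)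
  have hsq : 0 < Real.sqrt l := Real.sqrt_pos.2 hl
  set y := (Real.sqrt l)⁻¹ • x₁ with hy
  have hyn : ‖y‖ ≤ K * Real.sqrt s := by
    rw [hy, norm_smul, norm_inv, Real.norm_of_nonneg hsq.le, inv_mul_le_iff₀ hsq]
    rw [Real.sqrt_mul hl.le] at hx₁
    linarith
  have hxy : x₁ + Real.sqrt l • ξ = Real.sqrt l • (ξ + y) := by
    rw [smul_add, hy, smul_inv_smul₀ hsq.ne', add_comm]
  set t := T - l + l * τ with htd
  have hTt : T - t = l * (1 - τ) := by rw [htd]; ring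
  have h1τ : 1 ≤ 1 - τ := by linarith [hτ.2]
  have h2τ : 1 - τ ≤ 2 := by linarith [hτ.1]
  set s' := -Real.log (T - t) with hs'
  have hs's : s' = s - Real.log (1 - τ) := by
    rw [hs', hTt, Real.log_mul hl.ne' (by linarith)]; ring
  have hlogτ0 : 0 ≤ Real.log (1 - τ) := Real.log_nonneg h1τ
  have hlogτ1 : Real.log (1 - τ) ≤ 1 := by
    have := Real.log_le_sub_one_of_pos (by linarith : 0 < 1 - τ); linarith
  have hs'1 : s / 2 ≤ s' := by linarith
  have hs'2 : s' ≤ s := by linarith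
  have hs'0 : 0 < s' := by linarith
  have h1 := hprof t ⟨ht.1.le, ht.2⟩ _ hx
  rw [← hs', hTt] at h1
  have hmono : Real.log s' / s' ≤ 2 * (Real.log s / s) := by
    calc Real.log s' / s' ≤ Real.log s / (s / 2) :=
          div_le_div₀ (by linarith) (Real.log_le_log hs'0 hs'2) (by linarith) hs'1
      _ = 2 * (Real.log s / s) := by field_simp
  set hh := h t (x₁ + Real.sqrt l • ξ) with hhd
  have hhpos : 0 < hh := S.sol.pos t ⟨ht.1.le, ht.2⟩ _ hx
  set w := (l * (1 - τ)) ^ p / hh with hw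
  set U := ‖ξ + y‖ ^ 2 with hU
  have hU0 : 0 ≤ U := by positivity
  have hUb : U ≤ (K + 1) ^ 2 * s := norm_add_sq_le (by linarith) hyn hξ
  have hz : ‖zvar T t (x₁ + Real.sqrt l • ξ)‖ ^ 2 = U / ((1 - τ) * s') := by
    have hle : T - t < Real.exp (-1) := S.sub_lt ⟨ht.1.le, ht.2⟩
    rw [zvar, scale, abs_log_eq_neg_log (by rw [hTt]; positivity) hle, ← hs', hTt, hxy, norm_smul,
      norm_smul, norm_inv, Real.norm_of_nonneg (Real.sqrt_nonneg _), Real.norm_of_nonneg hsq.le,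
      mul_pow, mul_pow, inv_pow, Real.sq_sqrt (by positivity), Real.sq_sqrt hl.le, ← hU]
    field_simp
  -- The base of the profile with the true similarity time `s'`. The error splits in two: inverting
  -- the profile bound (`e1`), and replacing `s'` by `s` (`e2`), which costs `O(1/s)`.
  set P' := (β + 1) * (1 - τ) + b / s' * U with hP'
  have hPhi : Phi β (zvar T t (x₁ + Real.sqrt l • ξ)) = (P' / (1 - τ)) ^ (-p) := by
    rw [Phi, hz, ← hbd]
    congr 1
    rw [hP']; field_simp
  set Φ := Phi β (zvar T t (x₁ + Real.sqrt l • ξ)) with hΦ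
  have hP'1 : 1 ≤ P' := by
    have : 0 ≤ b / s' * U := by positivity
    rw [hP']; nlinarith
  have hP'2 : P' ≤ P₂ := by
    have h2 : b / s' * U ≤ b / (s / 2) * ((K + 1) ^ 2 * s) :=
      mul_le_mul (div_le_div_of_nonneg_left hb.le (by linarith) hs'1) hUb hU0 (by positivity)
    have h3 : b / (s / 2) * ((K + 1) ^ 2 * s) = 2 * b * (K + 1) ^ 2 := by field_simp
    rw [hP', hP₂]; nlinarith
  have hΦμ : μ ≤ Φ := by
    rw [hPhi, hμ]
    refine Real.rpow_le_rpow_of_nonpos (by positivity) ?_ (by linarith)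
    exact (div_le_self (by linarith) h1τ).trans hP'2
  have hwΦ : |w - Φ| ≤ C₁ * (Real.log s / s) := by
    refine h1.trans ?_
    rw [hC₁, mul_assoc]
    exact mul_le_mul_of_nonneg_left hmono hC₀
  have hwμ : μ / 2 ≤ w := by linarith [(abs_le.1 hwΦ).1]
  have hHw : l ^ (-p) * hh = (1 - τ) ^ p * w⁻¹ := by
    rw [hw, Real.mul_rpow hl.le (by linarith), Real.rpow_neg hl.le, inv_div]
    have e5 : l ^ p ≠ 0 := (Real.rpow_pos_of_pos hl _).ne'
    have e6 : (1 - τ) ^ p ≠ 0 := (Real.rpow_pos_of_pos (by linarith) _).ne'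
    field_simp
  have hPw : P' ^ p = (1 - τ) ^ p * Φ⁻¹ := by
    rw [hPhi, Real.rpow_neg (by positivity), inv_inv, ← Real.mul_rpow (by linarith) (by positivity)]
    congr 1
    field_simp
  have hτp : (1 - τ) ^ p ≤ 2 := by
    have hp1 : p ≤ 1 := by rw [hp, div_le_one (by linarith)]; linarith
    calc (1 - τ) ^ p ≤ (1 - τ) ^ (1 : ℝ) := Real.rpow_le_rpow_of_exponent_le h1τ hp1
      _ ≤ 2 := by rw [Real.rpow_one]; exact h2τ
  have hΦpos : 0 < Φ := hμpos.trans_le hΦμ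
  have hwpos : 0 < w := (half_pos hμpos).trans_le hwμ
  have e1 : |l ^ (-p) * hh - P' ^ p| ≤ 2 * (C₁ / (μ / 2 * μ)) * (Real.log s / s) := by
    rw [hHw, hPw, ← mul_sub, abs_mul, abs_of_nonneg (by positivity)]
    have h2 : w⁻¹ - Φ⁻¹ = -(w - Φ) / (w * Φ) := by field_simp; ring
    rw [h2, abs_div, abs_neg, abs_of_pos (mul_pos hwpos hΦpos)]
    have h3 : |w - Φ| / (w * Φ) ≤ C₁ * (Real.log s / s) / (μ / 2 * μ) :=
      div_le_div₀ (by positivity) hwΦ (by positivity)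
        (mul_le_mul hwμ hΦμ hμpos.le hwpos.le)
    calc (1 - τ) ^ p * (|w - Φ| / (w * Φ)) ≤ 2 * (C₁ * (Real.log s / s) / (μ / 2 * μ)) :=
          mul_le_mul hτp h3 (by positivity) zero_le_two
      _ = _ := by ring
  set P₀ := profBase β s y τ ξ with hP₀
  have hP₀1 : 1 ≤ P₀ := one_le_profBase hβ (by linarith) hτ.2 y ξ
  have hP₀2 : P₀ ≤ P₂ := by
    refine (profBase_le hβ (by linarith) hτ.1 hyn hξ).trans ?_
    rw [hP₂, ← hbd]
    have : 0 ≤ b * (K + 1) ^ 2 := by positivity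
    linarith
  have e2 : |P' ^ p - P₀ ^ p| ≤ Lp * (2 * b * (K + 1) ^ 2) * (Real.log s / s) := by
    refine (hLp P' ⟨hP'1, hP'2⟩ P₀ ⟨hP₀1, hP₀2⟩).trans ?_
    rw [mul_assoc Lp]
    refine mul_le_mul_of_nonneg_left ?_ hLp0
    have h2 : P' - P₀ = b * U * ((s - s') / (s * s')) := by
      rw [hP', hP₀, profBase, ← hbd, ← hU]; field_simp; ring
    have h3 : (s - s') / (s * s') ≤ 1 / (s * (s / 2)) := by
      refine div_le_div₀ zero_le_one (by linarith) (by positivity) ?_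
      exact mul_le_mul_of_nonneg_left hs'1 (by linarith)
    have h4 : 0 ≤ (s - s') / (s * s') := div_nonneg (by linarith) (by positivity)
    rw [h2, abs_of_nonneg (by positivity)]
    calc b * U * ((s - s') / (s * s')) ≤ b * ((K + 1) ^ 2 * s) * (1 / (s * (s / 2))) :=
          mul_le_mul (mul_le_mul_of_nonneg_left hUb hb.le) h3 h4 (by positivity)
      _ = 2 * b * (K + 1) ^ 2 * (1 / s) := by field_simp
      _ ≤ 2 * b * (K + 1) ^ 2 * (Real.log s / s) := by
          refine mul_le_mul_of_nonneg_left ?_ (by positivity)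
          exact div_le_div_of_nonneg_right hlogs (by linarith)
  calc |l ^ (-p) * hh - P₀ ^ p| ≤ |l ^ (-p) * hh - P' ^ p| + |P' ^ p - P₀ ^ p| :=
        abs_sub_le _ _ _
    _ ≤ _ := by rw [add_mul]; exact add_le_add e1 e2

set_option maxHeartbeats 1000000 in
/-- The intermediate gradient profile close to the extinction time. -/
theorem exists_gradient_profile_near (S : Setup β F χ₀ Ω ψ Hs T t₀ P h) {K : ℝ} (hK : 0 < K) :
    ∃ C, 0 ≤ C ∧ ∀ᶠ l in 𝓝[>] (0 : ℝ), ∀ x₁ : E N, ‖x₁‖ ≤ K * Real.sqrt (l * -Real.log l) →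
      ‖(l ^ (-(1 / (β + 1))) * Real.sqrt l) • gradient (h (T - l)) x₁ -
        (Real.sqrt (-Real.log l))⁻¹ •
          gradient (PhiHat β) ((Real.sqrt (l * -Real.log l))⁻¹ • x₁)‖ ≤
        C * (Real.log (-Real.log l) / -Real.log l) := by
  have hβ := S.β_pos
  obtain ⟨C₁, hC₁, hprof⟩ := S.exists_rescaled_profile hK
  set p := 1 / (β + 1) with hp
  have hppos : 0 < p := by positivity
  set b := (β + 1) ^ 2 / (4 * β) with hbd
  have hb : 0 < b := coeff_pos hβ
  set P₁ := 2 * (β + 1) + b * (K + 1) ^ 2 with hP₁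
  have hP₁pos : 0 < P₁ := by positivity
  -- The approximate solution lies in `[1, P₁^p]` and is eventually within `1/2` of the true one, so
  -- both stay in this interval.
  obtain ⟨C₂, hC₂, hrate⟩ := S.exists_rate (c := 1 / 2) (c' := P₁ ^ p + 1) (by norm_num)
  obtain ⟨-, Lp, -, hLp0, -, hLp⟩ := exists_bound_lipschitz_of_smooth (F := fun v : ℝ => v ^ (-β))
    (contDiffOn_id.rpow_const_of_ne fun x hx => ne_of_gt hx) (c := 1 / 2) (C := P₁ ^ p + 1)
    (by norm_num)
  set C₃ := 4 * b ^ 2 * (K + 1) ^ 2 + 2 * N * b with hC₃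
  have hC₃0 : 0 ≤ C₃ := by positivity
  refine ⟨(N + 1) * C₁ + (Lp * C₁ + C₂ + C₃) / 2, by positivity, ?_⟩
  have hlim : Tendsto (fun l => C₁ * (Real.log (-Real.log l) / -Real.log l)) (𝓝[>] (0 : ℝ))
      (𝓝 0) := by
    simpa using (tendsto_log_div_self.comp tendsto_neg_log_zero).const_mul C₁
  filter_upwards [S.eventually_mem_domain K, hprof, hrate,
    hlim.eventually (gt_mem_nhds (show (0 : ℝ) < 1 / 2 by norm_num)),
    tendsto_neg_log_zero.eventually_ge_atTop (Real.exp 1 + 1), self_mem_nhdsWithin]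
    with l hdom hprof hrate hsmall hs hl x₁ hx₁
  have hl : 0 < l := hl
  set s := -Real.log l with hsd
  have hs1 : 1 ≤ s := by linarith [Real.exp_pos 1]
  have hs0 : 0 < s := by linarith
  have hlogs : 1 ≤ Real.log s := (Real.le_log_iff_exp_le hs0).2 (by linarith)
  have hsq : 0 < Real.sqrt l := Real.sqrt_pos.2 hl
  set y := (Real.sqrt l)⁻¹ • x₁ with hy
  have hyn : ‖y‖ ≤ K * Real.sqrt s := by
    rw [hy, norm_smul, norm_inv, Real.norm_of_nonneg hsq.le, inv_mul_le_iff₀ hsq]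
    rw [Real.sqrt_mul hl.le] at hx₁
    linarith
  set m := Real.log s / s with hm
  have hm0 : 0 < m := by positivity
  have hsm : s⁻¹ ≤ m := by rw [hm, ← one_div]; exact div_le_div_of_nonneg_right hlogs hs0.le
  set I : Set ℝ := Icc (-1) 0 with hI
  set B : Set (E N) := Metric.closedBall 0 1 with hB
  have hBn : ∀ x ∈ B, ‖x‖ ≤ 1 := fun x hx => by simpa [hB] using hx
  have hH := S.isHeat_rescaled hl (T - l) x₁ (J := I) (O := B)
    (fun τ hτ => (hdom x₁ hx₁ τ hτ 0 (by simp)).1)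
    (fun ξ hξ => (hdom x₁ hx₁ 0 ⟨by norm_num, le_rfl⟩ ξ (hBn ξ hξ)).2)
  have hD := hH.sub (isHeat_profBase hβ hs0 y B)
  have hIe : Icc ((0 : ℝ) - 1 ^ 2) 0 = I := by rw [hI]; norm_num
  -- The difference is `O(log s / s)` by the profile. So is its source, made of the pure-power
  -- difference, the deviation of `F` with its forced rate, and the residual Laplacian.
  have key := IsHeat.norm_gradient_le (d := 1) (b := 0) (x₀ := (0 : E N)) (M := C₁ * m)
    (F₀ := (Lp * C₁ + C₂ + C₃) * m) one_pos (by positivity) (by positivity)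
    (by rw [hIe]; exact hD) ?_ ?_
  · have hd1 : DifferentiableAt ℝ (h (T - l + l * 0)) (x₁ + Real.sqrt l • (0 : E N)) := by
      have h0 := hdom x₁ hx₁ 0 ⟨by norm_num, le_rfl⟩ 0 (by simp)
      exact (S.isHeat.c2 _ h0.1 _ h0.2).differentiableAt (by simp)
    have hg1 := gradient_const_mul_comp_affine (l ^ (-p)) (Real.sqrt l) x₁ 0 hd1
    have hg2 : gradient (fun ξ => profBase β s y 0 ξ ^ p) (0 : E N) =
        (Real.sqrt s)⁻¹ • gradient (PhiHat β) ((Real.sqrt (l * s))⁻¹ • x₁) := by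
      have e1 : (fun ξ => profBase β s y 0 ξ ^ p) = fun ξ : E N => 1 *
          PhiHat β ((Real.sqrt s)⁻¹ • y + (Real.sqrt s)⁻¹ • ξ) := by
        funext ξ
        rw [one_mul, PhiHat, profBase, ← smul_add, norm_smul, mul_pow, norm_inv, inv_pow,
          Real.norm_of_nonneg (Real.sqrt_nonneg _), Real.sq_sqrt hs0.le, add_comm y ξ]
        congr 1
        rw [← hbd, div_eq_mul_inv b s]; ring
      rw [e1, gradient_const_mul_comp_affine _ _ _ _ (differentiableAt_PhiHat hβ _), one_mul,
        smul_zero, add_zero, hy, smul_smul, Real.sqrt_mul hl.le, mul_inv, mul_comm]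
    rw [gradient_sub_apply, hg1, hg2] at key
    · simp only [mul_zero, add_zero, smul_zero] at key
      refine key.trans (le_of_eq ?_)
      ring
    · refine DifferentiableAt.const_mul ?_ _
      exact DifferentiableAt.comp (g := h (T - l + l * 0))
        (f := fun ξ : E N => x₁ + Real.sqrt l • ξ) (0 : E N) hd1 (by fun_prop)
    · exact (contDiffAt_profBase_rpow hβ hs0 le_rfl y 0 p).differentiableAt (by simp)
  · rw [hIe]
    intro τ hτ ξ hξ
    have h1 := hprof x₁ hx₁ τ hτ ξ (hBn ξ hξ)
    set H := l ^ (-p) * h (T - l + l * τ) (x₁ + Real.sqrt l • ξ) with hHd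
    set P₀ := profBase β s y τ ξ with hP₀
    have hP₀1 : 1 ≤ P₀ := one_le_profBase hβ hs0 hτ.2 y ξ
    have hP₀2 : P₀ ≤ P₁ := profBase_le hβ hs1 hτ.1 hyn (hBn ξ hξ)
    have hb1 : 1 ≤ P₀ ^ p := Real.one_le_rpow hP₀1 hppos.le
    have hb2 : P₀ ^ p ≤ P₁ ^ p := Real.rpow_le_rpow (by linarith) hP₀2 hppos.le
    have hbmem : P₀ ^ p ∈ Icc (1 / 2) (P₁ ^ p + 1) := ⟨by linarith, by linarith⟩
    have h1' := abs_le.1 h1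
    have hHmem : H ∈ Icc (1 / 2) (P₁ ^ p + 1) := ⟨by linarith [h1'.1], by linarith [h1'.2]⟩
    have h2 := hrate H hHmem
    have h3 := hLp H hHmem _ hbmem
    have h4 := abs_laplacian_profBase_le hβ hs1 hτ.2 hyn (hBn ξ hξ)
    rw [← hbd, ← hp, ← hC₃] at h4
    set Λ := Laplacian.laplacian (fun ξ => profBase β s y τ ξ ^ p) ξ
    have h5 : -scaledF β F l H - (-(P₀ ^ p) ^ (-β) - Λ) =
        -(H ^ (-β) - (P₀ ^ p) ^ (-β)) - scaledErr β F l H + Λ := by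
      rw [scaledErr]; ring
    rw [h5]
    refine (abs_add_le _ _).trans ((add_le_add (abs_sub _ _) h4).trans ?_)
    rw [abs_neg]
    have h6 : Lp * |H - P₀ ^ p| ≤ Lp * (C₁ * m) := mul_le_mul_of_nonneg_left h1 hLp0
    have h7 : C₃ * s⁻¹ ≤ C₃ * m := mul_le_mul_of_nonneg_left hsm hC₃0
    linarith
  · rw [hIe]
    intro τ hτ ξ hξ
    exact hprof x₁ hx₁ τ hτ ξ (hBn ξ hξ)

end Setup

/-! ### Gradients of radial functions -/

lemma gradient_radial {φ : ℝ → ℝ} {φ' : ℝ} (x : E N) (hφ : HasDerivAt φ φ' (‖x‖ ^ 2)) :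
    gradient (fun y : E N => φ (‖y‖ ^ 2)) x = (2 * φ') • x := by
  refine HasGradientAt.gradient ?_
  rw [hasGradientAt_iff_hasFDerivAt]
  have h1 : HasFDerivAt (fun y : E N => ‖y‖ ^ 2) (2 • innerSL ℝ x) x :=
    (hasStrictFDerivAt_norm_sq x).hasFDerivAt
  have h2 := hφ.comp_hasFDerivAt x h1
  refine h2.congr_fderiv ?_
  ext v
  simp
  ring

lemma gradient_PhiHat {β : ℝ} (hβ : 0 < β) (z : E N) : gradient (PhiHat β) z =
    ((β + 1) / (2 * β) * (β + 1 + (β + 1) ^ 2 / (4 * β) * ‖z‖ ^ 2) ^ (1 / (β + 1) - 1)) • z := by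
  have hb := coeff_pos hβ
  have hlin : HasDerivAt (fun u : ℝ => β + 1 + (β + 1) ^ 2 / (4 * β) * u) ((β + 1) ^ 2 / (4 * β))
      (‖z‖ ^ 2) :=
    (((hasDerivAt_id' (‖z‖ ^ 2)).const_mul ((β + 1) ^ 2 / (4 * β))).const_add (β + 1)).congr_deriv
      (by ring)
  have h := gradient_radial z (hlin.rpow_const (p := 1 / (β + 1)) (Or.inl (by positivity)))
  have e : (PhiHat β : E N → ℝ) = fun y : E N =>
      (β + 1 + (β + 1) ^ 2 / (4 * β) * ‖y‖ ^ 2) ^ (1 / (β + 1)) := rfl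
  rw [e, h]
  congr 1
  field_simp
  ring

lemma norm_gradient_PhiHat_le {β : ℝ} (hβ : 0 < β) (z : E N) :
    ‖gradient (PhiHat β) z‖ ≤ (β + 1) / (2 * β) * ‖z‖ := by
  have hb := coeff_pos hβ
  rw [gradient_PhiHat hβ, norm_smul, Real.norm_of_nonneg (by positivity), mul_assoc]
  refine mul_le_mul_of_nonneg_left ?_ (by positivity)
  refine mul_le_of_le_one_left (norm_nonneg _) ?_
  refine Real.rpow_le_one_of_one_le_of_nonpos ?_ ?_
  · have : 0 ≤ (β + 1) ^ 2 / (4 * β) * ‖z‖ ^ 2 := by positivity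
    linarith
  · have : 1 / (β + 1) ≤ 1 := by rw [div_le_one (by linarith)]; linarith
    linarith

lemma mul_neg_log_le_one {l : ℝ} (hl : 0 < l) : l * -Real.log l ≤ 1 := by
  have h := Real.one_sub_inv_le_log_of_pos hl
  have : l * -Real.log l ≤ l * (l⁻¹ - 1) := mul_le_mul_of_nonneg_left (by linarith) hl.le
  rw [mul_sub, mul_inv_cancel₀ hl.ne'] at this
  linarith

namespace Setup

variable {β : ℝ} {F χ₀ : ℝ → ℝ} {Ω : Set (E N)} {ψ Hs : E N → ℝ} {T t₀ : ℝ} {P : Params}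
  {h : ℝ → E N → ℝ}

/-- The intermediate gradient profile on the whole time interval. -/
theorem exists_gradient_profile (S : Setup β F χ₀ Ω ψ Hs T t₀ P h) {K : ℝ} (hK : 0 < K) :
    ∃ C, ∀ t ∈ Ico t₀ T, ∀ x ∈ Ω, ‖x‖ ≤ K * scale T t →
      ‖(T - t) ^ (-(1 / (β + 1)) + 1 / 2) • gradient (h t) x
          - (|Real.log (T - t)| ^ (1 / 2 : ℝ))⁻¹ • gradient (PhiHat β) (zvar T t x)‖ ≤
        C * (Real.log |Real.log (T - t)| / |Real.log (T - t)|) := by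
  have hβ := S.β_pos
  obtain ⟨C₁, hC₁, hnear⟩ := S.exists_gradient_profile_near hK
  obtain ⟨δ, hδ, hδnear⟩ := mem_nhdsGT_iff_exists_Ioo_subset.1 hnear
  have hδ : 0 < δ := hδ
  obtain ⟨M, hM⟩ := S.trap.1.exists_gradient_bound S.isOpen S.ψ_smooth
    (show T - δ < T by linarith) K
  set p := 1 / (β + 1) with hp
  have hppos : 0 < p := by positivity
  set B := δ ^ (-p) * |M| + (β + 1) / (2 * β) * K with hB
  have hδp : 0 < δ ^ (-p) := Real.rpow_pos_of_pos hδ _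
  have hB0 : 0 ≤ B := by positivity
  have hs₀ := S.one_lt_s S.t₀_mem
  have hl₀ : 0 < Real.log (-Real.log (T - t₀)) := Real.log_pos hs₀
  refine ⟨C₁ + B / (Real.log (-Real.log (T - t₀)) / |Real.log δ|), fun t ht x hx hxs => ?_⟩
  have hl : 0 < T - t := S.sub_pos ht
  have hs := S.one_lt_s ht
  have habs := abs_log_eq_neg_log hl (S.sub_lt ht)
  rw [habs]
  rw [scale, habs] at hxs
  have hz : zvar T t x = (Real.sqrt ((T - t) * -Real.log (T - t)))⁻¹ • x := by
    rw [zvar, scale, habs]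
  have he : (T - t) ^ (-p + 1 / 2) = (T - t) ^ (-p) * Real.sqrt (T - t) := by
    rw [Real.rpow_add hl, Real.sqrt_eq_rpow]
  rw [← Real.sqrt_eq_rpow, he, hz]
  set l := T - t with hld
  set s := -Real.log l with hsd
  have hrate : 0 < Real.log s / s := div_pos (Real.log_pos hs) (by linarith)
  -- For `l < δ` the asymptotic estimate applies. For `l ≥ δ` the time interval is compact in `[t₀,
  -- T)`: both terms are bounded and `log s / s` is bounded below, so only the constant is affected.
  rcases lt_or_ge l δ with hlδ | hlδ
  · have h1 := hδnear (show l ∈ Ioo 0 δ from ⟨hl, hlδ⟩) x hxs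
    have htl : T - l = t := by rw [hld]; ring
    rw [htl] at h1
    refine h1.trans (mul_le_mul_of_nonneg_right ?_ hrate.le)
    have : 0 ≤ B / (Real.log (-Real.log (T - t₀)) / |Real.log δ|) := by positivity
    linarith
  · have hl1 : l < 1 := (S.sub_lt ht).trans (by simp)
    have hxK : ‖x‖ ≤ K := by
      refine hxs.trans (mul_le_of_le_one_right hK.le ?_)
      rw [Real.sqrt_le_one]
      exact mul_neg_log_le_one hl
    have h1 : ‖gradient (h t) x‖ ≤ |M| :=
      (hM t ⟨ht.1, by linarith⟩ x hx hxK).trans (le_abs_self _)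
    have hsc : 0 < Real.sqrt (l * s) := Real.sqrt_pos.2 (by positivity)
    have h2 : ‖gradient (PhiHat β) ((Real.sqrt (l * s))⁻¹ • x)‖ ≤ (β + 1) / (2 * β) * K := by
      refine (norm_gradient_PhiHat_le hβ _).trans (mul_le_mul_of_nonneg_left ?_ (by positivity))
      rw [norm_smul, norm_inv, Real.norm_of_nonneg hsc.le, inv_mul_le_iff₀ hsc]
      linarith
    have h3 : ‖(l ^ (-p) * Real.sqrt l) • gradient (h t) x
          - (Real.sqrt s)⁻¹ • gradient (PhiHat β) ((Real.sqrt (l * s))⁻¹ • x)‖ ≤ B := by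
      refine (norm_sub_le _ _).trans (add_le_add ?_ ?_)
      · rw [norm_smul, Real.norm_of_nonneg (by positivity)]
        refine mul_le_mul ?_ h1 (norm_nonneg _) hδp.le
        calc l ^ (-p) * Real.sqrt l ≤ δ ^ (-p) * 1 :=
              mul_le_mul (Real.rpow_le_rpow_of_nonpos hδ hlδ (by linarith))
                (by rw [Real.sqrt_le_one]; exact hl1.le) (Real.sqrt_nonneg _) hδp.le
          _ = _ := mul_one _
      · rw [norm_smul, norm_inv, Real.norm_of_nonneg (Real.sqrt_nonneg _)]
        refine (mul_le_of_le_one_left (norm_nonneg _) ?_).trans h2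
        exact inv_le_one_of_one_le₀ (by rw [Real.one_le_sqrt]; exact hs.le)
    refine h3.trans ?_
    have hslδ : s ≤ |Real.log δ| := by
      rw [hsd]
      exact (neg_le_neg (Real.log_le_log hδ hlδ)).trans (neg_le_abs _)
    have h4 : Real.log (-Real.log (T - t₀)) / |Real.log δ| ≤ Real.log s / s := by
      refine div_le_div₀ (Real.log_pos hs).le ?_ (by linarith) hslδ
      refine Real.log_le_log (by linarith) ?_
      exact neg_le_neg (Real.log_le_log hl (by rw [hld]; linarith [ht.1]))
    have hm : 0 < Real.log (-Real.log (T - t₀)) / |Real.log δ| :=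
      div_pos hl₀ (by linarith)
    calc B = B / (Real.log (-Real.log (T - t₀)) / |Real.log δ|) *
          (Real.log (-Real.log (T - t₀)) / |Real.log δ|) :=
          (div_mul_cancel₀ B hm.ne').symm
      _ ≤ B / (Real.log (-Real.log (T - t₀)) / |Real.log δ|) * (Real.log s / s) :=
          mul_le_mul_of_nonneg_left h4 (by positivity)
      _ ≤ _ := mul_le_mul_of_nonneg_right (by linarith) hrate.le

end Setup

/-! ### The intermediate region -/

/-- The solution rescaled around `(x, T - θ(x))`. -/
def zoom (β K₀ T : ℝ) (h : ℝ → E N → ℝ) (x : E N) (τ : ℝ) (ξ : E N) : ℝ :=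
  theta K₀ ‖x‖ ^ (-(1 / (β + 1))) *
    h (T - theta K₀ ‖x‖ + theta K₀ ‖x‖ * τ) (x + Real.sqrt (theta K₀ ‖x‖) • ξ)

lemma mul_abs_log_mono {a b : ℝ} (ha : 0 < a) (hab : a ≤ b) (hb : b ≤ Real.exp (-1)) :
    a * |Real.log a| ≤ b * |Real.log b| := by
  have habs : ∀ r, 0 < r → r ≤ Real.exp (-1) → r * |Real.log r| = Real.negMulLog r := by
    intro r h0 h1
    have : Real.log r ≤ -1 := (Real.log_le_iff_le_exp h0).2 h1
    rw [abs_of_neg (by linarith), Real.negMulLog]; ring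
  rw [habs a ha (hab.trans hb), habs b (ha.trans_le hab) hb]
  have hmono : MonotoneOn Real.negMulLog (Icc 0 (Real.exp (-1))) := by
    refine monotoneOn_of_deriv_nonneg (convex_Icc _ _) Real.continuous_negMulLog.continuousOn ?_ ?_
    · rw [interior_Icc]
      exact fun x hx => (Real.differentiableAt_negMulLog hx.1.ne').differentiableWithinAt
    · intro x hx
      rw [interior_Icc] at hx
      rw [Real.deriv_negMulLog hx.1.ne']
      have := (Real.log_lt_iff_lt_exp hx.1).2 hx.2
      linarith
  exact hmono ⟨ha.le, hab.trans hb⟩ ⟨(ha.trans_le hab).le, hb⟩ hab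

lemma eventually_norm_le {c : ℝ} (hc : 0 < c) : ∀ᶠ x : E N in 𝓝[≠] 0, 0 < ‖x‖ ∧ ‖x‖ ≤ c := by
  have h1 : ∀ᶠ x : E N in 𝓝[≠] 0, ‖x‖ < c := by
    have := (continuous_norm (E := E N)).tendsto 0
    rw [norm_zero] at this
    exact (this.mono_left nhdsWithin_le_nhds).eventually (gt_mem_nhds hc)
  filter_upwards [h1, self_mem_nhdsWithin] with x hx hx'
  exact ⟨norm_pos_iff.2 hx', hx.le⟩

lemma tendsto_neg_log_theta {K₀ : ℝ} (hK : 0 < K₀) :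
    Tendsto (fun x : E N => -Real.log (theta K₀ ‖x‖)) (𝓝[≠] 0) atTop :=
  tendsto_neg_log_zero.comp (tendsto_theta hK)

lemma sqrt_theta_mul {K₀ r : ℝ} (hK : 0 < K₀) (hr : 0 < r)
    (hr' : r ≤ K₀ / 4 * Real.sqrt (Real.exp (-1))) :
    Real.sqrt (theta K₀ r * -Real.log (theta K₀ r)) = 4 * r / K₀ := by
  obtain ⟨h0, h1, h2⟩ := theta_spec hK hr hr'
  have : Real.log (theta K₀ r) ≤ -1 := (Real.log_le_iff_le_exp h0).2 h1
  rw [abs_of_neg (by linarith)] at h2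
  rw [eq_div_iff hK.ne']; linarith

/-- The similarity variable at the time `T - θ(x)` of the point `x + √θ(x) ξ`. -/
def zoomVar (K₀ : ℝ) (q : E N × E N) : E N :=
  (Real.sqrt (theta K₀ ‖q.1‖ * -Real.log (theta K₀ ‖q.1‖)))⁻¹ •
    (q.1 + Real.sqrt (theta K₀ ‖q.1‖) • q.2)

/-- By the equation defining `θ`, the point `x` itself contributes exactly `(K₀/4) x/|x|`; the
displacement `√θ ξ` contributes `ξ/√|log θ|`, which vanishes in the limit. -/
lemma tendsto_zoomVar {K₀ : ℝ} (hK : 0 < K₀) (R : ℝ) :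
    Tendsto (fun q : E N × E N => zoomVar K₀ q - (K₀ / 4) • (‖q.1‖⁻¹ • q.1))
      (𝓝[≠] 0 ×ˢ 𝓟 (Metric.closedBall 0 R)) (𝓝 0) := by
  have hlim : Tendsto (fun q : E N × E N => |R| * (Real.sqrt (-Real.log (theta K₀ ‖q.1‖)))⁻¹)
      (𝓝[≠] 0 ×ˢ 𝓟 (Metric.closedBall 0 R)) (𝓝 0) := by
    have h1 : Tendsto (fun s : ℝ => |R| * (Real.sqrt s)⁻¹) atTop (𝓝 0) := by
      simpa using (tendsto_inv_atTop_zero.comp Real.tendsto_sqrt_atTop).const_mul |R|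
    exact h1.comp ((tendsto_neg_log_theta hK).comp tendsto_fst)
  refine squeeze_zero_norm' ?_ hlim
  have hc : 0 < K₀ / 4 * Real.sqrt (Real.exp (-1)) := by positivity
  rw [eventually_prod_principal_iff]
  filter_upwards [eventually_norm_le hc] with x hx ξ hξ
  obtain ⟨hx0, hx1⟩ := hx
  obtain ⟨h0, h1, -⟩ := theta_spec hK hx0 hx1
  have h2 := sqrt_theta_mul hK hx0 hx1
  simp only [zoomVar]
  set θ := theta K₀ ‖x‖ with hθ
  have hs : 0 < -Real.log θ := by
    have : Real.log θ ≤ -1 := (Real.log_le_iff_le_exp h0).2 h1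
    linarith
  have h3 : (Real.sqrt (θ * -Real.log θ))⁻¹ • (x + Real.sqrt θ • ξ) - (K₀ / 4) • (‖x‖⁻¹ • x) =
      (Real.sqrt (-Real.log θ))⁻¹ • ξ := by
    have e1 : (Real.sqrt (θ * -Real.log θ))⁻¹ • x = (K₀ / 4) • (‖x‖⁻¹ • x) := by
      rw [h2, smul_smul]; congr 1; field_simp
    have e2 : (Real.sqrt (θ * -Real.log θ))⁻¹ • (Real.sqrt θ • ξ) =
        (Real.sqrt (-Real.log θ))⁻¹ • ξ := by
      have h4 : Real.sqrt θ ≠ 0 := (Real.sqrt_pos.2 h0).ne'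
      rw [smul_smul, Real.sqrt_mul h0.le]; congr 1; field_simp
    rw [smul_add, e1, e2, add_sub_cancel_left]
  rw [h3, norm_smul, norm_inv, Real.norm_of_nonneg (Real.sqrt_nonneg _), mul_comm]
  refine mul_le_mul_of_nonneg_right ?_ (by positivity)
  exact (mem_closedBall_zero_iff.1 hξ).trans (le_abs_self R)

lemma tendsto_norm_zoomVar {K₀ : ℝ} (hK : 0 < K₀) (R : ℝ) :
    Tendsto (fun q : E N × E N => ‖zoomVar K₀ q‖)
      (𝓝[≠] 0 ×ˢ 𝓟 (Metric.closedBall 0 R)) (𝓝 (K₀ / 4)) := by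
  rw [tendsto_iff_norm_sub_tendsto_zero]
  refine squeeze_zero_norm' ?_ (tendsto_zero_iff_norm_tendsto_zero.1 (tendsto_zoomVar hK R))
  rw [eventually_prod_principal_iff]
  filter_upwards [self_mem_nhdsWithin] with x hx ξ hξ
  have hx0 : 0 < ‖x‖ := norm_pos_iff.2 hx
  have h1 : ‖(K₀ / 4) • (‖x‖⁻¹ • x)‖ = K₀ / 4 := by
    rw [norm_smul, norm_smul, norm_inv, norm_norm, inv_mul_cancel₀ hx0.ne', mul_one,
      Real.norm_of_nonneg (by positivity)]
  have h2 := abs_norm_sub_norm_le (zoomVar K₀ (x, ξ)) ((K₀ / 4) • (‖x‖⁻¹ • x))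
  rw [h1] at h2
  rw [norm_norm, Real.norm_eq_abs]
  exact h2

/-- The limit of the direction-normalised gradient in the intermediate region. -/
def slopeHat (β K₀ τ : ℝ) : ℝ := (β + 1) / (2 * β) * (K₀ / 4) * kHat β K₀ τ ^ (-β)

lemma hasDerivAt_kHat {β K₀ τ : ℝ} (hβ : 0 < β) (hK : 0 < K₀) (hτ : τ ≤ 1) :
    HasDerivAt (kHat β K₀) (-kHat β K₀ τ ^ (-β)) τ := by
  have hb := kHat_base_pos hβ hK hτ
  have h2 : HasDerivAt (fun τ : ℝ => (β + 1) * (1 - τ) + (β + 1) ^ 2 / (4 * β) * (K₀ ^ 2 / 16))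
      (-(β + 1)) τ :=
    ((((hasDerivAt_id' τ).const_sub 1).const_mul (β + 1)).add_const
        ((β + 1) ^ 2 / (4 * β) * (K₀ ^ 2 / 16))).congr_deriv (by ring)
  refine (h2.rpow_const (p := 1 / (β + 1)) (Or.inl hb.ne')).congr_deriv ?_
  rw [kHat, ← Real.rpow_mul hb.le]
  have h3 : 1 / (β + 1) * -β = 1 / (β + 1) - 1 := by field_simp; ring
  rw [h3]
  have h4 : β + 1 ≠ 0 := by linarith
  field_simp

/-- `slopeHat` is a constant multiple of the derivative of `kHat`, hence solves the equation
linearised at `kHat`. -/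
lemma hasDerivAt_slopeHat {β K₀ τ : ℝ} (hβ : 0 < β) (hK : 0 < K₀) (hτ : τ ≤ 1) :
    HasDerivAt (slopeHat β K₀) (β * kHat β K₀ τ ^ (-(β + 1)) * slopeHat β K₀ τ) τ := by
  have hk := kHat_pos hβ hK hτ
  refine (((hasDerivAt_kHat hβ hK hτ).rpow_const (p := -β) (Or.inl hk.ne')).const_mul
    ((β + 1) / (2 * β) * (K₀ / 4))).congr_deriv ?_
  rw [slopeHat, show -β - 1 = -(β + 1) by ring]
  ring

lemma isHeat_of_hasDerivAt {g g' : ℝ → ℝ} {I : Set ℝ} (O : Set (E N))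
    (hg : ∀ t ∈ I, HasDerivAt g (g' t) t) : IsHeat I O (fun t _ => g t) (fun t _ => g' t) := by
  refine ⟨?_, fun t _ x _ => contDiffAt_const, fun t ht x _ => ?_⟩
  · have : ContinuousOn g I := fun t ht => (hg t ht).continuousAt.continuousWithinAt
    exact this.comp continuousOn_fst fun p hp => hp.1
  · have h0 : Laplacian.laplacian (fun _ : E N => g t) x = 0 := by
      rw [InnerProductSpace.laplacian_const]; rfl
    rw [h0, zero_add]
    exact hg t ht

namespace Setup

variable {β : ℝ} {F χ₀ : ℝ → ℝ} {Ω : Set (E N)} {ψ Hs : E N → ℝ} {T t₀ : ℝ} {P : Params}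
  {h : ℝ → E N → ℝ}

/-- The a priori bounds in the intermediate region. -/
lemma eventually_zoom_bounds (S : Setup β F χ₀ Ω ψ Hs T t₀ P h) (R : ℝ) :
    ∀ᶠ x : E N in 𝓝[≠] 0, 0 < theta P.K₀ ‖x‖ ∧ 1 ≤ -Real.log (theta P.K₀ ‖x‖) ∧
      (∀ τ ∈ Ico (0 : ℝ) 1, T - theta P.K₀ ‖x‖ + theta P.K₀ ‖x‖ * τ ∈ Ioo t₀ T) ∧
      (∀ ξ : E N, ‖ξ‖ ≤ R → x + Real.sqrt (theta P.K₀ ‖x‖) • ξ ∈ Ω) ∧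
      ∀ τ ∈ Ico (0 : ℝ) 1, ∀ ξ : E N, ‖ξ‖ ≤ R →
        |zoom β P.K₀ T h x τ ξ - kHat β P.K₀ τ| ≤ P.δ₀ ∧
        ‖gradient (zoom β P.K₀ T h x τ) ξ‖ ≤
          P.C₀ / Real.sqrt (-Real.log (theta P.K₀ ‖x‖)) := by
  have hK := P.K₀_pos
  have hβ := S.β_pos
  obtain ⟨ρ, hρ, hρΩ⟩ := Metric.isOpen_iff.1 S.isOpen 0 S.zero_mem
  have hθT : ∀ᶠ x : E N in 𝓝[≠] 0, theta P.K₀ ‖x‖ < T - t₀ :=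
    ((tendsto_theta hK).mono_right nhdsWithin_le_nhds).eventually
      (gt_mem_nhds (by linarith [S.t₀_lt]))
  have hθR : ∀ᶠ x : E N in 𝓝[≠] 0, ‖x‖ + Real.sqrt (theta P.K₀ ‖x‖) * |R| < ρ := by
    have h1 : Tendsto (fun x : E N => ‖x‖) (𝓝[≠] 0) (𝓝 0) := by
      have := (continuous_norm (E := E N)).tendsto 0
      rw [norm_zero] at this
      exact this.mono_left nhdsWithin_le_nhds
    have h2 : Tendsto (fun x : E N => Real.sqrt (theta P.K₀ ‖x‖)) (𝓝[≠] 0) (𝓝 0) := by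
      have := (Real.continuous_sqrt.tendsto 0).comp
        ((tendsto_theta (N := N) hK).mono_right nhdsWithin_le_nhds)
      rwa [Real.sqrt_zero] at this
    have h3 := h1.add (h2.mul_const |R|)
    rw [zero_mul, add_zero] at h3
    exact h3.eventually (gt_mem_nhds hρ)
  -- The radius `α₀√|log θ|` of the second region eventually exceeds any fixed `R`.
  have hsR : ∀ᶠ x : E N in 𝓝[≠] 0, |R| / P.α₀ ≤ Real.sqrt (-Real.log (theta P.K₀ ‖x‖)) :=
    (Real.tendsto_sqrt_atTop.comp (tendsto_neg_log_theta hK)).eventually_ge_atTop _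
  filter_upwards [eventually_norm_le (N := N) P.ε₀_pos, hθT, hθR, hsR] with x hx hθT hθR hsR
  obtain ⟨hx0, hx1⟩ := hx
  have hx2 := hx1.trans S.ε₀_le
  obtain ⟨hθ0, hθ1, hθ2⟩ := theta_spec hK hx0 hx2
  have hlog := one_le_abs_log_theta hK hx0 hx2
  have habs : |Real.log (theta P.K₀ ‖x‖)| = -Real.log (theta P.K₀ ‖x‖) := by
    have : Real.log (theta P.K₀ ‖x‖) ≤ -1 := (Real.log_le_iff_le_exp hθ0).2 hθ1
    rw [abs_of_neg (by linarith)]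
  have hτt : ∀ τ ∈ Ico (0 : ℝ) 1, T - theta P.K₀ ‖x‖ + theta P.K₀ ‖x‖ * τ ∈ Ioo t₀ T := by
    intro τ hτ
    have h1 : 0 ≤ theta P.K₀ ‖x‖ * τ := mul_nonneg hθ0.le hτ.1
    have h2 : theta P.K₀ ‖x‖ * τ < theta P.K₀ ‖x‖ * 1 := mul_lt_mul_of_pos_left hτ.2 hθ0
    exact ⟨by linarith, by linarith⟩
  have hξΩ : ∀ ξ : E N, ‖ξ‖ ≤ R → x + Real.sqrt (theta P.K₀ ‖x‖) • ξ ∈ Ω := by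
    intro ξ hξ
    refine hρΩ (mem_ball_zero_iff.2 ((norm_add_le _ _).trans_lt (lt_of_le_of_lt ?_ hθR)))
    rw [norm_smul, Real.norm_of_nonneg (Real.sqrt_nonneg _)]
    have := mul_le_mul_of_nonneg_left (hξ.trans (le_abs_self R))
      (Real.sqrt_nonneg (theta P.K₀ ‖x‖))
    linarith
  refine ⟨hθ0, by linarith, hτt, hξΩ, fun τ hτ ξ hξ => ?_⟩
  have ht := hτt τ hτ
  set t := T - theta P.K₀ ‖x‖ + theta P.K₀ ‖x‖ * τ with htd
  have hTt : T - t = theta P.K₀ ‖x‖ * (1 - τ) := by rw [htd]; ring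
  have hxΩ : x ∈ Ω := by
    refine hρΩ (mem_ball_zero_iff.2 (lt_of_le_of_lt ?_ hθR))
    have : 0 ≤ Real.sqrt (theta P.K₀ ‖x‖) * |R| := by positivity
    linarith
  have hreg := (S.trap.2 t ⟨ht.1.le, ht.2⟩).region2 x hxΩ ?_ hx1 ξ ?_ (hξΩ ξ hξ)
  · have htau : tauOf P.K₀ T t x = τ := by
      rw [tauOf_eq x t hθ0.ne', hTt]; field_simp; ring
    have hk : kOf β P.K₀ (h t) x = zoom β P.K₀ T h x τ := by
      funext ξ
      rw [kOf, zoom, Real.rpow_neg hθ0.le, div_eq_inv_mul]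
    rw [htau, hk, habs] at hreg
    exact hreg
  -- The lower bound on `|x|` required by the second region: `T - t = θ(1-τ) ≤ θ` and `θ ↦ θ|log θ|`
  -- increases up to `e⁻¹`.
  · rw [← hθ2]
    refine mul_le_mul_of_nonneg_left (Real.sqrt_le_sqrt ?_) (by positivity)
    refine mul_abs_log_mono (by linarith [ht.2]) ?_ hθ1
    rw [hTt]
    exact mul_le_of_le_one_right hθ0.le (by linarith [hτ.1])
  · rw [habs]
    rw [div_le_iff₀ P.α₀_pos] at hsR
    linarith [le_abs_self R]

lemma isHeat_zoom (S : Setup β F χ₀ Ω ψ Hs T t₀ P h) {x : E N} {J : Set ℝ} {O : Set (E N)}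
    (hθ : 0 < theta P.K₀ ‖x‖)
    (hJ : ∀ τ ∈ J, T - theta P.K₀ ‖x‖ + theta P.K₀ ‖x‖ * τ ∈ Ioo t₀ T)
    (hO : ∀ ξ ∈ O, x + Real.sqrt (theta P.K₀ ‖x‖) • ξ ∈ Ω) :
    IsHeat J O (zoom β P.K₀ T h x)
      (fun τ ξ => -scaledF β F (theta P.K₀ ‖x‖) (zoom β P.K₀ T h x τ ξ)) :=
  S.isHeat_rescaled hθ _ x hJ hO

lemma gradient_zoom (S : Setup β F χ₀ Ω ψ Hs T t₀ P h) {x ξ : E N} {τ : ℝ}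
    (ht : T - theta P.K₀ ‖x‖ + theta P.K₀ ‖x‖ * τ ∈ Ioo t₀ T)
    (hx : x + Real.sqrt (theta P.K₀ ‖x‖) • ξ ∈ Ω) :
    gradient (zoom β P.K₀ T h x τ) ξ =
      (theta P.K₀ ‖x‖ ^ (-(1 / (β + 1))) * Real.sqrt (theta P.K₀ ‖x‖)) •
        gradient (h (T - theta P.K₀ ‖x‖ + theta P.K₀ ‖x‖ * τ))
          (x + Real.sqrt (theta P.K₀ ‖x‖) • ξ) :=
  gradient_const_mul_comp_affine _ _ _ _ ((S.isHeat.c2 _ ht _ hx).differentiableAt (by simp))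

/-- The rescaled solution starts close to the flat one. -/
lemma tendsto_zoom_zero (S : Setup β F χ₀ Ω ψ Hs T t₀ P h) (R : ℝ) :
    Tendsto (fun q : E N × E N => zoom β P.K₀ T h q.1 0 q.2)
      (𝓝[≠] 0 ×ˢ 𝓟 (Metric.closedBall 0 R)) (𝓝 (kHat β P.K₀ 0)) := by
  have hβ := S.β_pos
  have hK := P.K₀_pos
  have hb := coeff_pos hβ
  obtain ⟨C, hC, hprof⟩ := S.exists_profile_bound
  set L : Filter (E N × E N) := 𝓝[≠] 0 ×ˢ 𝓟 (Metric.closedBall 0 R)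
  have hbase := kHat_base_pos (τ := 0) hβ hK zero_le_one
  have hPhi : Tendsto (fun q : E N × E N => Phi β (zoomVar P.K₀ q)) L (𝓝 (kHat β P.K₀ 0)⁻¹) := by
    have h1 : Tendsto (fun q : E N × E N =>
        β + 1 + (β + 1) ^ 2 / (4 * β) * ‖zoomVar P.K₀ q‖ ^ 2) L
        (𝓝 ((β + 1) * (1 - 0) + (β + 1) ^ 2 / (4 * β) * (P.K₀ ^ 2 / 16))) := by
      have := (((tendsto_norm_zoomVar (N := N) hK R).pow 2).const_mul
        ((β + 1) ^ 2 / (4 * β))).const_add (β + 1)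
      convert this using 2
      ring
    rw [kHat, ← Real.rpow_neg hbase.le]
    exact h1.rpow_const (Or.inl hbase.ne')
  have hrate : Tendsto (fun q : E N × E N => C * (Real.log (-Real.log (theta P.K₀ ‖q.1‖)) /
      -Real.log (theta P.K₀ ‖q.1‖))) L (𝓝 0) := by
    have := (tendsto_log_div_self.comp
      ((tendsto_neg_log_theta (N := N) hK).comp tendsto_fst) : Tendsto _ L _).const_mul C
    rwa [mul_zero] at this
  have hdiff : Tendsto (fun q : E N × E N => (zoom β P.K₀ T h q.1 0 q.2)⁻¹ -
      Phi β (zoomVar P.K₀ q)) L (𝓝 0) := by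
    refine squeeze_zero_norm' ?_ hrate
    rw [eventually_prod_principal_iff]
    filter_upwards [S.eventually_zoom_bounds R] with x hx ξ hξ
    obtain ⟨hθ0, hlog, ht, hΩ, -⟩ := hx
    have ht0 := ht 0 ⟨le_rfl, zero_lt_one⟩
    rw [mul_zero, add_zero] at ht0
    have h1 := hprof _ ⟨ht0.1.le, ht0.2⟩ _ (hΩ ξ (mem_closedBall_zero_iff.1 hξ))
    rw [sub_sub_cancel] at h1
    have h2 : zvar T (T - theta P.K₀ ‖x‖) (x + Real.sqrt (theta P.K₀ ‖x‖) • ξ) =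
        zoomVar P.K₀ (x, ξ) := by
      rw [zvar, scale, sub_sub_cancel, zoomVar, abs_of_neg (by linarith)]
    rw [h2] at h1
    rw [Real.norm_eq_abs, zoom, mul_zero, add_zero, mul_inv, Real.rpow_neg hθ0.le, inv_inv]
    exact h1
  have hinv := (hdiff.add hPhi).inv₀ (by
    rw [zero_add]; exact (inv_pos.2 (kHat_pos hβ hK zero_le_one)).ne')
  rw [zero_add, inv_inv] at hinv
  refine hinv.congr fun q => ?_
  rw [sub_add_cancel, inv_inv]

/-- The gradient of the rescaled solution starts close to a constant vector. -/
lemma tendsto_gradient_zoom_zero (S : Setup β F χ₀ Ω ψ Hs T t₀ P h) (R : ℝ) :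
    Tendsto (fun q : E N × E N => Real.sqrt (-Real.log (theta P.K₀ ‖q.1‖)) •
        gradient (zoom β P.K₀ T h q.1 0) q.2 - slopeHat β P.K₀ 0 • (‖q.1‖⁻¹ • q.1))
      (𝓝[≠] 0 ×ˢ 𝓟 (Metric.closedBall 0 R)) (𝓝 0) := by
  have hβ := S.β_pos
  have hK := P.K₀_pos
  have hb := coeff_pos hβ
  -- The similarity variable has norm tending to `K₀/4`, so `K₀/2` leaves a margin.
  obtain ⟨C, hC, hprof⟩ := S.exists_gradient_profile_near (K := P.K₀ / 2) (by positivity)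
  set L : Filter (E N × E N) := 𝓝[≠] 0 ×ˢ 𝓟 (Metric.closedBall 0 R)
  have hbase := kHat_base_pos (τ := 0) hβ hK zero_le_one
  set p := 1 / (β + 1) with hp
  set g : E N × E N → ℝ := fun q => (β + 1) / (2 * β) *
    (β + 1 + (β + 1) ^ 2 / (4 * β) * ‖zoomVar P.K₀ q‖ ^ 2) ^ (p - 1) with hg
  have hglim : Tendsto g L (𝓝 ((β + 1) / (2 * β) * kHat β P.K₀ 0 ^ (-β))) := by
    have h1 : Tendsto (fun q : E N × E N =>
        β + 1 + (β + 1) ^ 2 / (4 * β) * ‖zoomVar P.K₀ q‖ ^ 2) L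
        (𝓝 ((β + 1) * (1 - 0) + (β + 1) ^ 2 / (4 * β) * (P.K₀ ^ 2 / 16))) := by
      have := (((tendsto_norm_zoomVar (N := N) hK R).pow 2).const_mul
        ((β + 1) ^ 2 / (4 * β))).const_add (β + 1)
      convert this using 2
      ring
    have h3 : p - 1 = p * -β := by rw [hp]; field_simp; ring
    rw [kHat, ← hp, ← Real.rpow_mul hbase.le, ← h3]
    exact (h1.rpow_const (Or.inl hbase.ne')).const_mul _
  have hunit : ∀ᶠ q in L, ‖(P.K₀ / 4) • (‖q.1‖⁻¹ • q.1)‖ ≤ P.K₀ / 4 := by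
    refine Eventually.of_forall fun q => ?_
    rw [norm_smul, norm_smul, norm_inv, norm_norm, Real.norm_of_nonneg (by positivity)]
    exact mul_le_of_le_one_right (by positivity) (inv_mul_le_one)
  have hA : Tendsto (fun q => gradient (PhiHat β) (zoomVar P.K₀ q) -
      slopeHat β P.K₀ 0 • (‖q.1‖⁻¹ • q.1)) L (𝓝 0) := by
    have h1 : Tendsto (fun q => g q • (zoomVar P.K₀ q - (P.K₀ / 4) • (‖q.1‖⁻¹ • q.1))) L (𝓝 0) := by
      have := hglim.smul (tendsto_zoomVar (N := N) hK R)
      rwa [smul_zero] at this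
    have h2 : Tendsto (fun q : E N × E N => (g q - (β + 1) / (2 * β) * kHat β P.K₀ 0 ^ (-β)) •
        ((P.K₀ / 4) • (‖q.1‖⁻¹ • q.1))) L (𝓝 0) := by
      refine squeeze_zero_norm' (a := fun q =>
        ‖g q - (β + 1) / (2 * β) * kHat β P.K₀ 0 ^ (-β)‖ * (P.K₀ / 4)) ?_ ?_
      · filter_upwards [hunit] with q hq
        rw [norm_smul]
        exact mul_le_mul_of_nonneg_left hq (norm_nonneg _)
      · have := (tendsto_iff_norm_sub_tendsto_zero.1 hglim).mul_const (P.K₀ / 4)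
        rwa [zero_mul] at this
    have h3 := h1.add h2
    rw [add_zero] at h3
    refine h3.congr fun q => ?_
    rw [gradient_PhiHat hβ, slopeHat, smul_sub, sub_smul, sub_add_sub_cancel]
    congr 1
    rw [smul_smul]
    congr 1
    ring
  -- The gradient is multiplied by `√s`, so the rate `log s / s` becomes `log s / √s`, which still
  -- tends to `0`; a mere `o(1)` in the gradient profile would not be enough.
  have hrate : Tendsto (fun q : E N × E N => C * (Real.log (-Real.log (theta P.K₀ ‖q.1‖)) /
      Real.sqrt (-Real.log (theta P.K₀ ‖q.1‖)))) L (𝓝 0) := by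
    have h1 : Tendsto (fun s : ℝ => Real.log s / Real.sqrt s) atTop (𝓝 0) := by
      have := (isLittleO_log_rpow_atTop (show (0 : ℝ) < 1 / 2 by norm_num)).tendsto_div_nhds_zero
      refine this.congr fun s => ?_
      rw [Real.sqrt_eq_rpow]
    have := (h1.comp
      ((tendsto_neg_log_theta (N := N) hK).comp tendsto_fst) : Tendsto _ L _).const_mul C
    rwa [mul_zero] at this
  have hB : Tendsto (fun q : E N × E N => Real.sqrt (-Real.log (theta P.K₀ ‖q.1‖)) •
        gradient (zoom β P.K₀ T h q.1 0) q.2 - gradient (PhiHat β) (zoomVar P.K₀ q)) L (𝓝 0) := by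
    refine squeeze_zero_norm' ?_ hrate
    have hz : ∀ᶠ q : E N × E N in L, ‖zoomVar P.K₀ q‖ < P.K₀ / 2 :=
      (tendsto_norm_zoomVar hK R).eventually (gt_mem_nhds (by linarith))
    rw [eventually_prod_principal_iff] at hz ⊢
    filter_upwards [S.eventually_zoom_bounds R, hz, (tendsto_theta hK).eventually hprof]
      with x hx hz hprof ξ hξ
    obtain ⟨hθ0, hlog, ht, hΩ, -⟩ := hx
    have hz := hz ξ hξ
    have ht0 := ht 0 ⟨le_rfl, zero_lt_one⟩
    rw [S.gradient_zoom ht0 (hΩ ξ (mem_closedBall_zero_iff.1 hξ)), mul_zero, add_zero]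
    set θ := theta P.K₀ ‖x‖ with hθ
    set s := -Real.log θ with hs
    have hss : 0 < Real.sqrt s := Real.sqrt_pos.2 (by linarith)
    have hsc : 0 < Real.sqrt (θ * s) := Real.sqrt_pos.2 (by positivity)
    have hzd : zoomVar P.K₀ (x, ξ) = (Real.sqrt (θ * s))⁻¹ • (x + Real.sqrt θ • ξ) := rfl
    have h1 := hprof (x + Real.sqrt θ • ξ) (by
      rw [hzd, norm_smul, norm_inv, Real.norm_of_nonneg hsc.le, inv_mul_lt_iff₀ hsc] at hz
      linarith)
    rw [← hzd] at h1
    have h2 : Real.sqrt s • (θ ^ (-p) * Real.sqrt θ) • gradient (h (T - θ)) (x + Real.sqrt θ • ξ) -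
        gradient (PhiHat β) (zoomVar P.K₀ (x, ξ)) = Real.sqrt s •
        ((θ ^ (-p) * Real.sqrt θ) • gradient (h (T - θ)) (x + Real.sqrt θ • ξ) -
          (Real.sqrt s)⁻¹ • gradient (PhiHat β) (zoomVar P.K₀ (x, ξ))) := by
      rw [smul_sub, smul_inv_smul₀ hss.ne']
    rw [h2, norm_smul, Real.norm_of_nonneg hss.le]
    refine (mul_le_mul_of_nonneg_left h1 hss.le).trans (le_of_eq ?_)
    have h3 : s = Real.sqrt s * Real.sqrt s := (Real.mul_self_sqrt (by linarith)).symm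
    have h4 : Real.log s / s = Real.log s / (Real.sqrt s * Real.sqrt s) := by rw [← h3]
    rw [h4]
    field_simp
  have h3 := hB.add hA
  rw [add_zero] at h3
  refine h3.congr fun q => ?_
  rw [sub_add_sub_cancel]

end Setup

/-! ### Propagation in the intermediate region -/

/-- A radius so large that the lateral term of `IsHeat.abs_le_center` is at most `ε` over unit time;
for `R = 1 + A` it suffices that `A ≤ (1 + A)²`. -/
lemma exists_radius (N : ℕ) {M ε : ℝ} (hM : 0 ≤ M) (hε : 0 < ε) :
    ∃ R > 0, M / R ^ 2 * (2 * N) ≤ ε := by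
  set A := 2 * N * M / ε with hA
  have hA0 : 0 ≤ A := by positivity
  refine ⟨1 + A, by positivity, ?_⟩
  rw [div_mul_eq_mul_div, div_le_iff₀ (by positivity)]
  have h1 : M * (2 * N) = ε * A := by rw [hA]; field_simp
  rw [h1]
  exact mul_le_mul_of_nonneg_left (by nlinarith) hε.le

/-- Initial, source and lateral errors contribute at most `ε` each on a time interval of length at
most `1`, which explains the `3`. -/
lemma IsHeat.abs_le_of_le_one {D f : ℝ → E N → ℝ} {b R L ε M : ℝ} {x₀ : E N} (hR : 0 < R)
    (hL : 0 ≤ L) (hε : 0 ≤ ε) (hM : 0 ≤ M) (hb1 : b ≤ 1) (hRM : M / R ^ 2 * (2 * N) ≤ ε)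
    (h : IsHeat (Icc 0 b) (Metric.closedBall x₀ R) D f)
    (hf : ∀ t ∈ Icc 0 b, ∀ x ∈ Metric.closedBall x₀ R, |f t x| ≤ L * |D t x| + ε)
    (hb : ∀ t ∈ Icc 0 b, ∀ x ∈ Metric.closedBall x₀ R, |D t x| ≤ M)
    (hi : ∀ x ∈ Metric.closedBall x₀ R, |D 0 x| ≤ ε) :
    ∀ t ∈ Icc 0 b, |D t x₀| ≤ Real.exp L * (3 * ε) := by
  intro t ht
  refine (h.abs_le_center hR hL hε hε hM hf hb hi t ht).trans ?_
  have ht0 : 0 ≤ t := ht.1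
  have ht1 : t ≤ 1 := ht.2.trans hb1
  rw [sub_zero]
  have hRM0 : 0 ≤ M / R ^ 2 * (2 * N) := by positivity
  refine mul_le_mul (Real.exp_le_exp.2 (mul_le_of_le_one_right hL ht1)) ?_ ?_ (Real.exp_pos _).le
  · have h1 : ε * t ≤ ε := mul_le_of_le_one_right hε ht1
    have h2 : M / R ^ 2 * (2 * N * t) ≤ ε := by
      rw [← mul_assoc]
      exact (mul_le_of_le_one_right hRM0 ht1).trans hRM
    linarith
  · positivity

namespace Setup

variable {β : ℝ} {F χ₀ : ℝ → ℝ} {Ω : Set (E N)} {ψ Hs : E N → ℝ} {T t₀ : ℝ} {P : Params}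
  {h : ℝ → E N → ℝ}

lemma mem_Icc_of_abs_sub_kHat_le (S : Setup β F χ₀ Ω ψ Hs T t₀ P h) {τ v : ℝ}
    (hτ : τ ∈ Ico (0 : ℝ) 1) (hv : |v - kHat β P.K₀ τ| ≤ P.δ₀) :
    v ∈ Icc (kHat β P.K₀ 1 / 2) (kHat β P.K₀ 0 + P.δ₀) := by
  have h1 := kHat_anti (K₀ := P.K₀) S.β_pos P.K₀_pos hτ.1 hτ.2.le
  have h2 := kHat_anti (K₀ := P.K₀) S.β_pos P.K₀_pos hτ.2.le le_rfl
  have h3 := S.δ₀_le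
  have h4 := abs_le.1 hv
  exact ⟨by linarith [h4.1], by linarith [h4.2]⟩

/-- The rescaled solution follows the flat one. -/
theorem eventually_zoom_le (S : Setup β F χ₀ Ω ψ Hs T t₀ P h) (R : ℝ) {ε : ℝ} (hε : 0 < ε) :
    ∀ᶠ x : E N in 𝓝[≠] 0, ∀ τ ∈ Ico (0 : ℝ) 1, ∀ ξ : E N, ‖ξ‖ ≤ R →
      |zoom β P.K₀ T h x τ ξ - kHat β P.K₀ τ| ≤ ε := by
  have hβ := S.β_pos
  have hK := P.K₀_pos
  set c := kHat β P.K₀ 1 / 2 with hc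
  have hcpos : 0 < c := half_pos (kHat_pos hβ hK le_rfl)
  set C := kHat β P.K₀ 0 + P.δ₀ with hC
  obtain ⟨-, L, -, hL0, -, hL⟩ := exists_bound_lipschitz_of_smooth (F := fun v : ℝ => v ^ (-β))
    (contDiffOn_id.rpow_const_of_ne fun x hx => ne_of_gt hx) (c := c) (C := C) hcpos
  set ε' := ε / (3 * Real.exp L) with hε'd
  have hε' : 0 < ε' := div_pos hε (by positivity)
  -- The a priori bound `δ₀` need not be small: it enters only through the lateral boundary and is
  -- damped by the size of the ball.
  obtain ⟨R', hR', hRM⟩ := exists_radius N P.δ₀_pos.le hε'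
  have hinit : ∀ᶠ q : E N × E N in 𝓝[≠] 0 ×ˢ 𝓟 (Metric.closedBall 0 (R + R')),
      |zoom β P.K₀ T h q.1 0 q.2 - kHat β P.K₀ 0| ≤ ε' := by
    have := (S.tendsto_zoom_zero (R + R')).eventually
      (Metric.closedBall_mem_nhds (kHat β P.K₀ 0) hε')
    exact this
  rw [eventually_prod_principal_iff] at hinit
  filter_upwards [S.eventually_zoom_bounds (R + R'), hinit,
    (tendsto_theta hK).eventually (S.nonlin.eventually_scaledErr_le hβ (C := C) hcpos hε')]
    with x hx hinit herr τ hτ ξ hξ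
  obtain ⟨hθ0, hlog, ht, hΩ, hbd⟩ := hx
  have hball : ∀ y ∈ Metric.closedBall ξ R', ‖y‖ ≤ R + R' := by
    intro y hy
    have h1 : ‖y - ξ‖ ≤ R' := by rw [← dist_eq_norm]; exact hy
    have h2 := norm_le_norm_add_norm_sub ξ y
    rw [norm_sub_rev] at h2
    linarith
  have hI : ∀ t ∈ Icc 0 τ, t ∈ Ico (0 : ℝ) 1 := fun t h => ⟨h.1, h.2.trans_lt hτ.2⟩
  have hD := (S.isHeat_zoom (J := Icc 0 τ) (O := Metric.closedBall ξ R') hθ0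
    (fun t h => ht t (hI t h)) (fun y hy => hΩ y (hball y hy))).sub
    (isHeat_of_hasDerivAt (g := kHat β P.K₀) (I := Icc 0 τ) (Metric.closedBall ξ R')
      fun t h => hasDerivAt_kHat hβ hK (hI t h).2.le)
  have key := hD.abs_le_of_le_one hR' hL0 hε'.le P.δ₀_pos.le hτ.2.le hRM ?_ ?_ ?_ τ
    ⟨hτ.1, le_rfl⟩
  · refine key.trans (le_of_eq ?_)
    rw [hε'd]; have := (Real.exp_pos L).ne'; field_simp
  · intro t h y hy
    have hk := S.mem_Icc_of_abs_sub_kHat_le (hI t h) (hbd t (hI t h) y (hball y hy)).1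
    have hk' := S.mem_Icc_of_abs_sub_kHat_le (v := kHat β P.K₀ t) (hI t h)
      (by rw [sub_self, abs_zero]; exact P.δ₀_pos.le)
    have h1 := hL _ hk _ hk'
    have h2 := herr _ hk
    set k := zoom β P.K₀ T _ x t y
    have h3 : -scaledF β F (theta P.K₀ ‖x‖) k - -kHat β P.K₀ t ^ (-β) =
        -(k ^ (-β) - kHat β P.K₀ t ^ (-β)) - scaledErr β F (theta P.K₀ ‖x‖) k := by
      rw [scaledErr]; ring
    rw [h3]
    refine (abs_sub _ _).trans ?_
    rw [abs_neg]
    exact add_le_add h1 h2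
  · exact fun t h y hy => (hbd t (hI t h) y (hball y hy)).1
  · exact fun y hy => hinit y (mem_closedBall_zero_iff.2 (hball y hy))

lemma differentiableAt_zoom (S : Setup β F χ₀ Ω ψ Hs T t₀ P h) {x ξ : E N} {τ : ℝ}
    (hθ : 0 < theta P.K₀ ‖x‖)
    (ht : T - theta P.K₀ ‖x‖ + theta P.K₀ ‖x‖ * τ ∈ Ioo t₀ T)
    (hx : x + Real.sqrt (theta P.K₀ ‖x‖) • ξ ∈ Ω) :
    DifferentiableAt ℝ (zoom β P.K₀ T h x τ) ξ :=
  ((S.isHeat_zoom (J := {τ}) (O := {ξ}) hθ (by simpa using ht) (by simpa using hx)).c2 τ rfl ξ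
    rfl).differentiableAt (by simp)

end Setup

lemma abs_sub_le_of_norm_gradient_le {f : E N → ℝ} {r C : ℝ}
    (hd : ∀ y ∈ Metric.closedBall (0 : E N) r, DifferentiableAt ℝ f y)
    (hg : ∀ y ∈ Metric.closedBall (0 : E N) r, ‖gradient f y‖ ≤ C) {a b : E N}
    (ha : a ∈ Metric.closedBall (0 : E N) r) (hb : b ∈ Metric.closedBall (0 : E N) r) :
    |f b - f a| ≤ C * ‖b - a‖ :=
  (convex_closedBall (0 : E N) r).norm_image_sub_le_of_norm_fderiv_le hd
    (fun y hy => by rw [← norm_gradient_eq]; exact hg y hy) ha hb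

lemma gradient_const_mul_sub_inner {f : E N → ℝ} {y : E N} (hf : DifferentiableAt ℝ f y)
    (a b : ℝ) (u : E N) :
    gradient (fun y => a * f y - b * inner ℝ u y) y = a • gradient f y - b • u := by
  have h1 : HasGradientAt f (gradient f y) y := hf.hasGradientAt
  rw [hasGradientAt_iff_hasFDerivAt] at h1
  refine HasGradientAt.gradient ?_
  rw [hasGradientAt_iff_hasFDerivAt]
  have h2 : HasFDerivAt (fun y : E N => inner ℝ u y) (innerSL ℝ u) y :=
    (innerSL ℝ u).hasFDerivAt
  refine ((h1.const_mul a).sub (h2.const_mul b)).congr_fderiv ?_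
  ext v
  simp

lemma norm_le_of_forall_inner_le {v : E N} {ε : ℝ} (hε : 0 ≤ ε)
    (hv : ∀ e : E N, ‖e‖ = 1 → |inner ℝ v e| ≤ ε) : ‖v‖ ≤ ε := by
  rcases eq_or_ne v 0 with rfl | h0
  · simpa using hε
  have hn : 0 < ‖v‖ := norm_pos_iff.2 h0
  have h1 := hv (‖v‖⁻¹ • v) (by rw [norm_smul, norm_inv, norm_norm, inv_mul_cancel₀ hn.ne'])
  rw [inner_smul_right, real_inner_self_eq_norm_sq, sq, inv_mul_cancel_left₀ hn.ne', abs_norm] at h1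
  exact h1

/-- A bound on the quotients uniform in the step survives the limit. The increments solve a
difference of two equations, whereas a derivative of a merely `C²` solution need not solve the
differentiated one classically. -/
lemma abs_inner_gradient_le_of_difference {f : E N → ℝ} {y e : E N} {a b ε : ℝ}
    (hf : DifferentiableAt ℝ f y)
    (h : ∀ η ∈ Ioc (0 : ℝ) 1, |a / η * (f (y + η • e) - f y) - b| ≤ ε) :
    |a * inner ℝ (gradient f y) e - b| ≤ ε := by
  have h1 : HasDerivAt (fun η : ℝ => f (y + η • e)) (inner ℝ (gradient f y) e) 0 := by
    rw [inner_gradient]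
    have h2 := hasDerivAt_line y e 0
    have h3 : HasFDerivAt f (fderiv ℝ f y) (y + (0 : ℝ) • e) := by
      rw [zero_smul, add_zero]; exact hf.hasFDerivAt
    exact h3.comp_hasDerivAt (0 : ℝ) h2
  have h4 := (hasDerivAt_iff_tendsto_slope.1 h1).mono_left
    (nhdsWithin_mono (0 : ℝ) (s := Ioi 0) fun r hr => ne_of_gt hr)
  have h5 := ((h4.const_mul a).sub_const b).abs
  refine le_of_tendsto h5 ?_
  filter_upwards [Ioc_mem_nhdsGT (zero_lt_one' ℝ)] with η hη
  have h6 := h η hη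
  rw [slope_def_field]
  simp only [sub_zero, zero_smul, add_zero]
  rwa [mul_div_assoc', ← div_mul_eq_mul_div]

namespace Setup

variable {β : ℝ} {F χ₀ : ℝ → ℝ} {Ω : Set (E N)} {ψ Hs : E N → ℝ} {T t₀ : ℝ} {P : Params}
  {h : ℝ → E N → ℝ}

lemma slopeHat_nonneg {K₀ τ : ℝ} (hβ : 0 < β) (hK : 0 < K₀) (hτ : τ ≤ 1) :
    0 ≤ slopeHat β K₀ τ := by
  have := Real.rpow_pos_of_pos (kHat_pos hβ hK hτ) (-β)
  unfold slopeHat; positivity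

lemma slopeHat_le {K₀ τ : ℝ} (hβ : 0 < β) (hK : 0 < K₀) (hτ : τ ≤ 1) :
    slopeHat β K₀ τ ≤ slopeHat β K₀ 1 :=
  mul_le_mul_of_nonneg_left (Real.rpow_le_rpow_of_nonpos (kHat_pos hβ hK le_rfl)
    (kHat_anti hβ hK hτ le_rfl) (by linarith)) (by positivity)

/-- The linearised nonlinearity along the flat solution. -/
lemma eventually_scaledF_linear (S : Setup β F χ₀ Ω ψ Hs T t₀ P h) {μ : ℝ} (hμ : 0 < μ) :
    ∃ ε > 0, ∀ᶠ l in 𝓝[>] (0 : ℝ), ∀ τ ∈ Ico (0 : ℝ) 1, ∀ v w : ℝ,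
      |v - kHat β P.K₀ τ| ≤ ε → |w - kHat β P.K₀ τ| ≤ ε →
      |scaledF β F l v - scaledF β F l w + β * kHat β P.K₀ τ ^ (-(β + 1)) * (v - w)| ≤
        μ * |v - w| := by
  have hβ := S.β_pos
  have hK := P.K₀_pos
  set c := kHat β P.K₀ 1 / 2 with hc
  have hcpos : 0 < c := half_pos (kHat_pos hβ hK le_rfl)
  set C := kHat β P.K₀ 0 + P.δ₀ with hC
  obtain ⟨-, L, -, hL0, -, hL⟩ := exists_bound_lipschitz_of_smooth
    (F := fun v : ℝ => v ^ (-(β + 1)))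
    (contDiffOn_id.rpow_const_of_ne fun x hx => ne_of_gt hx) (c := c) (C := C) hcpos
  have hd : 0 < β * L + 1 := by positivity
  -- `δ₀` keeps the values in `[c, C]`; the second term makes the variation of `β r^{-(β+1)}` about
  -- `k̂` at most `μ/2`, the other half being left to the derivative of the deviation.
  set ε := min P.δ₀ (μ / 2 / (β * L + 1)) with hε
  refine ⟨ε, lt_min P.δ₀_pos (by positivity), ?_⟩
  filter_upwards [S.nonlin.eventually_hasDerivAt_scaledF hβ (c := c) (C := C) (ε := μ / 2) hcpos
    (by positivity)] with l hl τ hτ v w hv hw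
  set k := kHat β P.K₀ τ with hk
  have hmem : ∀ r ∈ Metric.closedBall k ε, r ∈ Icc c C := fun r hr =>
    S.mem_Icc_of_abs_sub_kHat_le hτ ((show |r - k| ≤ ε from hr).trans (min_le_left _ _))
  have hkm : k ∈ Icc c C := S.mem_Icc_of_abs_sub_kHat_le hτ
    (by rw [← hk, sub_self, abs_zero]; exact P.δ₀_pos.le)
  choose! d hd1 hd2 using hl
  have key := (convex_closedBall k ε).norm_image_sub_le_of_norm_hasDerivWithin_le
    (f := fun r => scaledF β F l r + β * k ^ (-(β + 1)) * r)
    (f' := fun r => d r + β * k ^ (-(β + 1))) (C := μ)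
    (fun r hr => (((hd1 r (hmem r hr)).add ((hasDerivAt_id' r).const_mul
      (β * k ^ (-(β + 1))))).congr_deriv (by ring)).hasDerivWithinAt)
    (fun r hr => ?_) (x := w) (y := v) hw hv
  · rw [Real.norm_eq_abs, Real.norm_eq_abs] at key
    refine le_trans (le_of_eq ?_) key
    congr 1; ring
  · have h1 := hd2 r (hmem r hr)
    have h2 := hL r (hmem r hr) k hkm
    have h3 : |r - k| ≤ μ / 2 / (β * L + 1) := (show |r - k| ≤ ε from hr).trans (min_le_right _ _)
    have h4 : d r + β * k ^ (-(β + 1)) =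
        (d r + β * r ^ (-(β + 1))) - β * (r ^ (-(β + 1)) - k ^ (-(β + 1))) := by ring
    rw [Real.norm_eq_abs, h4]
    refine (abs_sub _ _).trans ?_
    rw [abs_mul, abs_of_pos hβ]
    have h5 : β * |r ^ (-(β + 1)) - k ^ (-(β + 1))| ≤ μ / 2 := by
      calc β * |r ^ (-(β + 1)) - k ^ (-(β + 1))| ≤ β * (L * (μ / 2 / (β * L + 1))) :=
            mul_le_mul_of_nonneg_left (h2.trans (mul_le_mul_of_nonneg_left h3 hL0)) hβ.le
        _ = (β * L) / (β * L + 1) * (μ / 2) := by field_simp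
        _ ≤ 1 * (μ / 2) := mul_le_mul_of_nonneg_right
            ((div_le_one hd).2 (by linarith)) (by positivity)
        _ = μ / 2 := one_mul _
    linarith

set_option maxHeartbeats 1000000 in
/-- The gradient of the rescaled solution follows the linearised flow. -/
theorem eventually_gradient_zoom_le (S : Setup β F χ₀ Ω ψ Hs T t₀ P h) {ε : ℝ} (hε : 0 < ε) :
    ∀ᶠ x : E N in 𝓝[≠] 0, ∀ τ ∈ Ico (0 : ℝ) 1,
      ‖Real.sqrt (-Real.log (theta P.K₀ ‖x‖)) • gradient (zoom β P.K₀ T h x τ) 0 -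
        slopeHat β P.K₀ τ • (‖x‖⁻¹ • x)‖ ≤ ε := by
  have hβ := S.β_pos
  have hK := P.K₀_pos
  set L := β * kHat β P.K₀ 1 ^ (-(β + 1)) with hLd
  have hk1 := kHat_pos (K₀ := P.K₀) hβ hK le_rfl
  have hL0 : 0 ≤ L := by have := Real.rpow_pos_of_pos hk1 (-(β + 1)); positivity
  have hLle : ∀ τ ∈ Ico (0 : ℝ) 1, β * kHat β P.K₀ τ ^ (-(β + 1)) ≤ L := fun τ hτ =>
    mul_le_mul_of_nonneg_left (Real.rpow_le_rpow_of_nonpos hk1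
      (kHat_anti hβ hK hτ.2.le le_rfl) (by linarith)) hβ.le
  have hCp := P.C₀_pos
  set M := P.C₀ + slopeHat β P.K₀ 1 with hM
  have hM0 : 0 ≤ M := by have := slopeHat_nonneg (K₀ := P.K₀) hβ hK le_rfl; positivity
  set ε' := ε / (3 * Real.exp L) with hε'd
  have hε' : 0 < ε' := div_pos hε (by positivity)
  -- `M` bounds the normalised quotient by `C₀`, from the gradient bound of the second region, plus
  -- the largest slope `slopeHat β K₀ 1`.
  obtain ⟨R, hR, hRM⟩ := exists_radius N hM0 hε'
  -- The linearisation error is proportional to the increment, and the normalised increment is at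
  -- most `C₀`, so its contribution is at most `ε'`.
  obtain ⟨εk, hεk, hlin⟩ := S.eventually_scaledF_linear (μ := ε' / P.C₀) (by positivity)
  have hinit : ∀ᶠ q : E N × E N in 𝓝[≠] 0 ×ˢ 𝓟 (Metric.closedBall 0 (R + 1)),
      ‖Real.sqrt (-Real.log (theta P.K₀ ‖q.1‖)) •
        gradient (zoom β P.K₀ T h q.1 0) q.2 - slopeHat β P.K₀ 0 • (‖q.1‖⁻¹ • q.1)‖ ≤ ε' := by
    have := (S.tendsto_gradient_zoom_zero (R + 1)).eventually
      (Metric.closedBall_mem_nhds (0 : E N) hε')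
    filter_upwards [this] with q hq
    exact mem_closedBall_zero_iff.1 hq
  rw [eventually_prod_principal_iff] at hinit
  filter_upwards [S.eventually_zoom_bounds (R + 1), hinit, S.eventually_zoom_le (R + 1) hεk,
    (tendsto_theta hK).eventually hlin] with x hx hinit hclose hlin τ hτ
  obtain ⟨hθ0, hlog, ht, hΩ, hbd⟩ := hx
  set θ := theta P.K₀ ‖x‖ with hθ
  set s := -Real.log θ with hs
  have hss : 0 < Real.sqrt s := Real.sqrt_pos.2 (by linarith)
  set u := ‖x‖⁻¹ • x with hu
  have hun : ‖u‖ ≤ 1 := by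
    rw [hu, norm_smul, norm_inv, norm_norm]; exact inv_mul_le_one
  set k := zoom β P.K₀ T h x with hkd
  have hI : ∀ t ∈ Icc 0 τ, t ∈ Ico (0 : ℝ) 1 := fun t h => ⟨h.1, h.2.trans_lt hτ.2⟩
  have hBn : ∀ y ∈ Metric.closedBall (0 : E N) (R + 1), ‖y‖ ≤ R + 1 :=
    fun y hy => mem_closedBall_zero_iff.1 hy
  have hdiff : ∀ t ∈ Ico (0 : ℝ) 1, ∀ y ∈ Metric.closedBall (0 : E N) (R + 1),
      DifferentiableAt ℝ (k t) y := fun t h y hy =>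
    S.differentiableAt_zoom hθ0 (ht t h) (hΩ y (hBn y hy))
  have h0B : (0 : E N) ∈ Metric.closedBall (0 : E N) (R + 1) :=
    Metric.mem_closedBall_self (by linarith)
  refine norm_le_of_forall_inner_le hε.le fun e he => ?_
  set ι := inner ℝ u e with hι
  have hι1 : |ι| ≤ 1 := (abs_real_inner_le_norm u e).trans (by rw [he, mul_one]; exact hun)
  rw [inner_sub_left, inner_smul_left, inner_smul_left]
  simp only [conj_trivial]
  refine abs_inner_gradient_le_of_difference (hdiff τ hτ 0 h0B) fun η hη => ?_
  have hη0 : 0 < η := hη.1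
  have hηe : ‖η • e‖ = η := by rw [norm_smul, he, mul_one, Real.norm_of_nonneg hη0.le]
  have hB₁ : ∀ y ∈ Metric.closedBall (0 : E N) R, y ∈ Metric.closedBall (0 : E N) (R + 1) :=
    fun y hy => Metric.closedBall_subset_closedBall (by linarith) hy
  have hB₂ : ∀ y ∈ Metric.closedBall (0 : E N) R,
      y + η • e ∈ Metric.closedBall (0 : E N) (R + 1) := by
    intro y hy
    rw [mem_closedBall_zero_iff] at hy ⊢
    have := norm_add_le y (η • e)
    rw [hηe] at this
    linarith [hη.2]
  have hH := S.isHeat_zoom (J := Icc 0 τ) (O := Metric.closedBall 0 (R + 1)) hθ0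
    (fun t h => ht t (hI t h)) (fun y hy => hΩ y (hBn y hy))
  -- The quotient with step `η ≤ 1`, normalised by `√s`, minus the linearised flow times `⟨u, e⟩`.
  -- The ball of radius `R + 1` accommodates the translate, and the bounds do not depend on `η`.
  have hD := (((hH.translate (O' := Metric.closedBall 0 R) (η • e) hB₂).sub
    (hH.mono (O' := Metric.closedBall 0 R) le_rfl hB₁)).const_mul (Real.sqrt s / η)).sub
    (isHeat_of_hasDerivAt (g := fun t => slopeHat β P.K₀ t * ι) (I := Icc 0 τ)
      (Metric.closedBall 0 R) fun t h =>
        (hasDerivAt_slopeHat hβ hK (hI t h).2.le).mul_const ι)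
  have hV : ∀ t ∈ Icc 0 τ, ∀ y ∈ Metric.closedBall (0 : E N) R,
      Real.sqrt s / η * |k t (y + η • e) - k t y| ≤ P.C₀ := by
    intro t h y hy
    have h1 := abs_sub_le_of_norm_gradient_le (hdiff t (hI t h))
      (fun z hz => (hbd t (hI t h) z (hBn z hz)).2) (hB₁ y hy) (hB₂ y hy)
    rw [add_sub_cancel_left, hηe] at h1
    calc Real.sqrt s / η * |k t (y + η • e) - k t y| ≤
          Real.sqrt s / η * (P.C₀ / Real.sqrt s * η) :=
          mul_le_mul_of_nonneg_left h1 (by positivity)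
      _ = P.C₀ := by field_simp
  have hq0 : 0 ≤ Real.sqrt s / η := by positivity
  have key := hD.abs_le_of_le_one (M := M) hR hL0 hε'.le hM0 hτ.2.le hRM ?_ ?_ ?_ τ ⟨hτ.1, le_rfl⟩
  · refine key.trans (le_of_eq ?_)
    rw [hε'd]; have := (Real.exp_pos L).ne'; field_simp
  · intro t h y hy
    have h1 := hlin t (hI t h) (k t (y + η • e)) (k t y)
      (hclose t (hI t h) _ (hBn _ (hB₂ y hy))) (hclose t (hI t h) _ (hBn _ (hB₁ y hy)))
    have h2 := hV t h y hy
    have h3 := hLle t (hI t h)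
    have h4 : 0 ≤ β * kHat β P.K₀ t ^ (-(β + 1)) := by
      have := Real.rpow_pos_of_pos (kHat_pos (K₀ := P.K₀) hβ hK (hI t h).2.le) (-(β + 1))
      positivity
    change |Real.sqrt s / η * (-scaledF β F θ (k t (y + η • e)) - -scaledF β F θ (k t y)) -
      β * kHat β P.K₀ t ^ (-(β + 1)) * slopeHat β P.K₀ t * ι| ≤
      L * |Real.sqrt s / η * (k t (y + η • e) - k t y) - slopeHat β P.K₀ t * ι| + ε'
    set v := k t (y + η • e)
    set w := k t y
    set B := β * kHat β P.K₀ t ^ (-(β + 1))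
    set Q := Real.sqrt s / η
    have h5 : Q * (-scaledF β F θ v - -scaledF β F θ w) - B * slopeHat β P.K₀ t * ι =
        B * (Q * (v - w) - slopeHat β P.K₀ t * ι) -
          Q * (scaledF β F θ v - scaledF β F θ w + B * (v - w)) := by ring
    rw [h5]
    refine (abs_sub _ _).trans (add_le_add ?_ ?_)
    · rw [abs_mul, abs_of_nonneg h4]
      exact mul_le_mul_of_nonneg_right h3 (abs_nonneg _)
    · rw [abs_mul, abs_of_nonneg hq0]
      calc Q * |scaledF β F θ v - scaledF β F θ w + B * (v - w)| ≤ Q * (ε' / P.C₀ * |v - w|) :=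
            mul_le_mul_of_nonneg_left h1 hq0
        _ = ε' / P.C₀ * (Q * |v - w|) := by ring
        _ ≤ ε' / P.C₀ * P.C₀ := mul_le_mul_of_nonneg_left h2 (by positivity)
        _ = ε' := div_mul_cancel₀ _ hCp.ne'
  · intro t h y hy
    have h2 := hV t h y hy
    refine (abs_sub _ _).trans (add_le_add ?_ ?_)
    · rw [abs_mul, abs_of_nonneg hq0]; exact h2
    · have h6 := slopeHat_nonneg (K₀ := P.K₀) hβ hK (hI t h).2.le
      rw [abs_mul, abs_of_nonneg h6]
      exact (mul_le_of_le_one_right h6 hι1).trans (slopeHat_le hβ hK (hI t h).2.le)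
  · intro y hy
    have h00 : (0 : ℝ) ∈ Ico (0 : ℝ) 1 := ⟨le_rfl, one_pos⟩
    -- At `τ = 0` the normalised solution minus its linear limit has gradient at most `ε'`, so its
    -- quotients are at most `ε'` whatever the step.
    have h1 := abs_sub_le_of_norm_gradient_le (r := R + 1) (C := ε')
      (f := fun y => Real.sqrt s * k 0 y - slopeHat β P.K₀ 0 * inner ℝ u y)
      (fun z hz => ((hdiff 0 h00 z hz).const_mul _).sub
        ((innerSL ℝ u).differentiableAt.const_mul _))
      (fun z hz => by
        rw [gradient_const_mul_sub_inner (hdiff 0 h00 z hz)]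
        exact hinit z hz) (hB₁ y hy) (hB₂ y hy)
    rw [add_sub_cancel_left, hηe, inner_add_right, inner_smul_right, ← hι] at h1
    change |Real.sqrt s / η * (k 0 (y + η • e) - k 0 y) - slopeHat β P.K₀ 0 * ι| ≤ ε'
    have h2 : Real.sqrt s / η * (k 0 (y + η • e) - k 0 y) - slopeHat β P.K₀ 0 * ι =
        (Real.sqrt s * k 0 (y + η • e) - slopeHat β P.K₀ 0 * (inner ℝ u y + η * ι) -
          (Real.sqrt s * k 0 y - slopeHat β P.K₀ 0 * inner ℝ u y)) / η := by
      field_simp; ring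
    rw [h2, abs_div, abs_of_pos hη0, div_le_iff₀ hη0]
    exact h1

end Setup

/-! ### The final profile -/

lemma isEquivalent_of_smul {α V : Type*} [NormedAddCommGroup V] [NormedSpace ℝ V] {l : Filter α}
    {f g : α → V} {m : α → ℝ} {c : ℝ} (hc : 0 < c) (hm : ∀ᶠ x in l, 0 < m x)
    (h1 : Tendsto (fun x => m x • f x - m x • g x) l (𝓝 0))
    (h2 : Tendsto (fun x => ‖m x • g x‖) l (𝓝 c)) : f ~[l] g := by
  rw [IsEquivalent, isLittleO_iff]
  intro ε hε
  have h3 : ∀ᶠ x in l, ‖m x • f x - m x • g x‖ < ε * (c / 2) := by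
    have := (tendsto_zero_iff_norm_tendsto_zero.1 h1).eventually
      (gt_mem_nhds (show 0 < ε * (c / 2) by positivity))
    exact this
  filter_upwards [hm, h3, h2.eventually (lt_mem_nhds (half_lt_self hc))] with x hm h3 h4
  rw [← smul_sub, norm_smul, Real.norm_of_nonneg hm.le] at h3
  rw [norm_smul, Real.norm_of_nonneg hm.le] at h4
  have h5 : m x * ‖f x - g x‖ ≤ m x * (ε * ‖g x‖) := by
    have := mul_lt_mul_of_pos_left h4 hε
    linarith
  exact le_of_mul_le_mul_left h5 hm

/-- Taking logarithms in `|x| = (K₀/4)√(θs)` with `s = -log θ` gives `2|log|x|| = s - log s - 2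
log(K₀/4)`. -/
lemma tendsto_log_theta_div {K₀ : ℝ} (hK : 0 < K₀) :
    Tendsto (fun x : E N => -Real.log (theta K₀ ‖x‖) / (2 * |Real.log ‖x‖|)) (𝓝[≠] 0) (𝓝 1) := by
  have hs := tendsto_neg_log_theta (N := N) hK
  have h1 : Tendsto (fun s : ℝ => 1 - Real.log s / s - 2 * Real.log (K₀ / 4) / s) atTop (𝓝 1) := by
    have := (tendsto_log_div_self.const_sub 1).sub
      ((tendsto_const_nhds (x := 2 * Real.log (K₀ / 4))).div_atTop tendsto_id)
    simpa using this
  have h2 := (h1.comp hs).inv₀ one_ne_zero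
  rw [inv_one] at h2
  refine h2.congr' ?_
  have hc : 0 < min (1 / 2) (K₀ / 4 * Real.sqrt (Real.exp (-1))) :=
    lt_min (by norm_num) (by positivity)
  filter_upwards [eventually_norm_le hc] with x hx
  obtain ⟨hx0, hx1⟩ := hx
  have hx2 := hx1.trans (min_le_right _ _)
  have hx3 := hx1.trans (min_le_left _ _)
  obtain ⟨hθ0, hθ1, -⟩ := theta_spec hK hx0 hx2
  have hsq := sqrt_theta_mul hK hx0 hx2
  simp only [Function.comp_def]
  set θ := theta K₀ ‖x‖
  set s := -Real.log θ with hsd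
  have hs1 : 1 ≤ s := by
    have : Real.log θ ≤ -1 := (Real.log_le_iff_le_exp hθ0).2 hθ1
    linarith
  have hs0 : 0 < s := by linarith
  have hxe : ‖x‖ = K₀ / 4 * Real.sqrt (θ * s) := by rw [hsq]; field_simp
  have hlog : Real.log ‖x‖ = Real.log (K₀ / 4) + (-s + Real.log s) / 2 := by
    rw [hxe, Real.log_mul (by positivity) (Real.sqrt_pos.2 (by positivity)).ne',
      Real.log_sqrt (by positivity), Real.log_mul hθ0.ne' hs0.ne', hsd]
    ring
  have hneg : Real.log ‖x‖ < 0 := Real.log_neg hx0 (by linarith)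
  have h3 : 2 * |Real.log ‖x‖| = s * (1 - Real.log s / s - 2 * Real.log (K₀ / 4) / s) := by
    rw [abs_of_neg hneg, hlog]; field_simp; ring
  rw [h3]
  have h4 : (1 - Real.log s / s - 2 * Real.log (K₀ / 4) / s) ≠ 0 := by
    intro h5
    rw [h5, mul_zero] at h3
    have := abs_pos.2 hneg.ne
    linarith
  field_simp

/-- Substituting `|x|² = (K₀²/16) θ s` cancels the power of `θ` and leaves the ratio `s /
(2|log|x||) → 1`; at `τ = 1` only the quadratic term of `k̂` remains. -/
lemma tendsto_finalExpr {β K₀ : ℝ} (hβ : 0 < β) (hK : 0 < K₀) :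
    Tendsto (fun x : E N => theta K₀ ‖x‖ ^ (-(1 / (β + 1))) * finalExpr β x) (𝓝[≠] 0)
      (𝓝 (kHat β K₀ 1)) := by
  have hbase := kHat_base_pos (τ := 1) hβ hK le_rfl
  have h1 : Tendsto (fun x : E N => (β + 1) ^ 2 / (4 * β) * (K₀ ^ 2 / 16) *
      (-Real.log (theta K₀ ‖x‖) / (2 * |Real.log ‖x‖|))) (𝓝[≠] 0)
      (𝓝 ((β + 1) * (1 - 1) + (β + 1) ^ 2 / (4 * β) * (K₀ ^ 2 / 16))) := by
    have := (tendsto_log_theta_div (N := N) hK).const_mul ((β + 1) ^ 2 / (4 * β) * (K₀ ^ 2 / 16))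
    simpa using this
  refine (h1.rpow_const (p := 1 / (β + 1)) (Or.inl hbase.ne')).congr' ?_
  have hc : 0 < min (1 / 2) (K₀ / 4 * Real.sqrt (Real.exp (-1))) :=
    lt_min (by norm_num) (by positivity)
  filter_upwards [eventually_norm_le hc] with x hx
  obtain ⟨hx0, hx1⟩ := hx
  have hx2 := hx1.trans (min_le_right _ _)
  have hx3 := hx1.trans (min_le_left _ _)
  obtain ⟨hθ0, hθ1, -⟩ := theta_spec hK hx0 hx2
  have hsq := sqrt_theta_mul hK hx0 hx2
  have hneg : Real.log ‖x‖ < 0 := Real.log_neg hx0 (by linarith)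
  have hlpos : 0 < |Real.log ‖x‖| := abs_pos.2 hneg.ne
  rw [finalExpr]
  set θ := theta K₀ ‖x‖
  set s := -Real.log θ with hsd
  have hs0 : 0 < s := by
    have : Real.log θ ≤ -1 := (Real.log_le_iff_le_exp hθ0).2 hθ1
    linarith
  have hxe : ‖x‖ ^ 2 = K₀ ^ 2 / 16 * (θ * s) := by
    have : ‖x‖ = K₀ / 4 * Real.sqrt (θ * s) := by rw [hsq]; field_simp
    rw [this, mul_pow, Real.sq_sqrt (by positivity)]; ring
  rw [Real.rpow_neg hθ0.le, ← Real.inv_rpow hθ0.le, ← Real.mul_rpow (by positivity) (by positivity),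
    hxe]
  congr 1
  field_simp
  ring

/-- In the variable `u = |x|²` one has `log|x| = (log u)/2`. The last factor, the effect of the
logarithm on the derivative, tends to `1` at the origin. -/
lemma gradient_finalExpr {β : ℝ} (hβ : 0 < β) {x : E N} (hx0 : 0 < ‖x‖) (hx1 : ‖x‖ < 1) :
    gradient (finalExpr β) x = (finalExpr β x * (2 / (β + 1) / ‖x‖) *
      (1 + 1 / (2 * |Real.log ‖x‖|))) • (‖x‖⁻¹ • x) := by
  set p := 1 / (β + 1) with hp
  set b := (β + 1) ^ 2 / (8 * β) with hb
  have hbpos : 0 < b := by positivity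
  set u := ‖x‖ ^ 2 with hu
  have hu0 : 0 < u := by positivity
  have hu1 : u < 1 := by rw [hu, sq_lt_one_iff₀ hx0.le]; exact hx1
  have hlu : Real.log u < 0 := Real.log_neg hu0 hu1
  have hlogu : Real.log u = 2 * Real.log ‖x‖ := by rw [hu, Real.log_pow]; norm_num
  have habs : |Real.log ‖x‖| = -(Real.log u) / 2 := by
    rw [abs_of_neg (by linarith), hlogu]; ring
  have hBd : HasDerivAt (fun v : ℝ => b * (v / (-(Real.log v) / 2)))
      (b * ((1 * (-(Real.log u) / 2) - u * (-u⁻¹ / 2)) / (-(Real.log u) / 2) ^ 2)) u := by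
    refine HasDerivAt.const_mul b ?_
    exact (hasDerivAt_id' u).fun_div ((Real.hasDerivAt_log hu0.ne').fun_neg.div_const 2)
      (by linarith)
  have hBpos : 0 < b * (u / (-(Real.log u) / 2)) :=
    mul_pos hbpos (div_pos hu0 (by linarith))
  have hφ := hBd.rpow_const (p := p) (Or.inl hBpos.ne')
  have hev : (fun v : ℝ => (b * (v / |Real.log (Real.sqrt v)|)) ^ p) =ᶠ[𝓝 u]
      fun v : ℝ => (b * (v / (-(Real.log v) / 2))) ^ p := by
    filter_upwards [Ioo_mem_nhds hu0 hu1] with v hv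
    rw [Real.log_sqrt hv.1.le, abs_of_neg (by have := Real.log_neg hv.1 hv.2; linarith), neg_div]
  have hgr := gradient_radial x (hφ.congr_of_eventuallyEq hev)
  have hfun : (finalExpr β : E N → ℝ) =
      fun y : E N => (b * (‖y‖ ^ 2 / |Real.log (Real.sqrt (‖y‖ ^ 2))|)) ^ p := by
    funext y
    rw [finalExpr, Real.sqrt_sq (norm_nonneg y)]
  have hval : finalExpr β x = (b * (u / (-(Real.log u) / 2))) ^ p := by
    rw [finalExpr, habs]
  rw [hval, habs]
  rw [hfun, hgr, smul_smul]
  congr 1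
  rw [Real.rpow_sub_one hBpos.ne']
  have hnx : ‖x‖ * ‖x‖ = u := by rw [hu]; ring
  have hlne : Real.log u ≠ 0 := hlu.ne
  set Q := (b * (u / (-(Real.log u) / 2))) ^ p
  have e1 : Q * (2 / (β + 1) / ‖x‖) * (1 + 1 / (2 * (-Real.log u / 2))) * ‖x‖⁻¹ =
      Q * (2 * p) / u * (1 + 1 / (-Real.log u)) := by
    rw [hp, ← hnx]; field_simp
  rw [e1]
  field_simp
  ring

namespace Setup

variable {β : ℝ} {F χ₀ : ℝ → ℝ} {Ω : Set (E N)} {ψ Hs : E N → ℝ} {T t₀ : ℝ} {P : Params}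
  {h : ℝ → E N → ℝ}

/-- The rescaled time tends to `1` from below as `t → T`. -/
lemma tendsto_rescaled_time {θ : ℝ} (hθ : 0 < θ) (T : ℝ) :
    Tendsto (fun t => 1 - (T - t) / θ) (𝓝[<] T) (𝓝 1) ∧
      ∀ᶠ t in 𝓝[<] T, 1 - (T - t) / θ ∈ Ico (0 : ℝ) 1 := by
  have h1 := (tendsto_sub_nhdsLT T).mono_right nhdsWithin_le_nhds
  constructor
  · have := (h1.div_const θ).const_sub 1
    rwa [zero_div, sub_zero] at this
  · filter_upwards [h1.eventually (gt_mem_nhds hθ), self_mem_nhdsWithin] with t ht ht'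
    have ht' : t < T := ht'
    have h2 : 0 < (T - t) / θ := div_pos (by linarith) hθ
    have h3 : (T - t) / θ < 1 := (div_lt_one hθ).2 ht
    exact ⟨by linarith, by linarith⟩

/-- At fixed `x`, `t → T` means `τ → 1`; the bounds at `ξ = 0` are uniform in `τ < 1` and pass to
the limit. -/
lemma tendsto_hstar (S : Setup β F χ₀ Ω ψ Hs T t₀ P h) {hstar : E N → ℝ}
    (hlim : ∀ x ∈ Ω, Tendsto (fun t => h t x) (𝓝[<] T) (𝓝 (hstar x))) :
    Tendsto (fun x : E N => theta P.K₀ ‖x‖ ^ (-(1 / (β + 1))) * hstar x) (𝓝[≠] 0)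
      (𝓝 (kHat β P.K₀ 1)) := by
  have hβ := S.β_pos
  have hK := P.K₀_pos
  refine Metric.nhds_basis_closedBall.tendsto_right_iff.2 fun ε hε => ?_
  filter_upwards [S.eventually_zoom_bounds 0, S.eventually_zoom_le 0 hε] with x hx hclose
  obtain ⟨hθ0, -, -, hΩ, -⟩ := hx
  have hxΩ : x ∈ Ω := by simpa using hΩ 0 (by simp)
  obtain ⟨hτ1, hτ2⟩ := tendsto_rescaled_time hθ0 T
  have h1 := ((hlim x hxΩ).const_mul (theta P.K₀ ‖x‖ ^ (-(1 / (β + 1))))).sub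
    ((hasDerivAt_kHat (K₀ := P.K₀) hβ hK le_rfl).continuousAt.tendsto.comp hτ1)
  refine le_of_tendsto h1.abs ?_
  filter_upwards [hτ2] with t ht
  have h2 := hclose _ ht 0 (by simp)
  rw [zoom, smul_zero, add_zero] at h2
  have h3 : T - theta P.K₀ ‖x‖ + theta P.K₀ ‖x‖ * (1 - (T - t) / theta P.K₀ ‖x‖) = t := by
    field_simp; ring
  rw [h3] at h2
  exact h2

lemma tendsto_gstar (S : Setup β F χ₀ Ω ψ Hs T t₀ P h) {gstar : E N → E N}
    (hlim : ∀ x ∈ Ω, x ≠ 0 → Tendsto (fun t => gradient (h t) x) (𝓝[<] T) (𝓝 (gstar x))) :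
    Tendsto (fun x : E N => (theta P.K₀ ‖x‖ ^ (-(1 / (β + 1))) * Real.sqrt (theta P.K₀ ‖x‖) *
        Real.sqrt (-Real.log (theta P.K₀ ‖x‖))) • gstar x -
        slopeHat β P.K₀ 1 • (‖x‖⁻¹ • x)) (𝓝[≠] 0) (𝓝 0) := by
  have hβ := S.β_pos
  have hK := P.K₀_pos
  refine Metric.nhds_basis_closedBall.tendsto_right_iff.2 fun ε hε => ?_
  filter_upwards [S.eventually_zoom_bounds 0, S.eventually_gradient_zoom_le hε,
    self_mem_nhdsWithin] with x hx hclose hx0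
  obtain ⟨hθ0, -, htm, hΩ, -⟩ := hx
  have hΩ0 := hΩ 0 (by simp)
  have hxΩ : x ∈ Ω := by simpa using hΩ0
  obtain ⟨hτ1, hτ2⟩ := tendsto_rescaled_time hθ0 T
  have h1 := ((hlim x hxΩ hx0).const_smul (theta P.K₀ ‖x‖ ^ (-(1 / (β + 1))) *
    Real.sqrt (theta P.K₀ ‖x‖) * Real.sqrt (-Real.log (theta P.K₀ ‖x‖)))).sub
    (((hasDerivAt_slopeHat (K₀ := P.K₀) hβ hK le_rfl).continuousAt.tendsto.comp hτ1).smul_const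
      (‖x‖⁻¹ • x))
  rw [mem_closedBall_zero_iff]
  refine le_of_tendsto h1.norm ?_
  filter_upwards [hτ2] with t ht
  have h2 := hclose _ ht
  have h3 : T - theta P.K₀ ‖x‖ + theta P.K₀ ‖x‖ * (1 - (T - t) / theta P.K₀ ‖x‖) = t := by
    field_simp; ring
  rw [S.gradient_zoom (htm _ ht) hΩ0, h3, smul_zero, add_zero, smul_smul,
    mul_comm (Real.sqrt (-Real.log _))] at h2
  exact h2

/-- The final profile. -/
theorem hstar_isEquivalent (S : Setup β F χ₀ Ω ψ Hs T t₀ P h) {hstar : E N → ℝ}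
    (hlim : ∀ x ∈ Ω, Tendsto (fun t => h t x) (𝓝[<] T) (𝓝 (hstar x))) :
    hstar ~[𝓝[≠] 0] Hs := by
  have hβ := S.β_pos
  have hK := P.K₀_pos
  obtain ⟨c, hc, hHs⟩ := S.Hs_near
  have hk := kHat_pos (K₀ := P.K₀) hβ hK le_rfl
  have h1 : Tendsto (fun x : E N => theta P.K₀ ‖x‖ ^ (-(1 / (β + 1))) * Hs x) (𝓝[≠] 0)
      (𝓝 (kHat β P.K₀ 1)) := by
    refine (tendsto_finalExpr hβ hK).congr' ?_
    filter_upwards [eventually_norm_le hc] with x hx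
    rw [hHs x hx.1 hx.2]
  refine isEquivalent_of_smul (m := fun x : E N => theta P.K₀ ‖x‖ ^ (-(1 / (β + 1)))) hk ?_ ?_ ?_
  · filter_upwards [(tendsto_theta hK).eventually self_mem_nhdsWithin] with x hx
    exact Real.rpow_pos_of_pos hx _
  · have := (S.tendsto_hstar hlim).sub h1
    rwa [sub_self] at this
  · have := h1.norm
    rwa [Real.norm_of_nonneg hk.le] at this

/-- The final gradient profile. -/
theorem gstar_isEquivalent (S : Setup β F χ₀ Ω ψ Hs T t₀ P h) {gstar : E N → E N}
    (hlim : ∀ x ∈ Ω, x ≠ 0 → Tendsto (fun t => gradient (h t) x) (𝓝[<] T) (𝓝 (gstar x))) :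
    gstar ~[𝓝[≠] 0] gradient Hs := by
  have hβ := S.β_pos
  have hK := P.K₀_pos
  obtain ⟨c, hc, hHs⟩ := S.Hs_near
  have hk := kHat_pos (K₀ := P.K₀) hβ hK le_rfl
  have hslope : 0 < slopeHat β P.K₀ 1 := by
    have := Real.rpow_pos_of_pos hk (-β)
    unfold slopeHat; positivity
  set m : E N → ℝ := fun x => theta P.K₀ ‖x‖ ^ (-(1 / (β + 1))) * Real.sqrt (theta P.K₀ ‖x‖) *
    Real.sqrt (-Real.log (theta P.K₀ ‖x‖)) with hm
  set a : E N → ℝ := fun x => theta P.K₀ ‖x‖ ^ (-(1 / (β + 1))) * finalExpr β x *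
    (8 / ((β + 1) * P.K₀)) * (1 + 1 / (2 * |Real.log ‖x‖|)) with ha
  have hlogx : Tendsto (fun x : E N => 1 + 1 / (2 * |Real.log ‖x‖|)) (𝓝[≠] 0) (𝓝 1) := by
    have h1 : Tendsto (fun x : E N => |Real.log ‖x‖|) (𝓝[≠] 0) atTop := by
      have h2 : Tendsto (fun x : E N => ‖x‖) (𝓝[≠] 0) (𝓝[>] 0) := tendsto_norm_nhdsNE_zero
      exact tendsto_abs_atBot_atTop.comp (Real.tendsto_log_nhdsGT_zero.comp h2)
    have h3 := ((tendsto_const_nhds (x := (1 : ℝ))).div_atTop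
      (h1.const_mul_atTop (show (0 : ℝ) < 2 by norm_num))).const_add 1
    rwa [add_zero] at h3
  -- The constant propagated by the linearised flow agrees with the one found by differentiating the
  -- final profile, because `k̂(1)^{β+1} = (β+1)²K₀²/(64β)`.
  have hslope_eq : kHat β P.K₀ 1 * (8 / ((β + 1) * P.K₀)) * 1 = slopeHat β P.K₀ 1 := by
    have hbase := kHat_base_pos (τ := 1) hβ hK le_rfl
    have h1 : kHat β P.K₀ 1 ^ (β + 1) = (β + 1) ^ 2 / (4 * β) * (P.K₀ ^ 2 / 16) := by
      rw [kHat, ← Real.rpow_mul hbase.le, one_div_mul_cancel (by linarith), Real.rpow_one]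
      ring
    have h2 : kHat β P.K₀ 1 ^ (-β) = kHat β P.K₀ 1 / kHat β P.K₀ 1 ^ (β + 1) := by
      rw [show -β = 1 - (β + 1) by ring, Real.rpow_sub hk, Real.rpow_one]
    rw [slopeHat, h2, h1]
    field_simp
    ring
  have halim : Tendsto a (𝓝[≠] 0) (𝓝 (slopeHat β P.K₀ 1)) := by
    rw [← hslope_eq]
    exact ((tendsto_finalExpr hβ hK).mul_const _).mul hlogx
  have hgrad : ∀ᶠ x : E N in 𝓝[≠] 0, m x • gradient Hs x = a x • (‖x‖⁻¹ • x) := by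
    have hc' : 0 < min (c / 2) (min (1 / 2) (P.K₀ / 4 * Real.sqrt (Real.exp (-1)))) :=
      lt_min (half_pos hc) (lt_min (by norm_num) (by positivity))
    filter_upwards [eventually_norm_le hc'] with x hx
    obtain ⟨hx0, hx1⟩ := hx
    have hxc := hx1.trans (min_le_left _ _)
    have hx2 := (hx1.trans (min_le_right _ _)).trans (min_le_right _ _)
    have hx3 := (hx1.trans (min_le_right _ _)).trans (min_le_left _ _)
    have hev : Hs =ᶠ[𝓝 x] finalExpr β := by
      have h1 : ∀ᶠ y : E N in 𝓝 x, ‖y‖ ∈ Ioo 0 c :=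
        continuous_norm.continuousAt.eventually_mem (Ioo_mem_nhds hx0 (by linarith))
      filter_upwards [h1] with y hy
      exact hHs y hy.1 hy.2.le
    have hg : gradient Hs x = gradient (finalExpr β) x := by
      rw [gradient, gradient, hev.fderiv_eq]
    obtain ⟨hθ0, hθ1, -⟩ := theta_spec hK hx0 hx2
    have hsq := sqrt_theta_mul hK hx0 hx2
    rw [Real.sqrt_mul hθ0.le] at hsq
    rw [hg, gradient_finalExpr hβ hx0 (by linarith), smul_smul]
    congr 1
    rw [hm, ha]
    simp only
    rw [mul_assoc (theta P.K₀ ‖x‖ ^ _), hsq]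
    field_simp
    ring
  have hunit : ∀ᶠ x : E N in 𝓝[≠] 0, ‖‖x‖⁻¹ • x‖ = 1 := by
    filter_upwards [self_mem_nhdsWithin] with x hx
    rw [norm_smul, norm_inv, norm_norm, inv_mul_cancel₀ (norm_pos_iff.2 hx).ne']
  refine isEquivalent_of_smul (m := m) hslope ?_ ?_ ?_
  · filter_upwards [(tendsto_theta hK).eventually self_mem_nhdsWithin,
      (tendsto_neg_log_theta hK).eventually_gt_atTop 0] with x hx hs
    have hx : 0 < theta P.K₀ ‖x‖ := hx
    have := Real.rpow_pos_of_pos hx (-(1 / (β + 1)))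
    exact mul_pos (mul_pos this (Real.sqrt_pos.2 hx)) (Real.sqrt_pos.2 hs)
  · have h1 : Tendsto (fun x : E N => (slopeHat β P.K₀ 1 - a x) • (‖x‖⁻¹ • x)) (𝓝[≠] 0) (𝓝 0) := by
      have h2 := (halim.const_sub (slopeHat β P.K₀ 1)).norm
      rw [sub_self, norm_zero] at h2
      refine squeeze_zero_norm' ?_ h2
      filter_upwards [hunit] with x hx
      rw [norm_smul, hx, mul_one]
    have h3 := (S.tendsto_gstar hlim).add h1
    rw [add_zero] at h3
    refine h3.congr' ?_
    filter_upwards [hgrad] with x hx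
    rw [hx, sub_smul, sub_add_sub_cancel]
  · have h1 := halim.norm
    rw [Real.norm_of_nonneg hslope.le] at h1
    refine h1.congr' ?_
    filter_upwards [hgrad, hunit] with x hx hu
    rw [hx, norm_smul, hu, mul_one]

end Setup

/-! ### The explicit final profile near the origin, in both settings. -/

lemma BoundedSetting.infDist_pos (hN : 1 ≤ N) {β : ℝ} {Ω : Set (E N)} {ψ Hs : E N → ℝ}
    (hB : BoundedSetting β Ω ψ Hs) : 0 < Metric.infDist 0 (frontier Ω) := by
  have hNt : Nontrivial (E N) := by
    have : Nonempty (Fin N) := ⟨⟨0, hN⟩⟩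
    infer_instance
  -- `Metric.infDist` to the empty set is `0` by default, so the frontier must be shown nonempty;
  -- this needs a nontrivial space, that is `N ≥ 1`, in which a bounded set is not everything.
  have hne : (frontier Ω).Nonempty := by
    refine nonempty_frontier_iff.2 ⟨⟨0, hB.zero_mem⟩, fun h => ?_⟩
    have h1 := hB.isBounded
    rw [h] at h1
    exact NormedSpace.unbounded_univ ℝ (E N) h1
  refine (isClosed_frontier.notMem_iff_infDist_pos hne).1 fun h => ?_
  rw [hB.isOpen.frontier_eq] at h
  exact h.2 hB.zero_mem

lemma exists_Hs_near (hN : 1 ≤ N) {β α₁ : ℝ} {F : ℝ → ℝ} {Ω : Set (E N)} {ψ Hs : E N → ℝ}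
    (hΩ : BoundedSetting β Ω ψ Hs ∨ WholeSpaceSetting β α₁ F Ω ψ Hs) :
    ∃ c > 0, ∀ x : E N, 0 < ‖x‖ → ‖x‖ ≤ c → Hs x = finalExpr β x := by
  rcases hΩ with hB | hW
  · obtain ⟨c, hc, hHs⟩ := hB.Hs_near
    obtain ⟨ρ, hρ, hρΩ⟩ := Metric.isOpen_iff.1 hB.isOpen 0 hB.zero_mem
    have hd := hB.infDist_pos hN
    refine ⟨min (ρ / 2) (min c (Metric.infDist 0 (frontier Ω) / 4)),
      lt_min (half_pos hρ) (lt_min hc (by positivity)), fun x h0 h1 => hHs x (hρΩ ?_) h0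
        (h1.trans (min_le_right _ _))⟩
    rw [mem_ball_zero_iff]
    have := h1.trans (min_le_left _ _)
    linarith
  · obtain ⟨c, hc, hHs⟩ := hW.Hs_near
    exact ⟨min c (1 / 2), lt_min hc (by norm_num), hHs⟩

end Quench

end

theorem proposition5p7 {N : ℕ} (hN : 1 ≤ N) (β : ℝ) (hβ : 0 < β)
    (F : ℝ → ℝ) (hF : Quench.IsNonlinearity β F)
    (χ₀ : ℝ → ℝ) (hχ₀ : Quench.IsCutoff χ₀)
    (Ω : Set (Quench.E N)) (ψ Hs : Quench.E N → ℝ) (α₁ : ℝ)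
    (hΩ : Quench.BoundedSetting β Ω ψ Hs ∨ Quench.WholeSpaceSetting β α₁ F Ω ψ Hs)
    (T t₀ : ℝ) (hT : T < Real.exp (-1)) (ht₀ : 0 ≤ t₀) (ht₀T : t₀ < T)
    (P : Quench.Params)
    -- `θ(x)` is defined for all `0 < |x| ≤ ε₀`
    (hε₀ : P.ε₀ ≤ P.K₀ / 4 * Real.sqrt (Real.exp (-1)))
    (h : ℝ → Quench.E N → ℝ) (hsol : Quench.IsSolution F Ω t₀ T h)
    (γ d₀ : ℝ) (d₁ : Quench.E N)
    (hinit : ∀ x ∈ Ω, h t₀ x = Quench.initData β χ₀ Hs T t₀ P.K₀ γ d₀ d₁ x)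
    (htrap : Quench.Trapped β Ω ψ χ₀ P t₀ T h)
    (hδ₀ : P.δ₀ ≤ 1 / 2 * Quench.kHat β P.K₀ 1)
    (hη₀ : ∀ x ∈ Ω, P.ε₀ / 4 ≤ ‖x‖ → P.η₀ ≤ 1 / 2 * h t₀ x) :
    -- extinction at the origin at time `T`
    Tendsto (fun t => h t 0) (𝓝[<] T) (𝓝 0) ∧
    -- no extinction elsewhere: `liminf_{t → T} inf_{|y - x| ≤ r} h(y,t) > 0`
    (∀ x ∈ Ω, x ≠ 0 → ∃ r > 0, Metric.closedBall x r ⊆ Ω ∧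
      ∃ c > 0, ∀ᶠ t in 𝓝[<] T, ∀ y ∈ Metric.closedBall x r, c ≤ h t y) ∧
    -- refined intermediate profile
    (∃ C : ℝ, ∀ t ∈ Ico t₀ T, ∀ x ∈ Ω,
      |(T - t) ^ (1 / (β + 1)) / h t x - 1 / Quench.PhiHat β (Quench.zvar T t x)| ≤
        C * (Real.log |Real.log (T - t)| / |Real.log (T - t)|)) ∧
    -- refined intermediate gradient profile
    (∀ K > 0, ∃ C : ℝ, ∀ t ∈ Ico t₀ T, ∀ x ∈ Ω, ‖x‖ ≤ K * Quench.scale T t →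
      ‖(T - t) ^ (-(1 / (β + 1)) + 1 / 2) • gradient (h t) x
          - (|Real.log (T - t)| ^ (1 / 2 : ℝ))⁻¹ •
              gradient (Quench.PhiHat β) (Quench.zvar T t x)‖ ≤
        C * (Real.log |Real.log (T - t)| / |Real.log (T - t)|)) ∧
    -- final extinction profile
    (∃ hstar : Quench.E N → ℝ,
      (∀ x ∈ Ω, Tendsto (fun t => h t x) (𝓝[<] T) (𝓝 (hstar x))) ∧
      hstar ~[𝓝[≠] 0] Hs) ∧
    -- final gradient profile
    (∃ gstar : Quench.E N → Quench.E N,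
      (∀ x ∈ Ω, x ≠ 0 → Tendsto (fun t => gradient (h t) x) (𝓝[<] T) (𝓝 (gstar x))) ∧
      gstar ~[𝓝[≠] 0] gradient Hs) := by
  have hΩ' : IsOpen Ω ∧ (0 : Quench.E N) ∈ Ω ∧ ContDiff ℝ ∞ ψ := by
    rcases hΩ with hB | hW
    · exact ⟨hB.isOpen, hB.zero_mem, by rw [hB.ψ_zero]; exact contDiff_const⟩
    · exact ⟨by rw [hW.eq_univ]; exact isOpen_univ, by rw [hW.eq_univ]; exact mem_univ _,
        hW.ψ_smooth⟩
  have S : Quench.Setup β F χ₀ Ω ψ Hs T t₀ P h :=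
    { β_pos := hβ
      nonlin := hF
      cutoff := hχ₀
      isOpen := hΩ'.1
      zero_mem := hΩ'.2.1
      ψ_smooth := hΩ'.2.2
      Hs_near := Quench.exists_Hs_near hN hΩ
      T_lt := hT
      t₀_nonneg := ht₀
      t₀_lt := ht₀T
      ε₀_le := hε₀
      sol := hsol
      trap := htrap
      δ₀_le := hδ₀
      η₀_le := hη₀ }
  refine ⟨S.tendsto_zero, fun x hx hx0 => ?_, ?_, fun K hK => S.exists_gradient_profile hK, ?_, ?_⟩
  · obtain ⟨r, hr, hrΩ, c, hc, C, hb⟩ := S.exists_local_bounds hx hx0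
    exact ⟨r, hr, hrΩ, c, hc, hb.mono fun t ht y hy => (ht y hy).1⟩
  · obtain ⟨C, -, hC⟩ := S.exists_profile_bound
    refine ⟨C, fun t ht x hx => ?_⟩
    rw [Quench.one_div_PhiHat hβ, Quench.abs_log_eq_neg_log (S.sub_pos ht) (S.sub_lt ht)]
    exact hC t ht x hx
  · have hex : ∀ x ∈ Ω, ∃ l, Tendsto (fun t => h t x) (𝓝[<] T) (𝓝 l) := by
      intro x hx
      rcases eq_or_ne x 0 with rfl | hx0
      · exact ⟨0, S.tendsto_zero⟩
      · exact (S.exists_limits hx hx0).1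
    choose! hstar hlim using hex
    exact ⟨hstar, hlim, S.hstar_isEquivalent hlim⟩
  · have hex : ∀ x ∈ Ω, x ≠ 0 → ∃ g, Tendsto (fun t => gradient (h t) x) (𝓝[<] T) (𝓝 g) :=
      fun x hx hx0 => (S.exists_limits hx hx0).2
    choose! gstar hlim using hex
    exact ⟨gstar, hlim, S.gstar_isEquivalent hlim⟩
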